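/- **Model.** Let $G=(V,E)$ be a directed graph with $n=|V|\ge 1$ and $m=|E|$, and for every node $v$ let $D_v$ be a distribution on subsets of the in-neighbours $N^-(v)$ (triggering model). Independent triggering sets $T_v\sim D_v$ are drawn; the seeds $S$ are active at time $0$, and $v$ becomes active at time $t$ if some node of $T_v$ is active at time $t-1$; $\sigma(S)$ is the expected number of finally active nodes. A strategy mix $x\in\mathbb R^d_+$, $d\ge1$, makes each node $v$ a seed independently with probability $h_v(x)\in[0,1]$; $g(x)=\sum_{S\subseteq V}\sigma(S)\prod_{u\in S}h_u(x)\prod_{v\notin S}(1-h_v(x))$. Let $c=\|\cdot\|_1$ or $c=\|\cdot\|_2$, with Lipschitz constant $L_c=\sqrt d$ or $L_c=1$ respectively, $k,\lambda\ge0$, $\mathcal P=\{x\in\mathbb R^d_+: c(x)\le k\}$, $s(x)=\lambda(k-c(x))$, $N=n+\lambda k$, and let $\Delta$ be an upper bound on the Euclidean diameter of $\mathcal P$. Let $0<\varepsilon<1$ and $\ell>0$. An RR set is the set of nodes from which a uniformly random root can be reached along the edges $\{(u,v):u\in T_v\}$. For a sequence $\mathcal R$ of $\theta$ RR sets put $\hat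 g_{\mathcal R}(x)=\frac n\theta\sum_{R\in\mathcal R}\bigl(1-\prod_{v\in R}(1-h_v(x))\bigr)$ and $\nu^{(i)}(\mathcal R)=\frac1\theta\sum_{R\in\mathcal R}|R|^i$. $\mathcal N(\mathcal P,r)$ is the covering number of $\mathcal P$ by Euclidean balls of radius $r$. **Grad-RIS**, for a gradient algorithm $\mathcal A$, a ratio $\alpha$ and a common Lipschitz constant $L$ of $g+s$ and $\hat g_{\mathcal R}+s$. Put $LB=1$, $\varepsilon'=\sqrt2\,\varepsilon/3$. For $i=1,\dots,\lfloor\log_2N-1\rfloor$: let $x_i=N/2^i$; extend the sequence of RR sets to $\mathcal R_i$ of length $$\theta_i=\Bigl\lceil n\bigl(2+\tfrac23\varepsilon'\bigr)\frac{\ln\mathcal N(\mathcal P,\frac{\varepsilon/3}{L}x_i)+\ell\ln n+\ln2+\ln\log_2N}{\varepsilon'^2x_i}\Bigr\rceil;$$ let $y_i=\mathcal A(\mathcal R_i)$; if $(\hat g_{\mathcal R_i}+s)(y_i)\ge(1+\varepsilon'+\varepsilon/3)x_i$, put $LB=(\hat g_{\mathcal R_i}+s)(y_i)/(1+\varepsilon'+\varepsilon/3)$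 and leave the loop. Then generate a sequence $\mathcal R$ of $\lceil\max\{\theta^{(1)},\theta^{(2)}\}\rceil$ fresh RR sets, where with $\alpha'=\alpha-\varepsilon/3$ $$\theta^{(1)}=\frac{8n\ln(4n^\ell)}{LB\,\alpha'^2\varepsilon^2/9},\qquad \theta^{(2)}=\frac{2\alpha' n\ln\bigl(4n^\ell\mathcal N(\mathcal P,\frac{\varepsilon/3}{2L}LB)\bigr)}{(\frac\varepsilon3-\frac14\alpha'^2\frac\varepsilon3)^2LB},$$ and return $\mathcal A(\mathcal R)$. **ProxGrad-RIS** is Grad-RIS with $\alpha=\frac12$, $L=n^2L_h+\lambda L_c$, and the $\mathcal A$ that, with $\beta=\nu^{(1)}(\mathcal R)n\beta_h+\nu^{(2)}(\mathcal R)nL_h^2$, performs $\lceil3\beta\Delta^2/(4\varepsilon)\rceil$ proximal gradient steps $x\leftarrow\arg\min_{y\in\mathcal P}\bigl(\frac\lambda\beta c(y)+\frac12\|x+\frac1\beta\nabla\hat g_{\mathcal R}(x)-y\|_2^2\bigr)$ from a given point of $\mathcal P$ and returns the iterate with the largest value of $\hat g_{\mathcal R}+s$. **UpperGrad-RIS**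 (for independent strategy activation, $h_v(x)=1-\prod_{j\le d}(1-q_{v,j}(x_j))$) is Grad-RIS with $\alpha=1-\frac1e$, $L=n^2\sqrt d\,L_q+\lambda L_c$, and the $\mathcal A$ that performs $\lceil9(\Delta L_{\mathcal R})^2/\varepsilon^2\rceil$ projected subgradient steps of sizes $\Delta/(L_{\mathcal R}\sqrt t)$, with $L_{\mathcal R}=\nu^{(1)}(\mathcal R)n\sqrt d\,L_q+\lambda L_c$, for $\bar g_{\mathcal R}+s$ on $\mathcal P$, where $\bar g_{\mathcal R}(x)=\frac n\theta\sum_{R\in\mathcal R}\min\{1,\sum_{v\in R,j\le d}q_{v,j}(x_j)\}$, and returns the iterate with the largest value of $\bar g_{\mathcal R}+s$. Running time counts elementary steps, an arithmetic operation or comparison of real numbers being one step (up to a constant factor), and so is the evaluation of the formulas for $\theta_i,\theta^{(1)},\theta^{(2)}$. RR sets are generated by reverse search, sampling $T_v$ when $v$ is reached. **Assumptions.** (1) Sampling $T_v$ takes time at most proportional to the in-degree of $v$ (at most $a(|N^-(v)|+1)$ for a constant $a$). (2) $\max_{x\in\mathcal P}g(x)\ge\max_{v\in V}\sigma(\{v\})$.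 (3) $\lambda k\le n$. **Theorem.** (i) Suppose the $h_v$ are monotone, DR-submodular, $L_h$-Lipschitz and $\beta_h$-smooth on $\mathbb R^d_+$, that $h_v(x)$ and $\nabla h_v(x)$ can be computed in time $T_h\ge1$, and that $\beta_hn^2+L_h^2n^3\ge\varepsilon$. Then the expected running time of ProxGrad-RIS is $$\tilde O\Bigl(\frac{\beta_hn^2+L_h^2n^3}{\varepsilon}\cdot\frac{T_h(m+n)(d+\ell)}{\varepsilon^2}\Bigr).$$ (ii) Under independent strategy activation, suppose the $q_{v,j}:[0,\infty)\to[0,1]$ are non-decreasing, concave, differentiable and $L_q$-Lipschitz, that a value and a derivative of $q_{v,j}$ can be computed in time $T_q\ge1$, and that $n^2\sqrt d\,L_q\ge L_c$. Then the expected running time of UpperGrad-RIS is $$\tilde O\Bigl(\frac{n^4dL_q^2}{\varepsilon^2}\cdot\frac{T_q(m+n)(d+\ell)}{\varepsilon^2}\Bigr).$$ Here $\tilde O(B)$ means at most $C\,B\,\ln^p(2+n+d+1/\varepsilon+L)$, with $L=L_h$ in (i) and $L=L_q$ in (ii), where $C$ and $p$ depend only on $a$ and an upper bound on $\Delta$ and,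 in (ii), also on an upper bound on $\lambda$. -/

import Mathlib

open MeasureTheory
open scoped ENNReal

noncomputable section

namespace CIM

/-! ## Computations with a step count

A `Timed α` is the result of a computation together with the number of elementary steps it took.
An elementary step is an operation on numbers (arithmetic, comparison, square root, logarithm) or
one access to an array; a fixed number of them is charged as one `tick`. -/

structure Timed (α : Type) where
  val : α
  time : ℕ

namespace Timed

instance : Monad Timed where
  pure a := ⟨a, 0⟩
  bind x f := ⟨(f x.val).val, x.time + (f x.val).time⟩

/-- Spend `k` steps. -/
def tick (k : ℕ) : Timed Unit := ⟨(), k⟩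

/-- A loop over `l` with loop state `s`; every pass costs one step on top of its body. -/
def loop {σ α : Type} (f : σ → α → Timed σ) : σ → List α → Timed σ
  | s, [] => pure s
  | s, a :: l => do
    tick 1
    let s' ← f s a
    loop f s' l

/-- Run `f` on every entry of a list and collect the results. -/
def mapList {α β : Type} (f : α → Timed β) (l : List α) : Timed (List β) :=
  ⟨l.map fun a => (f a).val, (l.map fun a => (f a).time + 1).sum⟩

/-- Run `f` on every entry of a list and add up the results. -/
def sumList {α : Type} (f : α → Timed ℝ) (l : List α) : Timed ℝ :=
  ⟨(l.map fun a => (f a).val).sum, (l.map fun a => (f a).time + 1).sum⟩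

/-- Run `f` on every entry of a list and multiply the results. -/
def prodList {α : Type} (f : α → Timed ℝ) (l : List α) : Timed ℝ :=
  ⟨(l.map fun a => (f a).val).prod, (l.map fun a => (f a).time + 1).sum⟩

/-- Fill an array of length `m`. -/
def tabulate {m : ℕ} {β : Type} (f : Fin m → Timed β) : Timed (Fin m → β) :=
  ⟨fun i => (f i).val, ∑ i, ((f i).time + 1)⟩

/-- Merge two lists sorted in decreasing order; each comparison puts one entry in place. -/
def merge (l₁ l₂ : List ℝ) : Timed (List ℝ) :=
  ⟨List.merge l₁ l₂ (fun a b => decide (b ≤ a)), l₁.length + l₂.length⟩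

/-- Merge sort (decreasing) with recursion depth at most `fuel`; splitting is charged too. -/
def mergeSortAux : ℕ → List ℝ → Timed (List ℝ)
  | 0, l => pure l
  | fuel + 1, l =>
    if l.length ≤ 1 then do
      tick 1
      pure l
    else do
      tick (l.length + 1)
      let l₁ ← mergeSortAux fuel (l.take (l.length / 2))
      let l₂ ← mergeSortAux fuel (l.drop (l.length / 2))
      merge l₁ l₂

def mergeSort (l : List ℝ) : Timed (List ℝ) := mergeSortAux l.length l

end Timed

open Timed

/-! ## The triggering model -/

/-- A directed graph on the nodes `Fin n`, with a distribution on sets of in-neighbours for every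
node. -/
structure Network (n : ℕ) where
  E : Finset (Fin n × Fin n)
  D : Fin n → PMF (Finset (Fin n))
  support_D : ∀ v, ∀ T ∈ (D v).support, ∀ u ∈ T, (u, v) ∈ E

variable {n d : ℕ}

namespace Network

/-- The adjacency list of in-neighbours. -/
def inList (G : Network n) (v : Fin n) : List (Fin n) :=
  (List.finRange n).filter fun u => (u, v) ∈ G.E

def inDegree (G : Network n) (v : Fin n) : ℕ := (Finset.univ.filter fun u => (u, v) ∈ G.E).card

/-- The active nodes at time `t`, for the seed set `S` and the triggering sets `T`. -/
def activeAt (T : Fin n → Finset (Fin n)) (S : Finset (Fin n)) : ℕ → Finset (Fin n)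
  | 0 => S
  | t + 1 => activeAt T S t ∪ Finset.univ.filter fun v => ∃ u ∈ T v, u ∈ activeAt T S t

open Classical in
/-- The nodes that become active at some time. -/
def finalActive (T : Fin n → Finset (Fin n)) (S : Finset (Fin n)) : Finset (Fin n) :=
  Finset.univ.filter fun v => ∃ t, v ∈ activeAt T S t

/-- The influence spread `σ(S)` of a seed set: the expected number of finally active nodes, the
triggering sets being drawn independently. -/
def spread (G : Network n) (S : Finset (Fin n)) : ℝ :=
  ∑ T : Fin n → Finset (Fin n), (∏ v, (G.D v (T v)).toReal) * ((finalActive T S).card : ℝ)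

end Network

/-! ## Strategy mixes and the optimization problem -/

/-- Strategy mixes are vectors of `ℝ^d` with the Euclidean norm. -/
abbrev Mix (d : ℕ) : Type := EuclideanSpace ℝ (Fin d)

/-- The domain `ℝ₊^d`. -/
def orthant (d : ℕ) : Set (Mix d) := {x | ∀ i, 0 ≤ x i}

inductive CostNorm
  | one
  | two

def cost (c : CostNorm) (x : Mix d) : ℝ :=
  match c with
  | .one => ∑ i, |x i|
  | .two => ‖x‖

/-- The Lipschitz constant `L_c` of the cost with respect to the Euclidean norm. -/
def costLip (c : CostNorm) (d : ℕ) : ℝ :=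
  match c with
  | .one => √(d : ℝ)
  | .two => 1

/-- The feasible strategy mixes `𝒫` for budget `k`. -/
def feasible (c : CostNorm) (k : ℝ) (d : ℕ) : Set (Mix d) := {x | x ∈ orthant d ∧ cost c x ≤ k}

def IsMonotone (f : Mix d → ℝ) : Prop :=
  ∀ x ∈ orthant d, ∀ y ∈ orthant d, (∀ i, x i ≤ y i) → f x ≤ f y

def IsDRSubmodular (f : Mix d → ℝ) : Prop :=
  ∀ x ∈ orthant d, ∀ y ∈ orthant d, (∀ i, x i ≤ y i) → ∀ (i : Fin d) (δ : ℝ), 0 < δ →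
    f (y + EuclideanSpace.single i δ) - f y ≤ f (x + EuclideanSpace.single i δ) - f x

def IsLipschitz (L : ℝ) (f : Mix d → ℝ) : Prop :=
  ∀ x ∈ orthant d, ∀ y ∈ orthant d, |f x - f y| ≤ L * ‖x - y‖

/-- `f` has the gradient `f'` on `ℝ₊^d` (one-sided on the boundary), and it is `β`-Lipschitz. -/
def IsSmooth (β : ℝ) (f : Mix d → ℝ) (f' : Mix d → Mix d) : Prop :=
  (∀ x ∈ orthant d, HasGradientWithinAt f (f' x) (orthant d) x) ∧
  ∀ x ∈ orthant d, ∀ y ∈ orthant d, ‖f' x - f' y‖ ≤ β * ‖x - y‖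

/-- The influence spread `g(x)` of a strategy mix, for the strategy activation functions `h`. -/
def influence (G : Network n) (h : Fin n → Mix d → ℝ) (x : Mix d) : ℝ :=
  ∑ S : Finset (Fin n), G.spread S * ((∏ u ∈ S, h u x) * ∏ v ∈ Sᶜ, (1 - h v x))

/-- The strategy activation functions under independent strategy activation. -/
def independentActivation (q : Fin n → Fin d → ℝ → ℝ) (v : Fin n) (x : Mix d) : ℝ :=
  1 - ∏ j, (1 - q v j (x j))

/-- The covering number `𝒩(P, r)` (radius `r`, centres anywhere in the space). -/
def covering (P : Set (Mix d)) (r : ℝ) : ℝ :=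
  ((Metric.externalCoveringNumber r.toNNReal P).toNat : ℝ)

/-! ## Generating reverse reachable sets -/

/-- What one RR set is generated from: its root, and the triggering sets of all nodes. -/
abbrev Sample (n : ℕ) : Type := Fin n × (Fin n → Finset (Fin n))

/-- An RR set, as a list of its nodes without repetition. -/
abbrev RRSet (n : ℕ) : Type := List (Fin n)

/-- The reverse propagation. `todo` holds the nodes reached but not yet processed, `seen` all nodes
reached; `seen` comes with an array of marks, so that testing membership is one step. When a node
`u` is processed, its triggering set `T u` is sampled, in time `sampleTime u`, and its
adjacency list is scanned. Triggering sets of other nodes are not looked at. -/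
def rrLoop (G : Network n) (sampleTime : Fin n → ℕ) (T : Fin n → Finset (Fin n)) :
    ℕ → List (Fin n) → RRSet n → Timed (RRSet n)
  | 0, _, seen => pure seen
  | _ + 1, [], seen => pure seen
  | fuel + 1, u :: todo, seen => do
    tick (sampleTime u + 1)
    let s ← loop (fun (s : List (Fin n) × RRSet n) w =>
      pure (if w ∈ T u ∧ w ∉ s.2 then (w :: s.1, w :: s.2) else s)) (todo, seen) (G.inList u)
    rrLoop G sampleTime T fuel s.1 s.2

def rrGenerate (G : Network n) (sampleTime : Fin n → ℕ) (w : Sample n) : Timed (RRSet n) := do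
  tick 1
  rrLoop G sampleTime w.2 n [w.1] [w.1]

/-- The law of the randomness behind one RR set: a uniform root and independent triggering sets. -/
def sampleLaw [NeZero n] (G : Network n) : Measure (Sample n) :=
  (PMF.uniformOfFintype (Fin n)).toMeasure.prod (Measure.pi fun v => (G.D v).toMeasure)

/-- The randomness of a whole run: two independent sequences of independent samples. -/
abbrev Tape (n : ℕ) : Type := (ℕ → Sample n) × (ℕ → Sample n)

def tapeLaw [NeZero n] (G : Network n) : Measure (Tape n) :=
  (Measure.infinitePi fun _ : ℕ => sampleLaw G).prod (Measure.infinitePi fun _ : ℕ => sampleLaw G)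

/-! ## Common subroutines -/

/-- The parameters of the algorithms. -/
structure Setting (n d : ℕ) where
  net : Network n
  /-- time for sampling a triggering set of a node -/
  sampleTime : Fin n → ℕ
  costNorm : CostNorm
  /-- the budget -/
  k : ℝ
  /-- the balance parameter `λ` -/
  lam : ℝ
  /-- the approximation parameter -/
  ε : ℝ
  /-- the confidence parameter -/
  ℓ : ℝ
  /-- an upper bound `Δ` on the diameter of the feasible set -/
  diam : ℝ
  /-- the starting point of the gradient iterations -/
  start : Mix d

namespace Setting

variable (S : Setting n d)

abbrev P : Set (Mix d) := feasible S.costNorm S.k d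

def edges : ℕ := S.net.E.card

def normT (x : Mix d) : Timed ℝ := do
  let s ← sumList (fun i => do tick 1; pure (x i ^ 2)) (List.finRange d)
  tick 1
  pure √s

def costT (x : Mix d) : Timed ℝ :=
  match S.costNorm with
  | .one => sumList (fun i => do tick 1; pure |x i|) (List.finRange d)
  | .two => normT x

/-- The proximal step: computes the `y ∈ 𝒫` that minimizes `t * c(y) + ‖z - y‖² / 2`. For `t = 0`
it is the projection to `𝒫`. For the 1-norm, `y i = max (z i - τ) 0` with the smallest threshold
`τ ≥ t` for which `y` is within budget; it is found from the partial sums of the sorted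
coordinates. For the 2-norm, `y` is a multiple of the positive part of `z`. -/
def proxT (t : ℝ) (z : Mix d) : Timed (Mix d) :=
  match S.costNorm with
  | .one => do
    let l ← mergeSort (List.ofFn fun i => z i)
    let s ← loop (fun (s : ℝ × ℝ × ℝ) a => do
      tick 1
      pure (s.1 + a, s.2.1 + 1, max s.2.2 ((s.1 + a - S.k) / (s.2.1 + 1)))) (0, 0, t) l
    let y ← tabulate fun i => do tick 1; pure (max (z i - s.2.2) 0)
    pure (WithLp.toLp 2 y)
  | .two => do
    let p ← tabulate fun i => do tick 1; pure (max (z i) 0)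
    let r ← normT (WithLp.toLp 2 p)
    tick 1
    let y ← tabulate fun i => do
      tick 1
      pure (if r = 0 then 0 else min (max (r - t) 0) S.k / r * p i)
    pure (WithLp.toLp 2 y)

/-- `(ĝ_R + s)(x)`, where `evalH v` computes `h_v(x)`; every `h_v(x)` is computed once. -/
def objHatT (evalH : Fin n → Mix d → Timed ℝ) (R : List (RRSet n)) (x : Mix d) : Timed ℝ := do
  let H ← tabulate fun v => evalH v x
  let a ← sumList (fun r => do
    let p ← prodList (fun v => do tick 1; pure (1 - H v)) r
    tick 1
    pure (1 - p)) R
  let c ← S.costT x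
  tick 1
  pure ((n : ℝ) / R.length * a + S.lam * (S.k - c))

/-- The `m`-th moment `ν^(m)(R)` of the sizes of the RR sets, by counting their nodes. -/
def moment (m : ℕ) (R : List (RRSet n)) : Timed ℝ := do
  let a ← sumList (fun r => do tick (r.length + 1); pure ((r.length : ℝ) ^ m)) R
  tick 1
  pure (a / R.length)

/-- `T` iterations `x ← step t x`; returns the iterate, the starting point included, with the
largest value of `obj`. -/
def bestIterate (step : ℕ → Mix d → Timed (Mix d)) (obj : Mix d → Timed ℝ) (T : ℕ) :
    Timed (Mix d) := do
  let v₀ ← obj S.start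
  let r ← loop (fun (s : Mix d × Mix d × ℝ) t => do
    let x ← step t s.1
    let v ← obj x
    tick 1
    pure (if s.2.2 < v then (x, x, v) else (x, s.2.1, s.2.2)))
    (S.start, S.start, v₀) (List.range T)
  pure r.2.1

/-! ## The meta-algorithm -/

/-- The input `x_i = (n + λk) / 2^i` of round `i`. -/
def guess (i : ℕ) : ℝ := (n + S.lam * S.k) / 2 ^ i

def ε' : ℝ := √2 * S.ε / 3

/-- The number of rounds. -/
def rounds : ℕ := ⌊Real.logb 2 (n + S.lam * S.k) - 1⌋₊

/-- The number `θ_i` of RR sets of round `i`, for the Lipschitz constant `L` of `ĝ_R + s`. -/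
def theta (L : ℝ) (i : ℕ) : ℕ :=
  ⌈(n : ℝ) * (2 + 2 / 3 * S.ε') *
      ((Real.log (covering S.P (S.ε / 3 / L * S.guess i)) + S.ℓ * Real.log n + Real.log 2
          + Real.log (Real.logb 2 (n + S.lam * S.k)))
        / (S.ε' ^ 2 * S.guess i))⌉₊

/-- The final number of RR sets, for the approximation ratio `α` and the Lipschitz constants
`L₁ = L₂ = L` of `g + s` and `ĝ_R + s`. -/
def thetaFinal (α L LB : ℝ) : ℕ :=
  ⌈max
    (8 * n * Real.log (4 * (n : ℝ) ^ S.ℓ) / (LB * (α - S.ε / 3) ^ 2 * (S.ε ^ 2 / 9)))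
    (2 * (α - S.ε / 3) * n *
        Real.log (4 * (n : ℝ) ^ S.ℓ * covering S.P (S.ε / 3 / (L + L) * LB))
      / ((S.ε / 3 - 1 / 4 * (α - S.ε / 3) ^ 2 * (S.ε / 3)) ^ 2 * LB))⌉₊

/-- The rounds of the sampling procedure, from round `i` on with `fuel` rounds left and the RR sets
`R` of the previous round. Returns the lower bound `LB`. `grad` is the gradient algorithm and
`obj` evaluates `ĝ_R + s`. -/
def samplingLoop (L : ℝ) (grad : List (RRSet n) → Timed (Mix d))
    (obj : List (RRSet n) → Mix d → Timed ℝ) (w : ℕ → Sample n) :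
    ℕ → ℕ → List (RRSet n) → Timed ℝ
  | 0, _, _ => pure 1
  | fuel + 1, i, R => do
    tick 1
    let new ← mapList (fun j => rrGenerate S.net S.sampleTime (w j))
      (List.range' R.length (S.theta L i - R.length))
    let y ← grad (R ++ new)
    let a ← obj (R ++ new) y
    if (1 + S.ε' + S.ε / 3) * S.guess i ≤ a then
      pure (a / (1 + S.ε' + S.ε / 3))
    else
      samplingLoop L grad obj w fuel (i + 1) (R ++ new)

/-- `Grad-RIS`: find `LB`, generate fresh RR sets, and run the gradient algorithm on them. -/
def gradRIS (α L : ℝ) (grad : List (RRSet n) → Timed (Mix d))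
    (obj : List (RRSet n) → Mix d → Timed ℝ) (w : Tape n) : Timed (Mix d) := do
  let LB ← S.samplingLoop L grad obj w.1 S.rounds 1 []
  tick 1
  let R ← mapList (fun j => rrGenerate S.net S.sampleTime (w.2 j))
    (List.range (S.thetaFinal α L LB))
  grad R

/-! ## ProxGrad-RIS -/

/-- For the nodes `v` of an RR set, the products of `1 - H u` over the nodes `u ≠ v` of it; `p` is
the product over the nodes before. Also returns the product over all nodes of the list. -/
def leaveOneOut (H : Fin n → ℝ) : ℝ → RRSet n → Timed (ℝ × List (Fin n × ℝ))
  | _, [] => pure (1, [])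
  | p, v :: r => do
    tick 1
    let s ← leaveOneOut H (p * (1 - H v)) r
    pure ((1 - H v) * s.1, (v, p * s.1) :: s.2)

/-- The exact gradient of `ĝ_R` at `x`, namely `(n/θ) ∑_{r ∈ R, v ∈ r} (∏_{u ∈ r, u ≠ v} (1 - h_u)) ∇h_v`.
A call that returns `h_v(x)` and `∇h_v(x)` takes time `Th`, and there is one for each node. -/
def gradHatT (h : Fin n → Mix d → ℝ) (h' : Fin n → Mix d → Mix d) (Th : ℕ)
    (R : List (RRSet n)) (x : Mix d) : Timed (Mix d) := do
  let O ← tabulate fun v => do tick Th; pure (h v x, h' v x)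
  let a₀ ← tabulate fun _ : Fin n => pure (0 : ℝ)
  let a ← loop (fun (a : Fin n → ℝ) r => do
    let s ← leaveOneOut (fun v => (O v).1) 1 r
    loop (fun (a : Fin n → ℝ) vc => pure (Function.update a vc.1 (a vc.1 + vc.2))) a s.2) a₀ R
  let y ← tabulate fun i => do
    let b ← sumList (fun v => do tick 1; pure (a v * (O v).2 i)) (List.finRange n)
    tick 1
    pure ((n : ℝ) / R.length * b)
  pure (WithLp.toLp 2 y)

def objProx (h : Fin n → Mix d → ℝ) (Th : ℕ) : List (RRSet n) → Mix d → Timed ℝ :=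
  S.objHatT fun v x => do tick Th; pure (h v x)

/-- The proximal gradient algorithm for `ĝ_R + s`, with step size `1/β` and
`⌈3 β Δ² / (4ε)⌉` steps, where `β = ν¹(R) n β_h + ν²(R) n L_h²`. -/
def proxGrad (h : Fin n → Mix d → ℝ) (h' : Fin n → Mix d → Mix d) (Lh βh : ℝ) (Th : ℕ)
    (R : List (RRSet n)) : Timed (Mix d) := do
  let ν₁ ← moment 1 R
  let ν₂ ← moment 2 R
  tick 1
  let β := ν₁ * n * βh + ν₂ * n * Lh ^ 2
  S.bestIterate
    (fun _ x => do
      let v ← gradHatT h h' Th R x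
      let z ← tabulate fun i => do tick 1; pure (x i + 1 / β * v i)
      S.proxT (1 / β * S.lam) (WithLp.toLp 2 z))
    (S.objProx h Th R)
    ⌈3 * β * S.diam ^ 2 / (4 * S.ε)⌉₊

def proxGradRIS (h : Fin n → Mix d → ℝ) (h' : Fin n → Mix d → Mix d) (Lh βh : ℝ) (Th : ℕ)
    (w : Tape n) : Timed (Mix d) :=
  S.gradRIS (1 / 2) ((n : ℝ) ^ 2 * Lh + S.lam * costLip S.costNorm d)
    (S.proxGrad h h' Lh βh Th) (S.objProx h Th) w

/-! ## UpperGrad-RIS -/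

/-- `(ĝ_R + s)(x)` under independent strategy activation; a call that returns `q_{v,j}(t)` takes
time `Tq`. -/
def objUpper (q : Fin n → Fin d → ℝ → ℝ) (Tq : ℕ) : List (RRSet n) → Mix d → Timed ℝ :=
  S.objHatT fun v x => do
    let p ← prodList (fun j => do tick (Tq + 1); pure (1 - q v j (x j))) (List.finRange d)
    tick 1
    pure (1 - p)

/-- `(ḡ_R + s)(x)`, where `ḡ_R(x) = (n/θ) ∑_{r ∈ R} min(1, ∑_{v ∈ r, j} q_{v,j}(x_j))`. -/
def objBarT (q : Fin n → Fin d → ℝ → ℝ) (Tq : ℕ) (R : List (RRSet n)) (x : Mix d) :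
    Timed ℝ := do
  let Q ← tabulate fun v =>
    sumList (fun j => do tick Tq; pure (q v j (x j))) (List.finRange d)
  let a ← sumList (fun r => do
    let b ← sumList (fun v => do tick 1; pure (Q v)) r
    tick 1
    pure (min 1 b)) R
  let c ← S.costT x
  tick 1
  pure ((n : ℝ) / R.length * a + S.lam * (S.k - c))

/-- A subgradient of `ḡ_R + s` at `x`. An RR set `r` with `∑_{v ∈ r, j} q_{v,j}(x_j) < 1` contributes
`∑_{v ∈ r} q'_{v,j}(x_j)` to coordinate `j` (before the factor `n/θ`), any other nothing. The
subgradient of the cost is `(1, …, 1)` for the 1-norm, `x/‖x‖` for the 2-norm (`0` at `x = 0`). -/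
def subgradT (q q' : Fin n → Fin d → ℝ → ℝ) (Tq : ℕ) (R : List (RRSet n)) (x : Mix d) :
    Timed (Mix d) := do
  let Q ← tabulate fun v => tabulate fun j => do tick Tq; pure (q v j (x j), q' v j (x j))
  let Qs ← tabulate fun v => sumList (fun j => do tick 1; pure (Q v j).1) (List.finRange d)
  let a₀ ← tabulate fun _ : Fin n => pure (0 : ℝ)
  let a ← loop (fun (a : Fin n → ℝ) r => do
    let b ← sumList (fun v => do tick 1; pure (Qs v)) r
    tick 1
    if b < 1 then
      loop (fun (a : Fin n → ℝ) v => pure (Function.update a v (a v + 1))) a r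
    else pure a) a₀ R
  let ρ ← normT x
  let y ← tabulate fun j => do
    let b ← sumList (fun v => do tick 1; pure (a v * (Q v j).2)) (List.finRange n)
    tick 1
    pure ((n : ℝ) / R.length * b - S.lam * (match S.costNorm with
      | .one => 1
      | .two => x j / ρ))
  pure (WithLp.toLp 2 y)

/-- The projected subgradient method for `ḡ_R + s`, with `⌈9 (Δ L)² / ε²⌉` steps of sizes
`Δ / (L √t)`, `t = 1, 2, …`, where `L = ν¹(R) n √d L_q + λ L_c`. -/
def upperGrad (q q' : Fin n → Fin d → ℝ → ℝ) (Lq : ℝ) (Tq : ℕ)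
    (R : List (RRSet n)) : Timed (Mix d) := do
  let ν₁ ← moment 1 R
  tick 1
  let L := ν₁ * n * √(d : ℝ) * Lq + S.lam * costLip S.costNorm d
  S.bestIterate
    (fun t x => do
      let v ← S.subgradT q q' Tq R x
      let z ← tabulate fun i => do
        tick 1
        pure (x i + S.diam / (L * √((t : ℝ) + 1)) * v i)
      S.proxT 0 (WithLp.toLp 2 z))
    (S.objBarT q Tq R)
    ⌈9 * (S.diam * L) ^ 2 / S.ε ^ 2⌉₊

def upperGradRIS (q q' : Fin n → Fin d → ℝ → ℝ) (Lq : ℝ) (Tq : ℕ)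
    (w : Tape n) : Timed (Mix d) :=
  S.gradRIS (1 - 1 / Real.exp 1)
    ((n : ℝ) ^ 2 * √(d : ℝ) * Lq + S.lam * costLip S.costNorm d)
    (S.upperGrad q q' Lq Tq) (S.objUpper q Tq) w

/-! ## Standing assumptions -/

/-- The assumptions common to both results. `a` bounds the constant in the time for sampling
triggering sets, which is proportional to the in-degree; `h` are the strategy activation
functions. -/
structure Admissible (a : ℕ) (h : Fin n → Mix d → ℝ) : Prop where
  sampleTime_le : ∀ v, S.sampleTime v ≤ a * (S.net.inDegree v + 1)
  k_nonneg : 0 ≤ S.k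
  lam_nonneg : 0 ≤ S.lam
  lam_mul_k_le : S.lam * S.k ≤ n
  ε_pos : 0 < S.ε
  ε_lt_one : S.ε < 1
  ℓ_pos : 0 < S.ℓ
  start_mem : S.start ∈ S.P
  le_diam : ∀ x ∈ S.P, ∀ y ∈ S.P, ‖x - y‖ ≤ S.diam
  /-- the best strategy mix has at least the influence spread of the best single node -/
  spread_le : ∀ v, ∃ x ∈ S.P, S.net.spread {v} ≤ influence S.net h x

end Setting

end CIM

end

/-! The number of iterations of either gradient method is bounded deterministically, because ν^(i) ≤
n^i (`moment_le`). One iteration is linear in a fixed cost `unitCost` plus the total width of the RR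
sets in use, where the width of a set counts its nodes and the edges entering them. Generating the
sets costs a multiple of their width as well. So everything reduces to the expected total width of
the RR sets used in all rounds (`lintegral_time_gradRIS_le`).

Let σ be the largest spread of a single node. A node u lies in a random RR set with probability
σ({u})/n, so the expected width of a set is at most (m+n)σ/n (`mean_width`, `meanWidth_le`). Round i
uses O(nK/x_i) sets with K = Γ(d+ℓ)/ε², where Γ dominates all logarithms; the covering number
contributes d times a logarithm (`covering_le`). A round with x_i far below σ is too expensive, but
it is rarely reached. The optimum is at least σ, and the gradient method finds half of ĝ_R(u), up to
1/3, for every feasible u (`proxGrad_spec`, `upperGrad_spec`). So if round i does not stop, ĝ_R(u) <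
4x_i for a mix u with g(u) ≥ σ, and an exponential moment bounds the probability of this by 16x_i/σ
(`exists_failure_bound`). The expected width used in round i+1 is then of order
(x_i/σ)(nK/x_{i+1})((m+n)σ/n) = O(K(m+n)): the unknown σ cancels. In the same way 1/LB has
expectation O((number of rounds + 1)/σ), and the last RR sets are fresh, so they obey a similar
bound.

RR sets are reused from round to round, so not stopping is correlated with the widths paid for
later. The bound on the indicator of not stopping is a product over the samples; integrated against
a function of one sample, it loses only the factor of that sample, which costs at most e^{1/2}
(`lintegral_exp_mul_le`).

For the proximal method, a nonnegative monotone DR-submodular F satisfies F(y) − 2F(x) ≤ ⟨∇F(x), y −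
x⟩ (`inner_gradient_ge`); with the ascent lemma and the variational inequality of the proximal step
this telescopes to half the optimum. For the subgradient method, ḡ_R is a concave upper bound of ĝ_R
within a factor 1 − 1/e, and it is maximized up to ε/2. -/

noncomputable section

namespace CIM

open Timed

/-! ## Values and costs of the basic computations -/

namespace Timed

variable {α β σ : Type}

@[simp] theorem val_pure (x : α) : (pure x : Timed α).val = x := rfl

@[simp] theorem time_pure (x : α) : (pure x : Timed α).time = 0 := rfl

@[simp] theorem val_bind (x : Timed α) (f : α → Timed β) : (x >>= f).val = (f x.val).val := rfl

@[simp] theorem time_bind (x : Timed α) (f : α → Timed β) :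
    (x >>= f).time = x.time + (f x.val).time := rfl

@[simp] theorem time_tick (k : ℕ) : (tick k).time = k := rfl

@[simp] theorem val_mapList (f : α → Timed β) (l : List α) :
    (mapList f l).val = l.map fun a => (f a).val := rfl

@[simp] theorem time_mapList (f : α → Timed β) (l : List α) :
    (mapList f l).time = (l.map fun a => (f a).time + 1).sum := rfl

@[simp] theorem val_sumList (f : α → Timed ℝ) (l : List α) :
    (sumList f l).val = (l.map fun a => (f a).val).sum := rfl

@[simp] theorem time_sumList (f : α → Timed ℝ) (l : List α) :
    (sumList f l).time = (l.map fun a => (f a).time + 1).sum := rfl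

@[simp] theorem val_prodList (f : α → Timed ℝ) (l : List α) :
    (prodList f l).val = (l.map fun a => (f a).val).prod := rfl

@[simp] theorem time_prodList (f : α → Timed ℝ) (l : List α) :
    (prodList f l).time = (l.map fun a => (f a).time + 1).sum := rfl

@[simp] theorem val_tabulate {m : ℕ} (f : Fin m → Timed β) :
    (tabulate f).val = fun i => (f i).val := rfl

@[simp] theorem time_tabulate {m : ℕ} (f : Fin m → Timed β) :
    (tabulate f).time = ∑ i, ((f i).time + 1) := rfl

@[simp] theorem loop_nil (f : σ → α → Timed σ) (s : σ) : loop f s [] = pure s := rfl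

@[simp] theorem val_loop_cons (f : σ → α → Timed σ) (s : σ) (a : α) (l : List α) :
    (loop f s (a :: l)).val = (loop f (f s a).val l).val := rfl

@[simp] theorem time_loop_cons (f : σ → α → Timed σ) (s : σ) (a : α) (l : List α) :
    (loop f s (a :: l)).time = 1 + ((f s a).time + (loop f (f s a).val l).time) := rfl

/-- A loop whose body on `a` takes at most `c a` steps. -/
theorem time_loop_le (f : σ → α → Timed σ) (c : α → ℕ) (l : List α) (s : σ)
    (h : ∀ s, ∀ a ∈ l, (f s a).time ≤ c a) :
    (loop f s l).time ≤ (l.map fun a => c a + 1).sum := by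
  induction l generalizing s with
  | nil => simp
  | cons a l ih =>
    have h1 := h s a (by simp)
    have h2 := ih (f s a).val fun s b hb => h s b (by simp [hb])
    simp only [time_loop_cons, List.map_cons, List.sum_cons]
    omega

/-! ## Merge sort -/

theorem mergeSortAux_perm (fuel : ℕ) (l : List ℝ) : (mergeSortAux fuel l).val.Perm l := by
  induction fuel generalizing l with
  | zero => exact List.Perm.refl _
  | succ fuel ih =>
    unfold mergeSortAux
    split_ifs with hl
    · exact List.Perm.refl _
    · refine (List.merge_perm_append _).trans ?_
      refine ((ih _).append (ih _)).trans ?_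
      rw [List.take_append_drop]

theorem length_mergeSortAux (fuel : ℕ) (l : List ℝ) :
    (mergeSortAux fuel l).val.length = l.length :=
  (mergeSortAux_perm fuel l).length_eq

theorem mergeSortAux_sorted (fuel : ℕ) (l : List ℝ) (hl : l.length ≤ fuel) :
    (mergeSortAux fuel l).val.Pairwise (· ≥ ·) := by
  induction fuel generalizing l with
  | zero =>
    obtain rfl : l = [] := List.length_eq_zero_iff.mp (by omega)
    exact List.Pairwise.nil
  | succ fuel ih =>
    unfold mergeSortAux
    split_ifs with h1
    · match l, h1 with
      | [], _ => exact List.Pairwise.nil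
      | [a], _ => exact List.pairwise_singleton _ _
    · have h2 := ih (l.take (l.length / 2)) (by rw [List.length_take]; omega)
      have h3 := ih (l.drop (l.length / 2)) (by rw [List.length_drop]; omega)
      have := List.pairwise_merge (le := fun a b : ℝ => decide (b ≤ a))
        (fun a b c hab hbc => by simp at *; exact hbc.trans hab)
        (fun a b => by simp; exact le_total b a)
        (mergeSortAux fuel (l.take (l.length / 2))).val
        (mergeSortAux fuel (l.drop (l.length / 2))).val
        (by simpa using h2) (by simpa using h3)
      simpa [merge] using this

/-- Each level costs at most three steps per entry, and `clog 2` drops by one when the length is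
halved and rounded up. The linear summand pays for lists of length one. Running out of fuel only
saves time, so no bound on `fuel` is needed. -/
theorem time_mergeSortAux_le (fuel : ℕ) (l : List ℝ) (hl : 1 ≤ l.length) :
    (mergeSortAux fuel l).time ≤ 3 * l.length * Nat.clog 2 l.length + l.length := by
  induction fuel generalizing l with
  | zero => simp [mergeSortAux]
  | succ fuel ih =>
    unfold mergeSortAux
    split_ifs with h1
    · simpa using hl.trans (Nat.le_add_left _ _)
    · have e : Nat.clog 2 l.length = Nat.clog 2 ((l.length + 2 - 1) / 2) + 1 :=
        Nat.clog_of_two_le (by norm_num) (by omega)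
      have h2 := ih (l.take (l.length / 2)) (by rw [List.length_take]; omega)
      have h3 := ih (l.drop (l.length / 2)) (by rw [List.length_drop]; omega)
      have l2 : (l.take (l.length / 2)).length = l.length / 2 := by rw [List.length_take]; omega
      have l3 : (l.drop (l.length / 2)).length = l.length - l.length / 2 := by
        rw [List.length_drop]
      have m2 : Nat.clog 2 (l.length / 2) ≤ Nat.clog 2 ((l.length + 2 - 1) / 2) :=
        Nat.clog_mono_right _ (by omega)
      have m3 : Nat.clog 2 (l.length - l.length / 2) ≤ Nat.clog 2 ((l.length + 2 - 1) / 2) :=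
        Nat.clog_mono_right _ (by omega)
      simp only [time_bind, time_tick, merge, length_mergeSortAux]
      rw [l2] at h2
      rw [l3] at h3
      rw [l2, l3, e]
      generalize Nat.clog 2 ((l.length + 2 - 1) / 2) = c at *
      generalize hA : l.length / 2 = A at *
      have hB : l.length - A + A = l.length := by omega
      generalize l.length - A = B at *
      rw [← hB]
      have i2 := Nat.mul_le_mul_left (3 * A) m2
      have i3 := Nat.mul_le_mul_left (3 * B) m3
      have : 1 ≤ B + A := by omega
      nlinarith

theorem mergeSort_perm (l : List ℝ) : (mergeSort l).val.Perm l := mergeSortAux_perm _ l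

theorem mergeSort_sorted (l : List ℝ) : (mergeSort l).val.Pairwise (· ≥ ·) :=
  mergeSortAux_sorted _ l le_rfl

theorem time_mergeSort_le (l : List ℝ) (hl : 1 ≤ l.length) :
    (mergeSort l).time ≤ 3 * l.length * Nat.clog 2 l.length + l.length :=
  time_mergeSortAux_le _ l hl

end Timed

variable {n d : ℕ}

/-! ## The proximal step -/

/-- One pass of the loop that looks for the threshold of the projection for the 1-norm. -/
def thresholdStep (k : ℝ) (s : ℝ × ℝ × ℝ) (a : ℝ) : Timed (ℝ × ℝ × ℝ) := do
  tick 1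
  pure (s.1 + a, s.2.1 + 1, max s.2.2 ((s.1 + a - k) / (s.2.1 + 1)))

/-- The third loop variable is a running maximum of the ratios (prefix sum − k) / (prefix length):
it bounds all of them and is one of them or the initial value. The start `s`, `c`, `m` is arbitrary
so that the induction goes through. -/
theorem thresholdStep_loop (k : ℝ) (l : List ℝ) (s c m : ℝ) :
    m ≤ (loop (thresholdStep k) (s, c, m) l).val.2.2 ∧
    (∀ j, 1 ≤ j → j ≤ l.length →
      (s + (l.take j).sum - k) / (c + j) ≤ (loop (thresholdStep k) (s, c, m) l).val.2.2) ∧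
    ((loop (thresholdStep k) (s, c, m) l).val.2.2 = m ∨ ∃ j, 1 ≤ j ∧ j ≤ l.length ∧
      (loop (thresholdStep k) (s, c, m) l).val.2.2 = (s + (l.take j).sum - k) / (c + j)) := by
  induction l generalizing s c m with
  | nil => exact ⟨le_rfl, fun j h1 h2 => absurd (h1.trans h2) (by simp), Or.inl rfl⟩
  | cons a l ih =>
    obtain ⟨h1, h2, h3⟩ := ih (s + a) (c + 1) (max m ((s + a - k) / (c + 1)))
    rw [val_loop_cons]
    change m ≤ (loop (thresholdStep k) (s + a, c + 1, max m ((s + a - k) / (c + 1))) l).val.2.2 ∧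
      (∀ j, 1 ≤ j → j ≤ (a :: l).length → (s + ((a :: l).take j).sum - k) / (c + j) ≤
        (loop (thresholdStep k) (s + a, c + 1, max m ((s + a - k) / (c + 1))) l).val.2.2) ∧
      ((loop (thresholdStep k) (s + a, c + 1, max m ((s + a - k) / (c + 1))) l).val.2.2 = m ∨
        ∃ j, 1 ≤ j ∧ j ≤ (a :: l).length ∧
        (loop (thresholdStep k) (s + a, c + 1, max m ((s + a - k) / (c + 1))) l).val.2.2 =
          (s + ((a :: l).take j).sum - k) / (c + j))
    generalize (loop (thresholdStep k) (s + a, c + 1, max m ((s + a - k) / (c + 1))) l).val.2.2 = τ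
      at *
    have key : ∀ j : ℕ, (s + ((a :: l).take (j + 1)).sum - k) / (c + (j + 1 : ℕ)) =
        (s + a + (l.take j).sum - k) / (c + 1 + j) := by
      intro j
      rw [List.take_succ_cons, List.sum_cons]
      push_cast
      congr 1 <;> ring
    refine ⟨(le_max_left _ _).trans h1, ?_, ?_⟩
    · intro j hj1 hj2
      obtain ⟨j, rfl⟩ := Nat.exists_eq_add_of_le' hj1
      rw [key]
      rcases Nat.eq_zero_or_pos j with rfl | hj
      · simpa using (le_max_right _ _).trans h1
      · exact h2 j hj (by simpa using hj2)
    · rcases h3 with h3 | ⟨j, hj1, hj2, h3⟩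
      · rcases max_choice m ((s + a - k) / (c + 1)) with h | h
        · exact Or.inl (h3.trans h)
        · refine Or.inr ⟨1, le_rfl, by simp, ?_⟩
          rw [h3, h]
          simp
      · exact Or.inr ⟨j + 1, by omega, by simpa using hj2, by rw [key, h3]⟩

/-- In a list in decreasing order the entries above `τ` form an initial segment. -/
theorem exists_sum_max_eq (τ : ℝ) (l : List ℝ) (hl : l.Pairwise (· ≥ ·)) :
    ∃ j ≤ l.length, (l.map fun a => max (a - τ) 0).sum = (l.take j).sum - j * τ := by
  induction l with
  | nil => exact ⟨0, le_rfl, by simp⟩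
  | cons a l ih =>
    rw [List.pairwise_cons] at hl
    by_cases ha : a ≤ τ
    · refine ⟨0, Nat.zero_le _, ?_⟩
      have : ∀ b ∈ (a :: l), max (b - τ) 0 = 0 := by
        intro b hb
        refine max_eq_right ?_
        rcases List.mem_cons.mp hb with rfl | hb
        · linarith
        · linarith [hl.1 b hb]
      rw [List.map_congr_left this]
      simp
    · obtain ⟨j, hj, h⟩ := ih hl.2
      refine ⟨j + 1, by simpa using hj, ?_⟩
      rw [List.map_cons, List.sum_cons, h, List.take_succ_cons, List.sum_cons,
        max_eq_left (by linarith)]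
      push_cast
      ring

/-- Each a − τ is at most its positive part, and the positive parts left out are nonnegative; no
ordering is needed. -/
theorem sum_take_sub_le_sum_max (τ : ℝ) (l : List ℝ) (j : ℕ) (hj : j ≤ l.length) :
    (l.take j).sum - j * τ ≤ (l.map fun a => max (a - τ) 0).sum := by
  induction l generalizing j with
  | nil => simp at hj; simp [hj]
  | cons a l ih =>
    rcases j with _ | j
    · simp only [List.take_zero, List.sum_nil, Nat.cast_zero, zero_mul, sub_zero]
      exact List.sum_nonneg (by simp)
    · have := ih j (by simpa using hj)
      have h2 := le_max_left (a - τ) 0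
      rw [List.take_succ_cons, List.sum_cons, List.map_cons, List.sum_cons]
      push_cast
      linarith

/-- The threshold `τ ≥ t` found by the loop makes the truncated sum at most `k`, and equal to `k`
unless `τ = t`. -/
theorem threshold_spec (k t : ℝ) (hk : 0 ≤ k) (l : List ℝ) (hl : l.Pairwise (· ≥ ·)) :
    let τ := (loop (thresholdStep k) (0, 0, t) l).val.2.2
    t ≤ τ ∧ (l.map fun a => max (a - τ) 0).sum ≤ k ∧
      (τ = t ∨ (l.map fun a => max (a - τ) 0).sum = k) := by
  intro τ
  obtain ⟨h1, h2, h3⟩ := thresholdStep_loop k l 0 0 t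
  change t ≤ τ at h1
  change ∀ j, 1 ≤ j → j ≤ l.length → (0 + (l.take j).sum - k) / (0 + j) ≤ τ at h2
  change τ = t ∨ ∃ j, 1 ≤ j ∧ j ≤ l.length ∧ τ = (0 + (l.take j).sum - k) / (0 + j) at h3
  simp only [zero_add] at h2 h3
  have hle : (l.map fun a => max (a - τ) 0).sum ≤ k := by
    obtain ⟨j, hj, h⟩ := exists_sum_max_eq τ l hl
    rw [h]
    rcases Nat.eq_zero_or_pos j with rfl | hj0
    · simpa using hk
    · have := h2 j hj0 hj
      rw [div_le_iff₀ (by exact_mod_cast hj0)] at this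
      linarith
  refine ⟨h1, hle, ?_⟩
  rcases h3 with h3 | ⟨j, hj1, hj2, h3⟩
  · exact Or.inl h3
  · right
    refine le_antisymm hle ?_
    -- For the prefix that attains the maximum, the prefix sum minus jτ is exactly k.
    have h4 := sum_take_sub_le_sum_max τ l j hj2
    rw [eq_div_iff (by exact_mod_cast (by omega : j ≠ 0))] at h3
    linarith

theorem inner_eq_sum (x y : Mix d) : inner ℝ x y = ∑ i, x i * y i := by
  rw [PiLp.inner_apply]
  exact Finset.sum_congr rfl fun i _ => by simp [mul_comm]

theorem norm_sq_eq_sum (x : Mix d) : ‖x‖ ^ 2 = ∑ i, x i ^ 2 := by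
  rw [← real_inner_self_eq_norm_sq, inner_eq_sum]
  exact Finset.sum_congr rfl fun i _ => by ring

theorem sum_finRange (f : Fin d → ℝ) : ((List.finRange d).map f).sum = ∑ i, f i := by
  rw [← List.ofFn_eq_map, List.sum_ofFn]

namespace Setting

@[simp] theorem val_normT (x : Mix d) : (normT x).val = ‖x‖ := by
  change √((List.finRange d).map fun i => x i ^ 2).sum = ‖x‖
  rw [sum_finRange, EuclideanSpace.norm_eq]
  simp

theorem time_normT (x : Mix d) : (normT x).time = 2 * d + 1 := by
  simp [normT, mul_comm]

variable (S : Setting n d)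

@[simp] theorem val_costT (x : Mix d) : (S.costT x).val = cost S.costNorm x := by
  unfold costT cost
  cases S.costNorm
  · simp [sum_finRange]
  · simp

theorem time_costT_le (x : Mix d) : (S.costT x).time ≤ 2 * d + 1 := by
  unfold costT
  cases S.costNorm
  · simp; omega
  · simp [time_normT]

/-- In each coordinate (z − y)(u − y) ≤ τ(u − y), with equality where y = z − τ; elsewhere y = 0, z
≤ τ and u ≥ 0. Passing from τ to t is harmless: either τ = t, or the budget is exhausted by y, so
that ∑ u ≤ ∑ y while τ ≥ t. -/
theorem proxT_one_spec (t : ℝ) (z : Mix d) (hk : 0 ≤ S.k)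
    (hc : S.costNorm = .one) :
    (S.proxT t z).val ∈ S.P ∧ ∀ u ∈ S.P,
      inner ℝ (z - (S.proxT t z).val) (u - (S.proxT t z).val) ≤
        t * (cost S.costNorm u - cost S.costNorm (S.proxT t z).val) := by
  set l := (mergeSort (List.ofFn fun i => z i)).val with hl
  set τ := (loop (thresholdStep S.k) (0, 0, t) l).val.2.2 with hτ
  have hval : ∀ i, (S.proxT t z).val i = max (z i - τ) 0 := by
    intro i
    unfold proxT
    rw [hc]
    rfl
  obtain ⟨h1, h2, h3⟩ := threshold_spec S.k t hk l (mergeSort_sorted _)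
  have hsum : (l.map fun a => max (a - τ) 0).sum = ∑ i, max (z i - τ) 0 := by
    rw [((mergeSort_perm (List.ofFn fun i => z i)).map _).sum_eq, List.map_ofFn, List.sum_ofFn]
    rfl
  rw [← hτ, hsum] at h2 h3
  rw [← hτ] at h1
  generalize (S.proxT t z).val = y at hval
  have hy0 : ∀ i, 0 ≤ y i := fun i => by rw [hval]; exact le_max_right _ _
  have hcost : ∀ x : Mix d, x ∈ orthant d → cost .one x = ∑ i, x i := fun x hx =>
    Finset.sum_congr rfl fun i _ => abs_of_nonneg (hx i)
  simp only [← hval] at h2 h3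
  refine ⟨⟨hy0, by rw [hc, hcost y hy0]; exact h2⟩, ?_⟩
  intro u hu
  rw [hc, hcost y hy0, hcost u hu.1, inner_eq_sum]
  have hu2 := hu.2
  rw [hc, hcost u hu.1] at hu2
  calc ∑ i, (z - y) i * (u - y) i ≤ ∑ i, τ * (u i - y i) := by
        refine Finset.sum_le_sum fun i _ => ?_
        simp only [PiLp.sub_apply]
        rcases le_total (z i - τ) 0 with h | h
        · have : y i = 0 := by rw [hval, max_eq_right h]
          rw [this]
          have := hu.1 i
          nlinarith
        · have : y i = z i - τ := by rw [hval, max_eq_left h]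
          rw [this]
          exact le_of_eq (by ring)
    _ = τ * (∑ i, u i - ∑ i, y i) := by rw [← Finset.mul_sum, Finset.sum_sub_distrib]
    _ ≤ t * (∑ i, u i - ∑ i, y i) := by
        rcases h3 with h3 | h3
        · rw [h3]
        · rw [h3]
          nlinarith

/-- Against nonnegative u, the point z may be replaced by its positive part p. Since y is the
multiple of p with norm s, Cauchy–Schwarz reduces the claim to (‖p‖ − s)(‖u‖ − s) ≤ t(‖u‖ − s),
where s is ‖p‖ − t clamped to [0, k]; each of the three cases of the clamp is immediate. -/
theorem proxT_two_spec (t : ℝ) (z : Mix d) (ht : 0 ≤ t) (hk : 0 ≤ S.k)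
    (hc : S.costNorm = .two) :
    (S.proxT t z).val ∈ S.P ∧ ∀ u ∈ S.P,
      inner ℝ (z - (S.proxT t z).val) (u - (S.proxT t z).val) ≤
        t * (cost S.costNorm u - cost S.costNorm (S.proxT t z).val) := by
  set p : Mix d := WithLp.toLp 2 fun i => max (z i) 0 with hp
  have hpi : ∀ i, p i = max (z i) 0 := fun i => rfl
  have hp0 : ∀ i, 0 ≤ p i := fun i => le_max_right _ _
  set s := min (max (‖p‖ - t) 0) S.k with hs
  have hs0 : 0 ≤ s := le_min (le_max_right _ _) hk
  set a := if ‖p‖ = 0 then 0 else s / ‖p‖ with ha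
  have ha0 : 0 ≤ a := by rw [ha]; split_ifs; exacts [le_rfl, div_nonneg hs0 (norm_nonneg _)]
  have hval : (S.proxT t z).val = a • p := by
    ext i
    unfold proxT
    rw [hc]
    change (if (normT p).val = 0 then 0 else min (max ((normT p).val - t) 0) S.k / (normT p).val * p i)
      = a * p i
    rw [val_normT, ha]
    split_ifs with h
    · simp
    · rfl
  rw [hval, hc]
  have hcost : ∀ x : Mix d, cost .two x = ‖x‖ := fun x => rfl
  have hmem : ∀ u, u ∈ S.P ↔ (∀ i, 0 ≤ u i) ∧ ‖u‖ ≤ S.k := by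
    intro u
    change _ ∧ cost S.costNorm u ≤ S.k ↔ _
    rw [hc]
    rfl
  have hnorm : ‖a • p‖ = a * ‖p‖ := by rw [norm_smul, Real.norm_of_nonneg ha0]
  have haps : ‖p‖ ≠ 0 → a * ‖p‖ = s := fun h => by rw [ha, if_neg h]; field_simp
  have hz : ∀ u : Mix d, (∀ i, 0 ≤ u i) →
      inner ℝ (z - a • p) (u - a • p) ≤ inner ℝ (p - a • p) (u - a • p) := by
    intro u hu
    rw [inner_eq_sum, inner_eq_sum]
    refine Finset.sum_le_sum fun i _ => ?_
    simp only [PiLp.sub_apply, PiLp.smul_apply, smul_eq_mul]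
    rcases le_total (z i) 0 with h | h
    · have : p i = 0 := by rw [hpi, max_eq_right h]
      rw [this]
      simpa using mul_nonpos_of_nonpos_of_nonneg h (hu i)
    · have : p i = z i := by rw [hpi, max_eq_left h]
      rw [this]
  rw [hmem]
  refine ⟨⟨fun i => mul_nonneg ha0 (hp0 i), ?_⟩, ?_⟩
  · rw [hnorm]
    by_cases h : ‖p‖ = 0
    · simpa [h] using hk
    · rw [haps h]
      exact min_le_right _ _
  · intro u hu
    rw [hmem] at hu
    refine (hz u hu.1).trans ?_
    rw [hcost, hcost, hnorm]
    by_cases h : ‖p‖ = 0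
    · have : p = 0 := norm_eq_zero.mp h
      simp [this, mul_nonneg ht (norm_nonneg u)]
    · have hpos : 0 < ‖p‖ := lt_of_le_of_ne (norm_nonneg _) (Ne.symm h)
      have e : inner ℝ (p - a • p) (u - a • p) = (1 - a) * (inner ℝ p u - a * ‖p‖ ^ 2) := by
        rw [inner_sub_left, inner_sub_right, inner_sub_right, real_inner_smul_left,
          real_inner_smul_left, real_inner_smul_right, real_inner_self_eq_norm_sq]
        ring
      have hcs : inner ℝ p u ≤ ‖p‖ * ‖u‖ := real_inner_le_norm _ _
      have hs1 : s ≤ ‖p‖ := by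
        refine (min_le_left _ _).trans (max_le (by linarith) hpos.le)
      have ha1 : a ≤ 1 := by
        rw [ha, if_neg h]
        exact (div_le_one hpos).mpr hs1
      have e2 : (1 - a) * (‖p‖ * ‖u‖ - a * ‖p‖ ^ 2) = (‖p‖ - s) * (‖u‖ - s) := by
        rw [← haps h]
        ring
      rw [e, haps h]
      refine (mul_le_mul_of_nonneg_left (sub_le_sub_right hcs _) (by linarith)).trans ?_
      rw [e2]
      rcases le_total (‖p‖ - t) 0 with h1 | h1
      · have : s = 0 := by rw [hs, max_eq_right h1, min_eq_left hk]
        rw [this]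
        have := norm_nonneg u
        nlinarith
      · rcases le_total (‖p‖ - t) S.k with h2 | h2
        · have : s = ‖p‖ - t := by rw [hs, max_eq_left h1, min_eq_left h2]
          rw [this]
          exact le_of_eq (by ring)
        · have : s = S.k := by rw [hs, max_eq_left h1, min_eq_right h2]
          rw [this]
          have := hu.2
          nlinarith

/-- The proximal step solves the variational inequality of its minimization problem. -/
theorem proxT_spec (t : ℝ) (z : Mix d) (ht : 0 ≤ t) (hk : 0 ≤ S.k) :
    (S.proxT t z).val ∈ S.P ∧ ∀ u ∈ S.P,
      inner ℝ (z - (S.proxT t z).val) (u - (S.proxT t z).val) ≤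
        t * (cost S.costNorm u - cost S.costNorm (S.proxT t z).val) := by
  cases hc : S.costNorm
  · rw [← hc]
    exact S.proxT_one_spec t z hk hc
  · rw [← hc]
    exact S.proxT_two_spec t z ht hk hc

theorem time_proxT_le (t : ℝ) (z : Mix d) (hd : 1 ≤ d) :
    (S.proxT t z).time ≤ 8 * d * (Nat.clog 2 d + 1) := by
  have h0 : 8 * d * (Nat.clog 2 d + 1) = 8 * (d * Nat.clog 2 d) + 8 * d := by ring
  rw [h0]
  unfold proxT
  cases S.costNorm
  · have h1 := time_mergeSort_le (List.ofFn fun i => z i) (by simpa using hd)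
    have h2 : ∀ s, (loop (thresholdStep S.k) s (mergeSort (List.ofFn fun i => z i)).val).time ≤
        2 * d := by
      intro s
      refine (time_loop_le _ (fun _ => 1) _ _ fun s a _ => le_of_eq rfl).trans ?_
      simp [(mergeSort_perm _).length_eq, mul_comm]
    have h3 := h2 (0, 0, t)
    simp only [List.length_ofFn] at h1
    have h1' : 3 * d * Nat.clog 2 d = 3 * (d * Nat.clog 2 d) := by ring
    rw [h1'] at h1
    change (mergeSort (List.ofFn fun i => z i)).time +
      ((loop (thresholdStep S.k) (0, 0, t) (mergeSort (List.ofFn fun i => z i)).val).time +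
      ((∑ i : Fin d, (1 + 0 + 1)) + 0)) ≤ _
    simp only [Finset.sum_const, Finset.card_univ, Fintype.card_fin, smul_eq_mul]
    omega
  · change (∑ i : Fin d, (1 + 0 + 1)) + ((normT _).time + (1 + ((∑ i : Fin d, (1 + 0 + 1)) + 0))) ≤ _
    rw [time_normT]
    simp only [Finset.sum_const, Finset.card_univ, Fintype.card_fin, smul_eq_mul]
    omega

end Setting

/-! ## Reverse reachable sets -/

namespace Network

/-- `u` is reached from `v` by one step of the reverse search. -/
def RevStep (G : Network n) (T : Fin n → Finset (Fin n)) (v u : Fin n) : Prop :=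
  u ∈ T v ∧ (u, v) ∈ G.E

theorem mem_inList (G : Network n) (u v : Fin n) : u ∈ G.inList v ↔ (u, v) ∈ G.E := by
  simp [inList]

theorem length_inList (G : Network n) (v : Fin n) : (G.inList v).length = G.inDegree v := by
  have h : (G.inList v).Nodup := (List.nodup_finRange n).filter _
  rw [inDegree, ← List.toFinset_card_of_nodup h]
  congr 1
  ext u
  simp [mem_inList]

/-- The number of edges into the nodes of a list, plus its length. -/
def width (G : Network n) (r : RRSet n) : ℕ := (r.map fun v => G.inDegree v + 1).sum

theorem length_le_width (G : Network n) (r : RRSet n) : r.length ≤ G.width r := by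
  induction r with
  | nil => simp
  | cons v r ih => simp only [width, List.map_cons, List.sum_cons, List.length_cons] at *; omega

theorem sum_inDegree (G : Network n) : ∑ v, (G.inDegree v + 1) = G.E.card + n := by
  have : ∑ v, G.inDegree v = G.E.card := by
    simp only [inDegree]
    rw [Finset.card_eq_sum_card_fiberwise (f := Prod.snd) (t := Finset.univ) (by simp)]
    refine Finset.sum_congr rfl fun v _ => ?_
    refine Finset.card_bij (fun u _ => (u, v)) (by simp) (by simp) ?_
    rintro ⟨u, w⟩ h
    simp only [Finset.mem_filter] at h
    obtain ⟨h1, rfl⟩ := h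
    exact ⟨u, by simpa using h1, rfl⟩
  rw [Finset.sum_add_distrib, this]
  simp

end Network

/-- The body of the scan of an adjacency list. -/
def scanStep (A : Finset (Fin n)) (s : List (Fin n) × RRSet n) (w : Fin n) :
    Timed (List (Fin n) × RRSet n) :=
  pure (if w ∈ A ∧ w ∉ s.2 then (w :: s.1, w :: s.2) else s)

/-- New nodes are pushed on both lists at once. This common `add` is what keeps the invariants of
the search and its cost accounting in balance. -/
theorem scan_spec (A : Finset (Fin n)) (l todo seen : List (Fin n)) (hs : seen.Nodup) :
    ∃ add : List (Fin n), (loop (scanStep A) (todo, seen) l).val = (add ++ todo, add ++ seen) ∧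
      (add ++ seen).Nodup ∧ (∀ w ∈ l, w ∈ A → w ∈ add ++ seen) ∧
      ∀ w ∈ add, w ∈ l ∧ w ∈ A := by
  induction l generalizing todo seen with
  | nil => exact ⟨[], rfl, hs, by simp, by simp⟩
  | cons w l ih =>
    rw [val_loop_cons]
    by_cases hw : w ∈ A ∧ w ∉ seen
    · obtain ⟨add, h1, h2, h3, h4⟩ := ih (w :: todo) (w :: seen) (List.nodup_cons.mpr ⟨hw.2, hs⟩)
      refine ⟨add ++ [w], ?_, ?_, ?_, ?_⟩
      · have : (scanStep A (todo, seen) w).val = (w :: todo, w :: seen) := by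
          simp [scanStep, hw]
        rw [this, h1]
        simp
      · simpa using h2
      · intro v hv hvA
        rcases List.mem_cons.mp hv with rfl | hv
        · simp
        · simpa using h3 v hv hvA
      · intro v hv
        rcases List.mem_append.mp hv with hv | hv
        · exact ⟨List.mem_cons_of_mem _ (h4 v hv).1, (h4 v hv).2⟩
        · obtain rfl : v = w := by simpa using hv
          exact ⟨by simp, hw.1⟩
    · obtain ⟨add, h1, h2, h3, h4⟩ := ih todo seen hs
      refine ⟨add, ?_, h2, ?_, fun v hv => ⟨List.mem_cons_of_mem _ (h4 v hv).1, (h4 v hv).2⟩⟩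
      · have : (scanStep A (todo, seen) w).val = (todo, seen) := by
          simp only [scanStep, val_pure, if_neg hw]
        rw [this, h1]
      · intro v hv hvA
        rcases List.mem_cons.mp hv with rfl | hv
        · have : v ∈ seen := by tauto
          simp [this]
        · exact h3 v hv hvA

theorem rrLoop_cons (G : Network n) (st : Fin n → ℕ) (T : Fin n → Finset (Fin n)) (fuel : ℕ)
    (u : Fin n) (todo : List (Fin n)) (seen : RRSet n) :
    rrLoop G st T (fuel + 1) (u :: todo) seen = (do
      tick (st u + 1)
      let s ← loop (scanStep (T u)) (todo, seen) (G.inList u)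
      rrLoop G st T fuel s.1 s.2) := rfl

/-- The hypotheses are the loop invariant. The length equation says that the processed nodes, which
are seen but not in `todo`, number n minus the remaining fuel. As `seen` has at most n entries,
`todo` is empty when the fuel is used up, and then `seen` is closed under reverse steps. -/
theorem rrLoop_spec (G : Network n) (st : Fin n → ℕ) (T : Fin n → Finset (Fin n)) (root : Fin n)
    (fuel : ℕ) (todo : List (Fin n)) (seen : RRSet n) (hs : seen.Nodup)
    (hlen : seen.length + fuel = todo.length + n)
    (hclosed : ∀ v ∈ seen, v ∉ todo → ∀ u, G.RevStep T v u → u ∈ seen) (hroot : root ∈ seen)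
    (hreach : ∀ v ∈ seen, Relation.ReflTransGen (G.RevStep T) root v)
    (hsub : ∀ v ∈ todo, v ∈ seen) :
    (rrLoop G st T fuel todo seen).val.Nodup ∧
      ∀ v, v ∈ (rrLoop G st T fuel todo seen).val ↔
        Relation.ReflTransGen (G.RevStep T) root v := by
  have hend : ∀ seen : RRSet n, (∀ v ∈ seen, ∀ u, G.RevStep T v u → u ∈ seen) → root ∈ seen →
      (∀ v ∈ seen, Relation.ReflTransGen (G.RevStep T) root v) →
      ∀ v, v ∈ seen ↔ Relation.ReflTransGen (G.RevStep T) root v := by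
    intro seen hc hr h v
    refine ⟨h v, fun hv => ?_⟩
    induction hv with
    | refl => exact hr
    | tail _ h2 ih => exact hc _ ih _ h2
  induction fuel generalizing todo seen with
  | zero =>
    have h1 : seen.length ≤ n := by simpa using hs.length_le_card
    obtain rfl : todo = [] := List.length_eq_zero_iff.mp (by omega)
    exact ⟨hs, hend seen (fun v hv => hclosed v hv (by simp)) hroot hreach⟩
  | succ fuel ih =>
    rcases todo with _ | ⟨u, todo⟩
    · exact ⟨hs, hend seen (fun v hv => hclosed v hv (by simp)) hroot hreach⟩
    · obtain ⟨add, h1, h2, h3, h4⟩ := scan_spec (T u) (G.inList u) todo seen hs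
      have hu : u ∈ seen := hsub u (by simp)
      have hval : (rrLoop G st T (fuel + 1) (u :: todo) seen).val =
          (rrLoop G st T fuel (add ++ todo) (add ++ seen)).val := by
        rw [rrLoop_cons, val_bind, val_bind, h1]
      rw [hval]
      refine ih _ _ h2 ?_ ?_ (by simp [hroot]) ?_ ?_
      · simp only [List.length_append, List.length_cons] at *
        omega
      · intro v hv hv2 w hw
        rw [List.mem_append] at hv
        rw [List.mem_append, not_or] at hv2
        rcases hv with hv | hv
        · exact absurd hv hv2.1
        · by_cases hvu : v = u
          · subst hvu
            exact h3 w ((G.mem_inList _ _).mpr hw.2) hw.1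
          · exact List.mem_append_right _ (hclosed v hv (by simp [hvu, hv2.2]) w hw)
      · intro v hv
        rcases List.mem_append.mp hv with hv | hv
        · exact (hreach u hu).tail ⟨(h4 v hv).2, (G.mem_inList _ _).mp (h4 v hv).1⟩
        · exact hreach v hv
      · intro v hv
        rcases List.mem_append.mp hv with hv | hv
        · simp [hv]
        · exact List.mem_append_right _ (hsub v (by simp [hv]))

/-- Amortization: a node pays for its processing when it is first seen. A newly seen node enters
both lists, so its contributions on the two sides cancel, and removing a node from `todo` releases
the cost of its scan. -/
theorem time_rrLoop_le (G : Network n) (st : Fin n → ℕ) (T : Fin n → Finset (Fin n))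
    (fuel : ℕ) (todo : List (Fin n)) (seen : RRSet n) (hs : seen.Nodup) :
    (rrLoop G st T fuel todo seen).time + (seen.map fun v => st v + 1 + G.inDegree v).sum ≤
      ((rrLoop G st T fuel todo seen).val.map fun v => st v + 1 + G.inDegree v).sum +
        (todo.map fun v => st v + 1 + G.inDegree v).sum := by
  induction fuel generalizing todo seen with
  | zero => simp [rrLoop]
  | succ fuel ih =>
    rcases todo with _ | ⟨u, todo⟩
    · simp [rrLoop]
    · obtain ⟨add, h1, h2, -, -⟩ := scan_spec (T u) (G.inList u) todo seen hs
      have h3 := ih (add ++ todo) (add ++ seen) h2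
      have h4 : (loop (scanStep (T u)) (todo, seen) (G.inList u)).time ≤ G.inDegree u := by
        refine (time_loop_le _ (fun _ => 0) _ _ fun s a _ => le_of_eq rfl).trans ?_
        simp [G.length_inList]
      rw [rrLoop_cons]
      simp only [val_bind, time_bind, time_tick, h1, List.map_append, List.sum_append,
        List.map_cons, List.sum_cons] at *
      omega

namespace Setting

variable (S : Setting n d)

/-- The RR set generated from a sample. -/
def rr (w : Sample n) : RRSet n := (rrGenerate S.net S.sampleTime w).val

theorem rr_spec (w : Sample n) :
    (S.rr w).Nodup ∧ ∀ v, v ∈ S.rr w ↔ Relation.ReflTransGen (S.net.RevStep w.2) w.1 v := by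
  refine rrLoop_spec S.net S.sampleTime w.2 w.1 n [w.1] [w.1] (by simp) (by simp) ?_ (by simp)
    ?_ (by simp)
  · intro v hv hv2
    exact absurd hv hv2
  · intro v hv
    obtain rfl : v = w.1 := by simpa using hv
    exact Relation.ReflTransGen.refl

theorem root_mem_rr (w : Sample n) : w.1 ∈ S.rr w :=
  ((S.rr_spec w).2 _).mpr Relation.ReflTransGen.refl

theorem one_le_length_rr (w : Sample n) : 1 ≤ (S.rr w).length :=
  List.length_pos_of_mem (S.root_mem_rr w)

theorem length_rr_le (w : Sample n) : (S.rr w).length ≤ n := by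
  simpa using (S.rr_spec w).1.length_le_card

theorem one_le_width_rr (w : Sample n) : 1 ≤ S.net.width (S.rr w) :=
  (S.one_le_length_rr w).trans (S.net.length_le_width _)

theorem time_rrGenerate_le (a : ℕ) (ha : ∀ v, S.sampleTime v ≤ a * (S.net.inDegree v + 1))
    (w : Sample n) :
    (rrGenerate S.net S.sampleTime w).time ≤ (a + 2) * S.net.width (S.rr w) := by
  have h1 := time_rrLoop_le S.net S.sampleTime w.2 n [w.1] [w.1] (by simp)
  have h2 : (rrGenerate S.net S.sampleTime w).time =
    1 + (rrLoop S.net S.sampleTime w.2 n [w.1] [w.1]).time := rfl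
  have h3 : (rrLoop S.net S.sampleTime w.2 n [w.1] [w.1]).val = S.rr w := rfl
  rw [h3] at h1
  have h4 : ((S.rr w).map fun v => S.sampleTime v + 1 + S.net.inDegree v).sum ≤
      (a + 1) * S.net.width (S.rr w) := by
    rw [Network.width, ← List.sum_map_mul_left]
    refine List.sum_le_sum fun v _ => ?_
    have := ha v
    nlinarith
  have h5 := S.one_le_width_rr w
  nlinarith

end Setting

/-! ## Reverse reachability and influence -/

namespace Network

/-- The relation points from a node to its triggering set, so the path runs against the propagation.
-/
theorem mem_finalActive (T : Fin n → Finset (Fin n)) (A : Finset (Fin n)) (v : Fin n) :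
    v ∈ finalActive T A ↔ ∃ u ∈ A, Relation.ReflTransGen (fun a b => b ∈ T a) v u := by
  simp only [finalActive, Finset.mem_filter, Finset.mem_univ, true_and]
  constructor
  · rintro ⟨t, ht⟩
    induction t generalizing v with
    | zero => exact ⟨v, ht, Relation.ReflTransGen.refl⟩
    | succ t ih =>
      simp only [activeAt, Finset.mem_union, Finset.mem_filter, Finset.mem_univ, true_and] at ht
      rcases ht with ht | ⟨u, hu, ht⟩
      · exact ih v ht
      · obtain ⟨u', h1, h2⟩ := ih u ht
        exact ⟨u', h1, h2.head hu⟩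
  · rintro ⟨u, hu, h⟩
    induction h using Relation.ReflTransGen.head_induction_on with
    | refl => exact ⟨0, hu⟩
    | head h1 _ ih =>
      obtain ⟨t, ht⟩ := ih
      refine ⟨t + 1, ?_⟩
      simp only [activeAt, Finset.mem_union, Finset.mem_filter, Finset.mem_univ, true_and]
      exact Or.inr ⟨_, h1, ht⟩

/-- The probability of the triggering sets `T`. -/
def prob (G : Network n) (T : Fin n → Finset (Fin n)) : ℝ := ∏ v, (G.D v (T v)).toReal

theorem prob_nonneg (G : Network n) (T : Fin n → Finset (Fin n)) : 0 ≤ G.prob T :=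
  Finset.prod_nonneg fun _ _ => ENNReal.toReal_nonneg

theorem sum_prob (G : Network n) : ∑ T, G.prob T = 1 := by
  have h : ∀ v, ∑ A, (G.D v A).toReal = 1 := by
    intro v
    rw [← ENNReal.toReal_sum fun A _ => (G.D v).apply_ne_top A]
    have := (G.D v).tsum_coe
    rw [tsum_fintype] at this
    rw [this]
    rfl
  unfold prob
  rw [← Fintype.prod_sum fun v A => (G.D v A).toReal]
  simp [h]

/-- The search follows only edges of the graph, while propagation looks at triggering sets alone.
They can differ only for T of probability zero. -/
theorem revStep_eq (G : Network n) (T : Fin n → Finset (Fin n)) (hT : G.prob T ≠ 0) :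
    G.RevStep T = fun a b => b ∈ T a := by
  ext v u
  refine ⟨fun h => h.1, fun h => ⟨h, ?_⟩⟩
  refine G.support_D v (T v) ?_ u h
  rw [PMF.mem_support_iff]
  intro h0
  exact hT (Finset.prod_eq_zero (Finset.mem_univ v) (by simp [h0]))

end Network

namespace Setting

variable (S : Setting n d)

theorem mem_finalActive_iff_rr (T : Fin n → Finset (Fin n)) (hT : S.net.prob T ≠ 0)
    (A : Finset (Fin n)) (v : Fin n) :
    v ∈ Network.finalActive T A ↔ ∃ u ∈ A, u ∈ S.rr (v, T) := by
  rw [Network.mem_finalActive]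
  simp only [(S.rr_spec (v, T)).2, S.net.revStep_eq T hT]

/-- The expectation of a function of a sample. -/
def mean (f : Sample n → ℝ) : ℝ := ∑ T, S.net.prob T * ∑ v, f (v, T)

/-- A node becomes active exactly if its RR set meets the seeds. Since `mean` sums over the root
without a factor 1/n, it is n times the expectation under `sampleLaw`, and the spread appears
without a prefactor. -/
theorem spread_eq (A : Finset (Fin n)) :
    S.net.spread A =
      S.mean fun w => if ∃ u ∈ A, u ∈ S.rr w then 1 else 0 := by
  refine Finset.sum_congr rfl fun T _ => ?_
  change S.net.prob T * _ = _
  by_cases hT : S.net.prob T = 0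
  · simp [hT]
  · congr 1
    rw [Finset.sum_boole]
    congr 2
    ext v
    simp [S.mem_finalActive_iff_rr T hT]

theorem mean_sum {ι : Type*} (s : Finset ι) (f : ι → Sample n → ℝ) :
    S.mean (fun w => ∑ i ∈ s, f i w) = ∑ i ∈ s, S.mean (f i) := by
  simp only [mean, Finset.mul_sum]
  rw [Finset.sum_comm' (s := s) (t' := Finset.univ) (s' := fun _ => s) (by simp)]
  refine Finset.sum_congr rfl fun T _ => ?_
  rw [Finset.sum_comm]

theorem mean_const_mul (c : ℝ) (f : Sample n → ℝ) :
    S.mean (fun w => c * f w) = c * S.mean f := by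
  simp only [mean, Finset.mul_sum]
  refine Finset.sum_congr rfl fun T _ => Finset.sum_congr rfl fun v _ => ?_
  ring

theorem mean_mono {f g : Sample n → ℝ} (h : ∀ w, f w ≤ g w) : S.mean f ≤ S.mean g :=
  Finset.sum_le_sum fun T _ => mul_le_mul_of_nonneg_left
    (Finset.sum_le_sum fun v _ => h (v, T)) (S.net.prob_nonneg T)

theorem mean_one : S.mean (fun _ => 1) = n := by
  simp [mean, ← Finset.sum_mul, S.net.sum_prob]

theorem mean_sub (f g : Sample n → ℝ) : S.mean (fun w => f w - g w) = S.mean f - S.mean g := by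
  simp only [mean, Finset.sum_sub_distrib, mul_sub]

/-- The expected width of an RR set in terms of the influence spreads of single nodes. -/
theorem mean_width :
    S.mean (fun w => (S.net.width (S.rr w) : ℝ)) =
      ∑ u, ((S.net.inDegree u : ℝ) + 1) * S.net.spread {u} := by
  have h : ∀ w, (S.net.width (S.rr w) : ℝ) =
      ∑ u, ((S.net.inDegree u : ℝ) + 1) * if ∃ v ∈ ({u} : Finset (Fin n)), v ∈ S.rr w then 1 else 0 := by
    intro w
    have h1 : S.net.width (S.rr w) = ∑ u ∈ (S.rr w).toFinset, (S.net.inDegree u + 1) := by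
      rw [List.sum_toFinset _ (S.rr_spec w).1]
      rfl
    rw [h1]
    push_cast
    simp only [Finset.mem_singleton, exists_eq_left, mul_ite, mul_one, mul_zero]
    rw [← Finset.sum_filter]
    refine Finset.sum_congr ?_ fun _ _ => rfl
    ext u
    simp
  simp only [h, mean_sum, mean_const_mul]
  exact Finset.sum_congr rfl fun u _ => by rw [spread_eq]

/-- The weights are those of independent seeds. Expanding ∏ (p + (1 − p)) gives total mass 1;
replacing p by 0 on R before expanding retains exactly the seed sets disjoint from R. -/
theorem sum_seed_weights (p : Fin n → ℝ) (R : Finset (Fin n)) :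
    ∑ A : Finset (Fin n), ((∏ u ∈ A, p u) * ∏ v ∈ Aᶜ, (1 - p v)) *
      (if ∃ u ∈ A, u ∈ R then 1 else 0) = 1 - ∏ v ∈ R, (1 - p v) := by
  have h1 : ∑ A : Finset (Fin n), ((∏ u ∈ A, p u) * ∏ v ∈ Aᶜ, (1 - p v)) = 1 := by
    have := Finset.prod_add p (fun v => 1 - p v) Finset.univ
    simp only [add_sub_cancel, Finset.prod_const_one, Finset.powerset_univ] at this
    simpa [Finset.compl_eq_univ_sdiff] using this.symm
  have h2 : ∑ A : Finset (Fin n), ((∏ u ∈ A, p u) * ∏ v ∈ Aᶜ, (1 - p v)) *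
      (if ∃ u ∈ A, u ∈ R then 0 else 1) = ∏ v ∈ R, (1 - p v) := by
    have := Finset.prod_add (fun u => if u ∈ R then 0 else p u) (fun v => 1 - p v) Finset.univ
    rw [Finset.powerset_univ] at this
    have e : ∏ i, ((if i ∈ R then 0 else p i) + (1 - p i)) = ∏ v ∈ R, (1 - p v) := by
      rw [← Finset.prod_subset (Finset.subset_univ R)]
      · exact Finset.prod_congr rfl fun v hv => by simp [hv]
      · intro v _ hv
        simp [hv]
    rw [← e, this]
    refine Finset.sum_congr rfl fun A _ => ?_
    rw [Finset.compl_eq_univ_sdiff]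
    split_ifs with h
    · obtain ⟨u, hu, huR⟩ := h
      rw [Finset.prod_eq_zero (s := A) (f := fun u => if u ∈ R then 0 else p u) hu
        (if_pos huR), zero_mul, mul_zero]
    · rw [mul_one]
      congr 1
      refine Finset.prod_congr rfl fun u hu => ?_
      rw [if_neg fun huR => h ⟨u, hu, huR⟩]
  rw [← h2, eq_sub_iff_add_eq, ← Finset.sum_add_distrib]
  refine Eq.trans (Finset.sum_congr rfl fun A _ => ?_) h1
  split_ifs <;> simp

/-- The probability that a random seed set meets the list `r`. -/
def hit (H : Fin n → ℝ) (r : RRSet n) : ℝ := 1 - (r.map fun v => 1 - H v).prod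

/-- The influence is `n` times the expected probability of hitting an RR set. -/
theorem influence_eq (h : Fin n → Mix d → ℝ) (x : Mix d) :
    influence S.net h x = S.mean fun w => hit (fun v => h v x) (S.rr w) := by
  have e : ∀ w, hit (fun v => h v x) (S.rr w) = ∑ A : Finset (Fin n),
      ((∏ u ∈ A, h u x) * ∏ v ∈ Aᶜ, (1 - h v x)) * (if ∃ u ∈ A, u ∈ S.rr w then 1 else 0) := by
    intro w
    have := sum_seed_weights (fun v => h v x) (S.rr w).toFinset
    rw [List.prod_toFinset _ (S.rr_spec w).1] at this
    rw [hit, ← this]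
    simp
  simp only [e, mean_sum, mean_const_mul]
  refine Finset.sum_congr rfl fun A _ => ?_
  rw [spread_eq, mul_comm]

/-- The sample space is finite, so this is a computation with point masses; the uniform root
contributes the factor 1/n that `mean` lacks. -/
theorem lintegral_sampleLaw [NeZero n] (f : Sample n → ℝ) (hf : ∀ w, 0 ≤ f w) :
    ∫⁻ w, ENNReal.ofReal (f w) ∂(sampleLaw S.net) = ENNReal.ofReal (S.mean f / n) := by
  have hn : (0 : ℝ) < n := by exact_mod_cast Nat.pos_of_ne_zero (NeZero.ne n)
  rw [lintegral_fintype]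
  have h : ∀ w : Sample n, sampleLaw S.net {w} = ENNReal.ofReal (S.net.prob w.2 / n) := by
    rintro ⟨v, T⟩
    rw [sampleLaw, ← Set.singleton_prod_singleton, Measure.prod_prod, Measure.pi_singleton]
    simp only [PMF.toMeasure_apply_singleton _ _ (MeasurableSet.singleton _),
      PMF.uniformOfFintype_apply, Fintype.card_fin]
    rw [Network.prob, ENNReal.ofReal_div_of_pos hn,
      ENNReal.ofReal_prod_of_nonneg fun _ _ => ENNReal.toReal_nonneg]
    simp only [ENNReal.ofReal_toReal ((S.net.D _).apply_ne_top _), ENNReal.ofReal_natCast]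
    rw [mul_comm, ENNReal.div_eq_inv_mul, mul_comm]
  have hnn : ∀ T, 0 ≤ S.net.prob T / n := fun T => div_nonneg (S.net.prob_nonneg T) hn.le
  simp only [h, ← ENNReal.ofReal_mul (hf _)]
  rw [← ENNReal.ofReal_sum_of_nonneg fun w _ => mul_nonneg (hf w) (hnn w.2)]
  congr 1
  rw [Fintype.sum_prod_type_right, mean, Finset.sum_div]
  refine Finset.sum_congr rfl fun T _ => ?_
  change ∑ v, f (v, T) * (S.net.prob T / n) = _
  rw [← Finset.sum_mul]
  ring

instance [NeZero n] (G : Network n) : IsProbabilityMeasure (sampleLaw G) := by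
  unfold sampleLaw
  infer_instance

end Setting

/-! ## Smooth monotone DR-submodular functions -/

theorem orthant_line {x y : Mix d} (hx : x ∈ orthant d) (hy : y ∈ orthant d) {t : ℝ}
    (ht : t ∈ Set.Icc (0 : ℝ) 1) : x + t • (y - x) ∈ orthant d := by
  intro i
  simp only [PiLp.add_apply, PiLp.smul_apply, PiLp.sub_apply, smul_eq_mul]
  nlinarith [hx i, hy i, ht.1, ht.2, mul_nonneg ht.1 (hy i), mul_nonneg (sub_nonneg.mpr ht.2) (hx i)]

theorem orthant_add {x u : Mix d} (hx : x ∈ orthant d) (hu : u ∈ orthant d) :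
    x + u ∈ orthant d := fun i => add_nonneg (hx i) (hu i)

theorem orthant_smul {u : Mix d} (hu : u ∈ orthant d) {t : ℝ} (ht : 0 ≤ t) :
    t • u ∈ orthant d := fun i => mul_nonneg ht (hu i)

theorem single_mem_orthant (i : Fin d) : EuclideanSpace.single i (1 : ℝ) ∈ orthant d := by
  intro j
  by_cases h : j = i <;> simp [h]

theorem inner_nonneg_of_mem_orthant {x y : Mix d} (hx : x ∈ orthant d) (hy : y ∈ orthant d) :
    0 ≤ inner ℝ x y := by
  rw [inner_eq_sum]
  exact Finset.sum_nonneg fun i _ => mul_nonneg (hx i) (hy i)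

theorem hasDerivWithinAt_line {F : Mix d → ℝ} {g : Mix d → Mix d}
    (hF : ∀ x ∈ orthant d, HasGradientWithinAt F (g x) (orthant d) x) {x y : Mix d}
    (hx : x ∈ orthant d) (hy : y ∈ orthant d) {t : ℝ} (ht : t ∈ Set.Icc (0 : ℝ) 1) :
    HasDerivWithinAt (fun t : ℝ => F (x + t • (y - x)))
      (inner ℝ (g (x + t • (y - x))) (y - x)) (Set.Icc 0 1) t := by
  have h1 := (hF _ (orthant_line hx hy ht)).hasFDerivWithinAt
  have h2 : HasDerivWithinAt (fun t : ℝ => x + t • (y - x)) (y - x) (Set.Icc 0 1) t := by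
    simpa using ((hasDerivWithinAt_id t (Set.Icc (0 : ℝ) 1)).smul_const (y - x)).const_add x
  exact h1.comp_hasDerivWithinAt t h2 fun s hs => orthant_line hx hy hs

/-- A one-sided derivative suffices, so sign information on gradients is obtained on the boundary of
the orthant too. -/
theorem nonneg_of_monotoneOn_Icc {φ : ℝ → ℝ} {c : ℝ}
    (hφ : HasDerivWithinAt φ c (Set.Icc 0 1) 0) (hm : MonotoneOn φ (Set.Icc 0 1)) : 0 ≤ c := by
  rw [← hφ.derivWithin (uniqueDiffOn_Icc zero_lt_one 0 (by simp))]
  exact hm.derivWithin_nonneg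

/-- A gradient along a nonnegative direction at the start of the segment. -/
theorem hasDerivWithinAt_line_zero {F : Mix d → ℝ} {g : Mix d → Mix d}
    (hF : ∀ x ∈ orthant d, HasGradientWithinAt F (g x) (orthant d) x) {x u : Mix d}
    (hx : x ∈ orthant d) (hu : u ∈ orthant d) :
    HasDerivWithinAt (fun t : ℝ => F (x + t • u)) (inner ℝ (g x) u) (Set.Icc 0 1) 0 := by
  have := hasDerivWithinAt_line hF hx (orthant_add hx hu) (t := 0) (by simp)
  simpa using this

theorem gradient_nonneg {F : Mix d → ℝ} {g : Mix d → Mix d}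
    (hF : ∀ x ∈ orthant d, HasGradientWithinAt F (g x) (orthant d) x) (hm : IsMonotone F)
    {x : Mix d} (hx : x ∈ orthant d) : g x ∈ orthant d := by
  intro i
  have h1 := hasDerivWithinAt_line_zero hF hx (single_mem_orthant i)
  rw [EuclideanSpace.inner_single_right] at h1
  have := nonneg_of_monotoneOn_Icc h1 ?_
  · simpa using this
  · intro s hs t _ hst
    refine hm _ (orthant_add hx (orthant_smul (single_mem_orthant i) hs.1)) _
      (orthant_add hx (orthant_smul (single_mem_orthant i) (hs.1.trans hst))) fun j => ?_
    simp only [PiLp.add_apply, PiLp.smul_apply, smul_eq_mul]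
    have := single_mem_orthant i j
    nlinarith

/-- DR-submodularity says that F(x + t e_i) − F(y + t e_i) is nondecreasing in t. -/
theorem gradient_antitone {F : Mix d → ℝ} {g : Mix d → Mix d}
    (hF : ∀ x ∈ orthant d, HasGradientWithinAt F (g x) (orthant d) x) (hm : IsDRSubmodular F)
    {x y : Mix d} (hx : x ∈ orthant d) (hy : y ∈ orthant d) (hxy : ∀ i, x i ≤ y i) (i : Fin d) :
    g y i ≤ g x i := by
  have h1 := hasDerivWithinAt_line_zero hF hx (single_mem_orthant i)
  have h2 := hasDerivWithinAt_line_zero hF hy (single_mem_orthant i)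
  rw [EuclideanSpace.inner_single_right] at h1 h2
  have := nonneg_of_monotoneOn_Icc (h1.sub h2) ?_
  · simpa using this
  · intro s hs t _ hst
    have hs1 := orthant_add hx (orthant_smul (single_mem_orthant i) hs.1)
    have hs2 := orthant_add hy (orthant_smul (single_mem_orthant i) hs.1)
    rcases hst.eq_or_lt with rfl | hst
    · exact le_rfl
    have h := hm _ hs1 _ hs2 (fun j => by simpa using hxy j) i (t - s) (sub_pos.mpr hst)
    have e : ∀ z : Mix d, z + s • EuclideanSpace.single i (1 : ℝ) +
        EuclideanSpace.single i (t - s) = z + t • EuclideanSpace.single i (1 : ℝ) := by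
      intro z
      ext j
      simp only [PiLp.add_apply, PiLp.smul_apply, PiLp.single_apply, smul_eq_mul]
      split_ifs <;> ring
    rw [e, e] at h
    simp only [Pi.sub_apply]
    linarith

/-- Monotonicity makes the gradient nonnegative, so one may move from x in the direction g x without
leaving the orthant. The Lipschitz bound along this ray gives ‖g x‖² ≤ L‖g x‖. -/
theorem norm_gradient_le {F : Mix d → ℝ} {g : Mix d → Mix d} {L : ℝ}
    (hF : ∀ x ∈ orthant d, HasGradientWithinAt F (g x) (orthant d) x) (hm : IsMonotone F)
    (hL : IsLipschitz L F) (hL0 : 0 ≤ L) {x : Mix d} (hx : x ∈ orthant d) : ‖g x‖ ≤ L := by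
  have hg := gradient_nonneg hF hm hx
  have h1 := hasDerivWithinAt_line_zero hF hx hg
  rw [real_inner_self_eq_norm_sq] at h1
  have h2 := ((hasDerivWithinAt_id (0 : ℝ) (Set.Icc (0 : ℝ) 1)).const_mul (L * ‖g x‖)).sub h1
  have h3 := nonneg_of_monotoneOn_Icc h2 ?_
  · by_contra! hlt
    have := norm_nonneg (g x)
    nlinarith
  · intro s hs t _ hst
    have h4 := hL _ (orthant_add hx (orthant_smul hg (hs.1.trans hst))) _
      (orthant_add hx (orthant_smul hg hs.1))
    have e : x + t • g x - (x + s • g x) = (t - s) • g x := by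
      rw [sub_smul]; abel
    rw [e, norm_smul, Real.norm_of_nonneg (sub_nonneg.mpr hst)] at h4
    have h5 := (abs_le.mp h4).2
    simp only [Pi.sub_apply, id]
    linarith

/-- A nonnegative monotone function on the orthant with an antitone, `β`-Lipschitz gradient. -/
structure DRSmooth (β : ℝ) (F : Mix d → ℝ) (g : Mix d → Mix d) : Prop where
  nonneg : ∀ x ∈ orthant d, 0 ≤ F x
  mono : IsMonotone F
  grad : ∀ x ∈ orthant d, HasGradientWithinAt F (g x) (orthant d) x
  lip : ∀ x ∈ orthant d, ∀ y ∈ orthant d, ‖g x - g y‖ ≤ β * ‖x - y‖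
  anti : ∀ x ∈ orthant d, ∀ y ∈ orthant d, (∀ i, x i ≤ y i) → ∀ i, g y i ≤ g x i

namespace DRSmooth

variable {β β' c : ℝ} {F F' : Mix d → ℝ} {g g' : Mix d → Mix d}

theorem zero : DRSmooth (d := d) 0 (fun _ => 0) (fun _ => 0) where
  nonneg _ _ := le_rfl
  mono _ _ _ _ _ := le_rfl
  grad x _ := by
    rw [hasGradientWithinAt_iff_hasFDerivWithinAt, map_zero]
    exact hasFDerivWithinAt_const _ _ _
  lip _ _ _ _ := by simp
  anti _ _ _ _ _ _ := le_rfl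

theorem add (h : DRSmooth β F g) (h' : DRSmooth β' F' g') :
    DRSmooth (β + β') (fun x => F x + F' x) (fun x => g x + g' x) where
  nonneg x hx := add_nonneg (h.nonneg x hx) (h'.nonneg x hx)
  mono x hx y hy hxy := add_le_add (h.mono x hx y hy hxy) (h'.mono x hx y hy hxy)
  grad x hx := by
    rw [hasGradientWithinAt_iff_hasFDerivWithinAt, map_add]
    exact (h.grad x hx).hasFDerivWithinAt.add (h'.grad x hx).hasFDerivWithinAt
  lip x hx y hy := by
    rw [add_sub_add_comm, add_mul]
    exact (norm_add_le _ _).trans (add_le_add (h.lip x hx y hy) (h'.lip x hx y hy))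
  anti x hx y hy hxy i := add_le_add (h.anti x hx y hy hxy i) (h'.anti x hx y hy hxy i)

theorem const_mul (h : DRSmooth β F g) (hc : 0 ≤ c) :
    DRSmooth (c * β) (fun x => c * F x) (fun x => c • g x) where
  nonneg x hx := mul_nonneg hc (h.nonneg x hx)
  mono x hx y hy hxy := mul_le_mul_of_nonneg_left (h.mono x hx y hy hxy) hc
  grad x hx := by
    rw [hasGradientWithinAt_iff_hasFDerivWithinAt, map_smul]
    exact (h.grad x hx).hasFDerivWithinAt.const_mul c
  lip x hx y hy := by
    rw [← smul_sub, norm_smul, Real.norm_of_nonneg hc, mul_assoc]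
    exact mul_le_mul_of_nonneg_left (h.lip x hx y hy) hc
  anti x hx y hy hxy i := mul_le_mul_of_nonneg_left (h.anti x hx y hy hxy i) hc

theorem list_sum {ι : Type*} (l : List ι) {B : ι → ℝ} {f : ι → Mix d → ℝ} {f' : ι → Mix d → Mix d}
    (h : ∀ i ∈ l, DRSmooth (B i) (f i) (f' i)) :
    DRSmooth (l.map B).sum (fun x => (l.map fun i => f i x).sum)
      (fun x => (l.map fun i => f' i x).sum) := by
  induction l with
  | nil => exact zero
  | cons i l ih =>
    simpa using (h i (by simp)).add (ih fun j hj => h j (by simp [hj]))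

/-- Concavity along nonnegative directions. -/
theorem le_of_nonneg_direction (h : DRSmooth β F g) {x u : Mix d} (hx : x ∈ orthant d)
    (hu : u ∈ orthant d) :
    F (x + u) - F x ≤ inner ℝ (g x) u ∧ inner ℝ (g (x + u)) u ≤ F (x + u) - F x := by
  have hy := orthant_add hx hu
  have hline := fun t (ht : t ∈ Set.Icc (0 : ℝ) 1) => hasDerivWithinAt_line h.grad hx hy ht
  simp only [add_sub_cancel_left] at hline
  -- The mean value point lies between the two ends in the coordinatewise order, so the antitone
  -- gradient compares the slope with both end gradients.
  obtain ⟨t, ht, e⟩ := exists_hasDerivAt_eq_slope (fun t : ℝ => F (x + t • u))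
    (fun t => inner ℝ (g (x + t • u)) u) zero_lt_one
    (fun t ht => (hline t ht).continuousWithinAt)
    (fun t ht => (hline t (Set.Ioo_subset_Icc_self ht)).hasDerivAt (Icc_mem_nhds ht.1 ht.2))
  simp only [one_smul, zero_smul, add_zero, sub_zero, div_one] at e
  rw [← e, ← sub_nonneg, ← sub_nonneg (a := inner ℝ (g (x + t • u)) u), ← inner_sub_left,
    ← inner_sub_left]
  have ht' := orthant_add hx (orthant_smul hu ht.1.le)
  refine ⟨inner_nonneg_of_mem_orthant (fun i => ?_) hu,
    inner_nonneg_of_mem_orthant (fun i => ?_) hu⟩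
  · refine sub_nonneg.mpr (h.anti x hx _ ht' (fun j => ?_) i)
    simpa using mul_nonneg ht.1.le (hu j)
  · refine sub_nonneg.mpr (h.anti _ ht' _ hy (fun j => ?_) i)
    simpa using mul_le_of_le_one_left (hu j) ht.2.le

/-- The gradient inequality that yields the approximation ratio `1/2`. -/
theorem inner_gradient_ge (h : DRSmooth β F g) {x y : Mix d} (hx : x ∈ orthant d)
    (hy : y ∈ orthant d) : F y - 2 * F x ≤ inner ℝ (g x) (y - x) := by
  -- Split y − x = p − q with p = x ∨ y − x and q = x − x ∧ y. Concavity along p bounds ⟨g x, p⟩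
  -- below by F(x ∨ y) − F(x) ≥ F(y) − F(x), and concavity along q bounds ⟨g x, q⟩ above by F(x) −
  -- F(x ∧ y) ≤ F(x).
  set p : Mix d := WithLp.toLp 2 fun i => max (y i - x i) 0 with hp
  set q : Mix d := WithLp.toLp 2 fun i => max (x i - y i) 0 with hq
  set m : Mix d := WithLp.toLp 2 fun i => min (x i) (y i) with hm
  have hp0 : p ∈ orthant d := fun i => le_max_right _ _
  have hq0 : q ∈ orthant d := fun i => le_max_right _ _
  have hm0 : m ∈ orthant d := fun i => le_min (hx i) (hy i)
  have e1 : m + q = x := by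
    ext i
    change min (x i) (y i) + max (x i - y i) 0 = x i
    rcases le_total (x i) (y i) with h | h <;> simp [h]
  have e2 : y - x = p - q := by
    ext i
    change y i - x i = max (y i - x i) 0 - max (x i - y i) 0
    rcases le_total (x i) (y i) with h | h <;> simp [h]
  have h1 := (h.le_of_nonneg_direction hx hp0).1
  have h2 := (h.le_of_nonneg_direction hm0 hq0).2
  rw [e1] at h2
  have h3 : F y ≤ F (x + p) := by
    refine h.mono y hy _ (orthant_add hx hp0) fun i => ?_
    change y i ≤ x i + max (y i - x i) 0
    linarith [le_max_left (y i - x i) 0]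
  have h4 := h.nonneg m hm0
  rw [e2, inner_sub_right]
  linarith

/-- The ascent lemma. -/
theorem ascent (h : DRSmooth β F g) {x y : Mix d} (hx : x ∈ orthant d) (hy : y ∈ orthant d) :
    F x + inner ℝ (g x) (y - x) - β / 2 * ‖y - x‖ ^ 2 ≤ F y := by
  have hline := fun t (ht : t ∈ Set.Icc (0 : ℝ) 1) => hasDerivWithinAt_line h.grad hx hy ht
  -- The difference between F on the segment and its quadratic minorant has a nonnegative
  -- derivative, because the gradient is β-Lipschitz; comparing the ends gives the claim.
  have hψ : ∀ t ∈ Set.Icc (0 : ℝ) 1, HasDerivWithinAt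
      (fun t : ℝ => F (x + t • (y - x)) - (t * inner ℝ (g x) (y - x) - t ^ 2 * (β / 2 * ‖y - x‖ ^ 2)))
      (inner ℝ (g (x + t • (y - x))) (y - x) - (inner ℝ (g x) (y - x) - 2 * t * (β / 2 * ‖y - x‖ ^ 2)))
      (Set.Icc 0 1) t := by
    intro t ht
    have h1 := ((hasDerivWithinAt_id t (Set.Icc (0 : ℝ) 1)).mul_const (inner ℝ (g x) (y - x))).sub
      (((hasDerivWithinAt_id t (Set.Icc (0 : ℝ) 1)).pow 2).mul_const (β / 2 * ‖y - x‖ ^ 2))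
    have h2 := (hline t ht).sub h1
    refine h2.congr_deriv ?_
    simp
  have hmono := monotoneOn_of_deriv_nonneg (convex_Icc (0 : ℝ) 1)
    (fun t ht => (hψ t ht).continuousWithinAt) (fun t ht => ?_) (fun t ht => ?_)
  · have := hmono (Set.left_mem_Icc.mpr zero_le_one) (Set.right_mem_Icc.mpr zero_le_one) zero_le_one
    simp at this
    linarith
  · rw [interior_Icc] at ht
    exact ((hψ t (Set.Ioo_subset_Icc_self ht)).hasDerivAt
      (Icc_mem_nhds ht.1 ht.2)).differentiableAt.differentiableWithinAt
  · rw [interior_Icc] at ht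
    rw [((hψ t (Set.Ioo_subset_Icc_self ht)).hasDerivAt (Icc_mem_nhds ht.1 ht.2)).deriv]
    have hz := orthant_line hx hy (Set.Ioo_subset_Icc_self ht)
    have h1 := h.lip x hx _ hz
    have h2 := real_inner_le_norm (g x - g (x + t • (y - x))) (y - x)
    have e : x - (x + t • (y - x)) = -(t • (y - x)) := by abel
    rw [e, norm_neg, norm_smul, Real.norm_of_nonneg ht.1.le] at h1
    have h3 := mul_le_mul_of_nonneg_right h1 (norm_nonneg (y - x))
    rw [inner_sub_left] at h2
    nlinarith

end DRSmooth

/-! ## The probability of hitting an RR set -/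

open Setting in
/-- The gradient of the hitting probability, given the gradients `O` of the `H`. -/
def hitGrad (H : Fin n → ℝ) (O : Fin n → Mix d) : RRSet n → Mix d
  | [] => 0
  | v :: r => (1 - hit H r) • O v + (1 - H v) • hitGrad H O r

open Setting in
theorem hit_cons (H : Fin n → ℝ) (v : Fin n) (r : RRSet n) :
    hit H (v :: r) = 1 - (1 - H v) * (1 - hit H r) := by
  simp [hit]

open Setting in
theorem hit_mem (H : Fin n → ℝ) (r : RRSet n) (hH : ∀ v, H v ∈ Set.Icc (0 : ℝ) 1) :
    hit H r ∈ Set.Icc (0 : ℝ) 1 := by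
  induction r with
  | nil => simp [hit]
  | cons v r ih =>
    rw [hit_cons]
    have := hH v
    constructor
    · nlinarith [ih.1, ih.2, this.1, this.2, mul_nonneg ih.1 (sub_nonneg.mpr this.2)]
    · nlinarith [ih.1, ih.2, this.1, this.2, mul_nonneg (sub_nonneg.mpr ih.2) (sub_nonneg.mpr this.2)]

/-- What is assumed of the strategy activation functions for the proximal gradient method. -/
structure ActivationSmooth (h : Fin n → Mix d → ℝ) (h' : Fin n → Mix d → Mix d) (L β : ℝ) :
    Prop where
  mem : ∀ v, ∀ x ∈ orthant d, h v x ∈ Set.Icc (0 : ℝ) 1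
  mono : ∀ v, IsMonotone (h v)
  dr : ∀ v, IsDRSubmodular (h v)
  lip : ∀ v, IsLipschitz L (h v)
  smooth : ∀ v, IsSmooth β (h v) (h' v)
  L_nonneg : 0 ≤ L

open Setting in
/-- The regularity of the hitting probability of an RR set. -/
theorem hit_regular {h : Fin n → Mix d → ℝ} {h' : Fin n → Mix d → Mix d} {L β : ℝ}
    (hh : ActivationSmooth h h' L β) (r : RRSet n) :
    DRSmooth (r.length * β + r.length ^ 2 * L ^ 2) (fun x => hit (fun v => h v x) r)
      (fun x => hitGrad (fun v => h v x) (fun v => h' v x) r) ∧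
    (∀ x ∈ orthant d, hitGrad (fun v => h v x) (fun v => h' v x) r ∈ orthant d) ∧
    (∀ x ∈ orthant d, ‖hitGrad (fun v => h v x) (fun v => h' v x) r‖ ≤ r.length * L) ∧
    (∀ x ∈ orthant d, ∀ y ∈ orthant d,
      |hit (fun v => h v x) r - hit (fun v => h v y) r| ≤ r.length * L * ‖x - y‖) := by
  induction r with
  | nil =>
    refine ⟨?_, fun _ _ _ => le_rfl, by simp [hitGrad], by simp [hit]⟩
    simpa [hit, hitGrad] using DRSmooth.zero (d := d)
  | cons v r ih =>
    obtain ⟨hs, hpos, hnorm, hlip⟩ := ih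
    have hv := hh.mem v
    have hr := fun x (hx : x ∈ orthant d) => hit_mem (fun v => h v x) r fun v => hh.mem v x hx
    have hL := hh.L_nonneg
    have hgn := fun x (hx : x ∈ orthant d) =>
      norm_gradient_le (hh.smooth v).1 (hh.mono v) (hh.lip v) hL hx
    have hgp := fun x (hx : x ∈ orthant d) => gradient_nonneg (hh.smooth v).1 (hh.mono v) hx
    simp only [hit_cons, hitGrad, List.length_cons]
    push_cast
    set ρ : ℝ := (r.length : ℝ)
    have hρ : 0 ≤ ρ := Nat.cast_nonneg _
    set f := fun x => hit (fun v => h v x) r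
    set g := fun x => hitGrad (fun v => h v x) (fun v => h' v x) r
    refine ⟨⟨?_, ?_, ?_, ?_, ?_⟩, ?_, ?_, ?_⟩
    · intro x hx
      have := (hit_mem (fun v => h v x) (v :: r) fun v => hh.mem v x hx).1
      rwa [hit_cons] at this
    · intro x hx y hy hxy
      have h1 := hh.mono v x hx y hy hxy
      have h2 := hs.mono x hx y hy hxy
      have h3 := mul_le_mul (sub_le_sub_left h1 1) (sub_le_sub_left h2 1)
        (sub_nonneg.mpr (hr y hy).2) (sub_nonneg.mpr (hv x hx).2)
      linarith
    · intro x hx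
      rw [hasGradientWithinAt_iff_hasFDerivWithinAt, map_add, map_smul, map_smul]
      have h1 := ((hh.smooth v).1 x hx).hasFDerivWithinAt.const_sub 1
      have h2 := (hs.grad x hx).hasFDerivWithinAt.const_sub 1
      refine ((h1.mul h2).const_sub 1).congr_fderiv ?_
      simp only [smul_neg, neg_add_rev, neg_neg]
      rfl
    · intro x hx y hy
      have h1 := (hh.smooth v).2 x hx y hy
      have h2 := hs.lip x hx y hy
      have h3 := hh.lip v x hx y hy
      have h4 := hlip x hx y hy
      -- The first two terms change a gradient and cost β + (ρβ + ρ²L²); the last two change a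
      -- coefficient and cost 2ρL². Altogether this is at most (ρ+1)β + (ρ+1)²L².
      have e : (1 - f x) • h' v x + (1 - h v x) • g x - ((1 - f y) • h' v y + (1 - h v y) • g y) =
          ((1 - f x) • (h' v x - h' v y) + (1 - h v x) • (g x - g y)) +
          ((f y - f x) • h' v y + (h v y - h v x) • g y) := by
        simp only [sub_smul, smul_sub, one_smul]
        abel
      have hn : 0 ≤ ‖x - y‖ := norm_nonneg _
      have t1 : ‖(1 - f x) • (h' v x - h' v y)‖ ≤ β * ‖x - y‖ := by
        rw [norm_smul, Real.norm_of_nonneg (sub_nonneg.mpr (hr x hx).2)]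
        exact (mul_le_of_le_one_left (norm_nonneg _) (by linarith [(hr x hx).1])).trans h1
      have t2 : ‖(1 - h v x) • (g x - g y)‖ ≤ (ρ * β + ρ ^ 2 * L ^ 2) * ‖x - y‖ := by
        rw [norm_smul, Real.norm_of_nonneg (sub_nonneg.mpr (hv x hx).2)]
        exact (mul_le_of_le_one_left (norm_nonneg _) (by linarith [(hv x hx).1])).trans h2
      have t3 : ‖(f y - f x) • h' v y‖ ≤ ρ * L * ‖x - y‖ * L := by
        rw [norm_smul, Real.norm_eq_abs, abs_sub_comm]
        exact mul_le_mul h4 (hgn y hy) (norm_nonneg _) (by positivity)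
      have t4 : ‖(h v y - h v x) • g y‖ ≤ L * ‖x - y‖ * (ρ * L) := by
        rw [norm_smul, Real.norm_eq_abs, abs_sub_comm]
        exact mul_le_mul h3 (hnorm y hy) (norm_nonneg _) (by positivity)
      rw [e]
      have t := (norm_add_le ((1 - f x) • (h' v x - h' v y) + (1 - h v x) • (g x - g y))
        ((f y - f x) • h' v y + (h v y - h v x) • g y)).trans
        (add_le_add (norm_add_le _ _) (norm_add_le _ _))
      have hLx := mul_nonneg (sq_nonneg L) hn
      nlinarith
    · intro x hx y hy hxy i
      have h1 := gradient_antitone (hh.smooth v).1 (hh.dr v) hx hy hxy i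
      have h2 := hs.anti x hx y hy hxy i
      have h3 := hh.mono v x hx y hy hxy
      have h4 := hs.mono x hx y hy hxy
      simp only [PiLp.add_apply, PiLp.smul_apply, smul_eq_mul]
      exact add_le_add
        (mul_le_mul (sub_le_sub_left h4 1) h1 (hgp y hy i) (sub_nonneg.mpr (hr x hx).2))
        (mul_le_mul (sub_le_sub_left h3 1) h2 (hpos y hy i) (sub_nonneg.mpr (hv x hx).2))
    · intro x hx i
      simp only [PiLp.add_apply, PiLp.smul_apply, smul_eq_mul]
      exact add_nonneg (mul_nonneg (sub_nonneg.mpr (hr x hx).2) (hgp x hx i))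
        (mul_nonneg (sub_nonneg.mpr (hv x hx).2) (hpos x hx i))
    · intro x hx
      refine (norm_add_le _ _).trans ?_
      rw [norm_smul, norm_smul, Real.norm_of_nonneg (sub_nonneg.mpr (hr x hx).2),
        Real.norm_of_nonneg (sub_nonneg.mpr (hv x hx).2)]
      have h1 := mul_le_of_le_one_left (norm_nonneg (h' v x)) (by linarith [(hr x hx).1] :
        1 - hit (fun v => h v x) r ≤ 1)
      have h2 := mul_le_of_le_one_left
        (norm_nonneg (hitGrad (fun v => h v x) (fun v => h' v x) r))
        (by linarith [(hv x hx).1] : 1 - h v x ≤ 1)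
      have h3 := hgn x hx
      have h4 := hnorm x hx
      linarith
    · intro x hx y hy
      have h3 := hh.lip v x hx y hy
      have h4 := hlip x hx y hy
      have e : 1 - (1 - h v x) * (1 - f x) - (1 - (1 - h v y) * (1 - f y)) =
          (1 - f x) * (h v x - h v y) + (1 - h v y) * (f x - f y) := by ring
      change |1 - (1 - h v x) * (1 - f x) - (1 - (1 - h v y) * (1 - f y))| ≤ _
      rw [e]
      refine (abs_add_le _ _).trans ?_
      rw [abs_mul, abs_mul, abs_of_nonneg (sub_nonneg.mpr (hr x hx).2),
        abs_of_nonneg (sub_nonneg.mpr (hv y hy).2)]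
      have h1 := mul_le_of_le_one_left (abs_nonneg (h v x - h v y)) (by linarith [(hr x hx).1] :
        1 - hit (fun v => h v x) r ≤ 1)
      have h2 := mul_le_of_le_one_left (abs_nonneg (f x - f y))
        (by linarith [(hv y hy).1] : 1 - h v y ≤ 1)
      change |f x - f y| ≤ _ at h4
      nlinarith

namespace Timed

variable {α σ : Type}

theorem val_loop_append (f : σ → α → Timed σ) (s : σ) (l m : List α) :
    (loop f s (l ++ m)).val = (loop f (loop f s l).val m).val := by
  induction l generalizing s with
  | nil => rfl
  | cons a l ih => exact ih _

end Timed

namespace Setting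

variable (S : Setting n d)

/-! ## Best iterates -/

/-- The iterates of `x ← step t x`. -/
def iterates (step : ℕ → Mix d → Timed (Mix d)) : ℕ → Mix d
  | 0 => S.start
  | t + 1 => (step t (iterates step t)).val

/-- One pass of the loop of `bestIterate`. -/
def bestStep (step : ℕ → Mix d → Timed (Mix d)) (obj : Mix d → Timed ℝ)
    (s : Mix d × Mix d × ℝ) (t : ℕ) : Timed (Mix d × Mix d × ℝ) := do
  let x ← step t s.1
  let v ← obj x
  tick 1
  pure (if s.2.2 < v then (x, x, v) else (x, s.2.1, s.2.2))

theorem bestIterate_eq (step : ℕ → Mix d → Timed (Mix d)) (obj : Mix d → Timed ℝ) (T : ℕ) :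
    S.bestIterate step obj T = (do
      let v₀ ← obj S.start
      let r ← loop (bestStep step obj) (S.start, S.start, v₀) (List.range T)
      pure r.2.1) := rfl

/-- The comparison includes the starting point, which matters when T = 0. -/
theorem bestIterate_spec (step : ℕ → Mix d → Timed (Mix d)) (obj : Mix d → Timed ℝ) (T : ℕ) :
    (∃ t ≤ T, (S.bestIterate step obj T).val = S.iterates step t) ∧
      ∀ t ≤ T, (obj (S.iterates step t)).val ≤ (obj (S.bestIterate step obj T).val).val := by
  have key : ∃ b, (loop (bestStep step obj) (S.start, S.start, (obj S.start).val)
      (List.range T)).val = (S.iterates step T, b, (obj b).val) ∧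
      (∃ t ≤ T, b = S.iterates step t) ∧
      ∀ t ≤ T, (obj (S.iterates step t)).val ≤ (obj b).val := by
    induction T with
    | zero =>
      refine ⟨S.start, rfl, ⟨0, le_rfl, rfl⟩, fun t ht => ?_⟩
      obtain rfl : t = 0 := by omega
      exact le_rfl
    | succ T ih =>
      obtain ⟨b, h1, ⟨t, ht, hb⟩, h3⟩ := ih
      rw [List.range_succ, val_loop_append, h1]
      have e : (loop (bestStep step obj) (S.iterates step T, b, (obj b).val) [T]).val =
          if (obj b).val < (obj (S.iterates step (T + 1))).val then
            (S.iterates step (T + 1), S.iterates step (T + 1), (obj (S.iterates step (T + 1))).val)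
          else (S.iterates step (T + 1), b, (obj b).val) := rfl
      rw [e]
      split_ifs with h
      · refine ⟨_, rfl, ⟨T + 1, le_rfl, rfl⟩, fun s hs => ?_⟩
        rcases hs.eq_or_lt with rfl | hs
        · exact le_rfl
        · exact (h3 s (by omega)).trans h.le
      · refine ⟨b, rfl, ⟨t, by omega, hb⟩, fun s hs => ?_⟩
        rcases hs.eq_or_lt with rfl | hs
        · exact not_lt.mp h
        · exact h3 s (by omega)
  obtain ⟨b, h1, h2, h3⟩ := key
  have hb : (S.bestIterate step obj T).val = b := by
    rw [bestIterate_eq]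
    simp only [val_bind, val_pure, h1]
  rw [hb]
  exact ⟨h2, h3⟩

theorem time_bestIterate_le (step : ℕ → Mix d → Timed (Mix d)) (obj : Mix d → Timed ℝ) (T : ℕ)
    (s o : ℕ) (hs : ∀ t x, (step t x).time ≤ s) (ho : ∀ x, (obj x).time ≤ o) :
    (S.bestIterate step obj T).time ≤ o + T * (s + o + 2) := by
  have h1 := time_loop_le (bestStep step obj) (fun _ => s + (o + 1)) (List.range T)
    (S.start, S.start, (obj S.start).val) (fun x t _ => by
      have h2 := hs t x.1
      have h3 := ho (step t x.1).val
      simp only [bestStep, time_bind, time_tick, time_pure]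
      omega)
  rw [bestIterate_eq]
  simp only [time_bind, time_pure]
  simp only [List.map_const', List.sum_replicate, List.length_range, smul_eq_mul] at h1
  have := ho S.start
  have e : s + (o + 1) + 1 = s + o + 2 := by ring
  rw [e] at h1
  omega

/-! ## The objective function -/

/-- The estimate `ĝ_R` for the seed probabilities `H`. -/
def hatG (H : Fin n → ℝ) (R : List (RRSet n)) : ℝ := (n : ℝ) / R.length * (R.map (hit H)).sum

/-- The remaining budget, weighted by the balance parameter. -/
def slack (x : Mix d) : ℝ := S.lam * (S.k - cost S.costNorm x)

theorem val_objHatT (evalH : Fin n → Mix d → Timed ℝ) (R : List (RRSet n)) (x : Mix d) :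
    (S.objHatT evalH R x).val = hatG (fun v => (evalH v x).val) R + S.slack x := by
  simp only [objHatT, hatG, slack, val_bind, val_tabulate, val_sumList, val_prodList, val_pure,
    val_costT]
  rfl

/-- The total width of a sequence of RR sets. -/
def totalWidth (R : List (RRSet n)) : ℕ := (R.map S.net.width).sum

/-- All members of a sequence are RR sets. -/
def IsRR (R : List (RRSet n)) : Prop := ∀ r ∈ R, ∃ w, r = S.rr w

variable {S}

/-- The width of an RR set is at least its length and at least 1, so both the cost per node and the
cost per set are charged to it. -/
theorem sum_le_totalWidth {R : List (RRSet n)} (hR : S.IsRR R) (a b : ℕ) :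
    (R.map fun r => a * r.length + b).sum ≤ (a + b) * S.totalWidth R := by
  rw [totalWidth, ← List.sum_map_mul_left]
  refine List.sum_le_sum fun r hr => ?_
  obtain ⟨w, rfl⟩ := hR r hr
  have h1 := S.one_le_width_rr w
  have h2 := S.net.length_le_width (S.rr w)
  nlinarith

theorem time_objHatT_le (evalH : Fin n → Mix d → Timed ℝ) (e : ℕ) (he : ∀ v x, (evalH v x).time ≤ e)
    {R : List (RRSet n)} (hR : S.IsRR R) (x : Mix d) :
    (S.objHatT evalH R x).time ≤ n * (e + 1) + 4 * S.totalWidth R + (2 * d + 2) := by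
  have h1 : ∑ v, ((evalH v x).time + 1) ≤ n * (e + 1) := by
    refine (Finset.sum_le_sum fun v _ => Nat.add_le_add_right (he v x) 1).trans ?_
    simp
  have h2 := sum_le_totalWidth hR 2 2
  have h3 := S.time_costT_le x
  have h4 : (S.objHatT evalH R x).time = ∑ v, ((evalH v x).time + 1) +
      ((R.map fun r => (r.map fun _ => 1 + 0 + 1).sum + (1 + 0) + 1).sum +
      ((S.costT x).time + (1 + 0))) := rfl
  have h5 : (R.map fun r => (r.map fun _ => 1 + 0 + 1).sum + (1 + 0) + 1) =
      R.map fun r => 2 * r.length + 2 := by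
    refine List.map_congr_left fun r _ => ?_
    simp [mul_comm]
  rw [h4, h5]
  omega

theorem val_moment (m : ℕ) (R : List (RRSet n)) :
    (moment m R).val = (R.map fun r => (r.length : ℝ) ^ m).sum / R.length := by
  simp [moment]

theorem time_moment_le (m : ℕ) {R : List (RRSet n)} (hR : S.IsRR R) :
    (moment m R).time ≤ 3 * S.totalWidth R + 1 := by
  have h2 := sum_le_totalWidth hR 1 2
  have h1 : (moment m R).time = (R.map fun r => r.length + 1 + 0 + 1).sum + (1 + 0) := rfl
  have h3 : (R.map fun r => r.length + 1 + 0 + 1) = R.map fun r => 1 * r.length + 2 :=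
    List.map_congr_left fun r _ => by ring
  rw [h1, h3]
  omega

theorem moment_le (m : ℕ) {R : List (RRSet n)} (hR : S.IsRR R) :
    (moment m R).val ≤ (n : ℝ) ^ m := by
  rw [val_moment]
  -- This form covers the empty sequence too, whose moment is 0 / 0 = 0.
  refine div_le_of_le_mul₀ (Nat.cast_nonneg _) (by positivity) ?_
  have : (R.map fun r => (r.length : ℝ) ^ m).sum ≤ (R.map fun _ => (n : ℝ) ^ m).sum := by
    refine List.sum_le_sum fun r hr => ?_
    obtain ⟨w, rfl⟩ := hR r hr
    exact pow_le_pow_left₀ (Nat.cast_nonneg _) (by exact_mod_cast S.length_rr_le w) m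
  simpa [mul_comm] using this

theorem moment_nonneg (m : ℕ) (R : List (RRSet n)) : 0 ≤ (moment m R).val := by
  rw [val_moment]
  exact div_nonneg (List.sum_nonneg (by simp)) (Nat.cast_nonneg _)

theorem one_le_moment (m : ℕ) {R : List (RRSet n)} (hR : S.IsRR R) (h0 : R ≠ []) :
    1 ≤ (moment m R).val := by
  have hpos : (0 : ℝ) < R.length := by exact_mod_cast List.length_pos_iff.mpr h0
  rw [val_moment, le_div_iff₀ hpos]
  have : (R.map fun _ => (1 : ℝ)).sum ≤ (R.map fun r => (r.length : ℝ) ^ m).sum := by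
    refine List.sum_le_sum fun r hr => ?_
    obtain ⟨w, rfl⟩ := hR r hr
    exact one_le_pow₀ (by exact_mod_cast S.one_le_length_rr w)
  simpa using this

/-! ## The gradient of the objective function -/

/-- The coefficient of a node is the product before it, carried down in `p`, times the product after
it, returned by the recursion. This takes linear time and avoids dividing by 1 − H v, which may be
0. -/
theorem leaveOneOut_spec (H : Fin n → ℝ) (O : Fin n → Mix d) (i : Fin d) (p : ℝ) (r : RRSet n) :
    (leaveOneOut H p r).val.1 = 1 - hit H r ∧
      ((leaveOneOut H p r).val.2.map fun vc => vc.2 * O vc.1 i).sum = p * hitGrad H O r i ∧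
      (leaveOneOut H p r).time = r.length ∧ (leaveOneOut H p r).val.2.length = r.length := by
  induction r generalizing p with
  | nil => simp [leaveOneOut, hit, hitGrad]
  | cons v r ih =>
    obtain ⟨h1, h2, h3, h4⟩ := ih (p * (1 - H v))
    refine ⟨?_, ?_, ?_, ?_⟩
    · simp only [leaveOneOut, val_bind, val_pure, h1, hit_cons]
      ring
    · simp only [leaveOneOut, val_bind, val_pure, h1, List.map_cons, List.sum_cons, h2, hitGrad,
        PiLp.add_apply, PiLp.smul_apply, smul_eq_mul]
      ring
    · simp [leaveOneOut, h3, add_comm]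
    · simp [leaveOneOut, h4]

/-- Adding up coefficients in an array. -/
def addStep (a : Fin n → ℝ) (vc : Fin n × ℝ) : Timed (Fin n → ℝ) :=
  pure (Function.update a vc.1 (a vc.1 + vc.2))

theorem sum_update_mul (a c : Fin n → ℝ) (v : Fin n) (b : ℝ) :
    ∑ u, Function.update a v (a v + b) u * c u = ∑ u, a u * c u + b * c v := by
  have : ∀ u, Function.update a v (a v + b) u * c u =
      a u * c u + if u = v then b * c u else 0 := by
    intro u
    by_cases h : u = v
    · subst h; simp; ring
    · simp [h]
  simp only [this, Finset.sum_add_distrib, Finset.sum_ite_eq', Finset.mem_univ, if_true]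

/-- Pairing the array with a fixed vector c makes every update additive, even when nodes repeat. The
coordinates of the gradient are such pairings. -/
theorem addStep_loop (c : Fin n → ℝ) (l : List (Fin n × ℝ)) (a : Fin n → ℝ) :
    ∑ u, (loop addStep a l).val u * c u = ∑ u, a u * c u + (l.map fun vc => vc.2 * c vc.1).sum := by
  induction l generalizing a with
  | nil => simp
  | cons vc l ih =>
    rw [val_loop_cons, ih]
    simp only [addStep, val_pure, sum_update_mul, List.map_cons, List.sum_cons]
    ring

/-- The contribution of one RR set to the coefficients of the gradients. -/
def coeffStep (H : Fin n → ℝ) (a : Fin n → ℝ) (r : RRSet n) : Timed (Fin n → ℝ) := do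
  let s ← leaveOneOut H 1 r
  loop addStep a s.2

theorem coeffStep_loop (H : Fin n → ℝ) (O : Fin n → Mix d) (i : Fin d) (R : List (RRSet n))
    (a : Fin n → ℝ) :
    ∑ u, (loop (coeffStep H) a R).val u * O u i =
      ∑ u, a u * O u i + (R.map fun r => hitGrad H O r i).sum := by
  induction R generalizing a with
  | nil => simp
  | cons r R ih =>
    rw [val_loop_cons, ih]
    simp only [coeffStep, val_bind, List.map_cons, List.sum_cons]
    rw [addStep_loop, (leaveOneOut_spec H O i 1 r).2.1]
    ring

theorem list_sum_apply (l : List (Mix d)) (i : Fin d) : l.sum i = (l.map fun x => x i).sum := by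
  induction l with
  | nil => rfl
  | cons x l ih => simp [ih]

theorem val_gradHatT (h : Fin n → Mix d → ℝ) (h' : Fin n → Mix d → Mix d) (Th : ℕ)
    (R : List (RRSet n)) (x : Mix d) :
    (gradHatT h h' Th R x).val = ((n : ℝ) / R.length) •
      (R.map fun r => hitGrad (fun v => h v x) (fun v => h' v x) r).sum := by
  ext i
  have e : (gradHatT h h' Th R x).val i = (n : ℝ) / R.length *
      ((List.finRange n).map fun v =>
        (loop (coeffStep fun v => h v x) (fun _ => 0) R).val v * h' v x i).sum := rfl
  rw [e, sum_finRange, coeffStep_loop _ (fun v => h' v x), PiLp.smul_apply, list_sum_apply, List.map_map]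
  simp [Function.comp_def]

theorem time_gradHatT_le (h : Fin n → Mix d → ℝ) (h' : Fin n → Mix d → Mix d) (Th : ℕ)
    {R : List (RRSet n)} (hR : S.IsRR R) (x : Mix d) :
    (gradHatT h h' Th R x).time ≤ n * (Th + 1) + n + 3 * S.totalWidth R + d * (2 * n + 2) := by
  have e : (gradHatT h h' Th R x).time = (∑ _ : Fin n, (Th + 0 + 1)) + ((∑ _ : Fin n, (0 + 1)) +
      ((loop (coeffStep fun v => h v x) (fun _ => 0) R).time +
      ((∑ _ : Fin d, (((List.finRange n).map fun _ => 1 + 0 + 1).sum + (1 + 0) + 1)) + 0))) := rfl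
  have h1 := time_loop_le (coeffStep fun v => h v x) (fun r => 2 * r.length) R (fun _ => 0)
    (fun a r _ => by
      have := leaveOneOut_spec (d := 1) (fun v => h v x) (fun _ => 0) 0 1 r
      have h5 := time_loop_le addStep (fun _ => 0) (leaveOneOut (fun v => h v x) 1 r).val.2 a
        (fun _ _ _ => le_rfl)
      simp only [coeffStep, time_bind, this.2.2.1]
      simp [this.2.2.2] at h5
      omega)
  have h2 := sum_le_totalWidth hR 2 1
  rw [e]
  simp only [Finset.sum_const, Finset.card_univ, Fintype.card_fin, smul_eq_mul, List.map_const',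
    List.sum_replicate, List.length_finRange]
  have e2 : d * (n * (1 + 0 + 1) + (1 + 0) + 1) = d * (2 * n + 2) := by ring
  rw [e2]
  simp only [add_zero, zero_add, mul_one] at *
  omega

/-! ## The proximal gradient method -/

theorem slack_nonneg {x : Mix d} (hlam : 0 ≤ S.lam) (hx : x ∈ S.P) : 0 ≤ S.slack x :=
  mul_nonneg hlam (sub_nonneg.mpr hx.2)

/-- Progress made by one proximal gradient step. -/
theorem prox_progress {β : ℝ} {F : Mix d → ℝ} {g : Mix d → Mix d} (hF : DRSmooth β F g)
    (hβ : 0 < β) (hk : 0 ≤ S.k) (hlam : 0 ≤ S.lam) {x u z : Mix d} (hx : x ∈ S.P) (hu : u ∈ S.P)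
    (hz : z = x + (1 / β) • g x) :
    let y := (S.proxT (1 / β * S.lam) z).val
    y ∈ S.P ∧ F u + S.slack u ≤ (F y + S.slack y) + (F x + S.slack x) +
      β / 2 * (‖u - x‖ ^ 2 - ‖u - y‖ ^ 2) := by
  intro y
  obtain ⟨hy, hvi⟩ := S.proxT_spec (1 / β * S.lam) z (by positivity) hk
  refine ⟨hy, ?_⟩
  have h1 := hvi u hu
  change inner ℝ (z - y) (u - y) ≤ 1 / β * S.lam * (cost S.costNorm u - cost S.costNorm y) at h1
  -- In F u − 2 F x ≤ ⟨g x, u − y⟩ + ⟨g x, y − x⟩ the first product is bounded by the variational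
  -- inequality and the second by the ascent lemma. The ‖y − x‖² terms cancel, and the slack at x is
  -- added because it is nonnegative.
  have h2 := hF.ascent hx.1 hy.1
  have h3 := hF.inner_gradient_ge hx.1 hu.1
  have h4 := S.slack_nonneg hlam hx
  have e1 : inner ℝ (z - y) (u - y) = inner ℝ (x - y) (u - y) + 1 / β * inner ℝ (g x) (u - y) := by
    rw [hz, ← real_inner_smul_left, ← inner_add_left]
    congr 1
    abel
  have e2 : 2 * inner ℝ (x - y) (u - y) = ‖y - x‖ ^ 2 + ‖u - y‖ ^ 2 - ‖u - x‖ ^ 2 := by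
    have := norm_sub_sq_real (x - y) (u - y)
    have e : x - y - (u - y) = -(u - x) := by abel
    rw [e, norm_neg, norm_sub_rev x y] at this
    linarith
  have e3 : inner ℝ (g x) (u - x) = inner ℝ (g x) (u - y) + inner ℝ (g x) (y - x) := by
    rw [← inner_add_right]
    congr 1
    abel
  have h5 : inner ℝ (g x) (u - y) ≤ S.lam * (cost S.costNorm u - cost S.costNorm y) -
      β * inner ℝ (x - y) (u - y) := by
    rw [e1] at h1
    have := mul_le_mul_of_nonneg_left h1 hβ.le
    field_simp at this
    linarith
  have h6 : β * inner ℝ (x - y) (u - y) =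
      β / 2 * (‖y - x‖ ^ 2 + ‖u - y‖ ^ 2 - ‖u - x‖ ^ 2) := by rw [← e2]; ring
  simp only [slack] at *
  nlinarith

theorem iterates_mem (step : ℕ → Mix d → Timed (Mix d)) (h0 : S.start ∈ S.P)
    (h : ∀ t, ∀ x ∈ S.P, (step t x).val ∈ S.P) (t : ℕ) : S.iterates step t ∈ S.P := by
  induction t with
  | zero => exact h0
  | succ t ih => exact h t _ ih

section prox

variable {a : ℕ} {h : Fin n → Mix d → ℝ} {h' : Fin n → Mix d → Mix d} {Lh βh : ℝ}

theorem hatG_smooth (hh : ActivationSmooth h h' Lh βh) (R : List (RRSet n)) (Th : ℕ) :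
    DRSmooth ((moment 1 R).val * n * βh + (moment 2 R).val * n * Lh ^ 2)
      (fun x => hatG (fun v => h v x) R) (fun x => (gradHatT h h' Th R x).val) := by
  have h1 := (DRSmooth.list_sum R fun r _ => (hit_regular hh r).1).const_mul
    (c := (n : ℝ) / R.length) (by positivity)
  simp only [val_gradHatT]
  convert h1 using 1
  · rw [val_moment, val_moment, List.sum_map_add, List.sum_map_mul_right, List.sum_map_mul_right]
    simp only [pow_one]
    ring
  · rfl

/-- The approximation guarantee of the proximal gradient algorithm. -/
theorem proxGrad_spec [NeZero n] (hA : S.Admissible a h) (hh : ActivationSmooth h h' Lh βh)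
    (hβ0 : 0 ≤ βh) (hpos : 0 < βh ∨ 0 < Lh) (Th : ℕ) {R : List (RRSet n)} (hR : S.IsRR R)
    (h0 : R ≠ []) {u : Mix d} (hu : u ∈ S.P) :
    1 / 2 * hatG (fun v => h v u) R - 1 / 3 ≤
      (S.objProx h Th R (S.proxGrad h h' Lh βh Th R).val).val := by
  have hn : (0 : ℝ) < n := by exact_mod_cast Nat.pos_of_ne_zero (NeZero.ne n)
  set β := (moment 1 R).val * n * βh + (moment 2 R).val * n * Lh ^ 2 with hβdef
  have hβ : 0 < β := by
    have m1 := one_le_moment 1 hR h0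
    have m2 := one_le_moment 2 hR h0
    have hL := hh.L_nonneg
    rcases hpos with h | h <;> positivity
  set step : ℕ → Mix d → Timed (Mix d) := fun _ x => do
      let v ← gradHatT h h' Th R x
      let z ← tabulate fun i => do tick 1; pure (x i + 1 / β * v i)
      S.proxT (1 / β * S.lam) (WithLp.toLp 2 z) with hstep
  set T := ⌈3 * β * S.diam ^ 2 / (4 * S.ε)⌉₊ with hT
  have hval : (S.proxGrad h h' Lh βh Th R).val = (S.bestIterate step (S.objProx h Th R) T).val := rfl
  obtain ⟨-, hbest⟩ := S.bestIterate_spec step (S.objProx h Th R) T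
  rw [← hval] at hbest
  set Φ := (S.objProx h Th R (S.proxGrad h h' Lh βh Th R).val).val
  have hobj : ∀ x, (S.objProx h Th R x).val = hatG (fun v => h v x) R + S.slack x := fun x =>
    S.val_objHatT _ R x
  simp only [hobj] at hbest
  have hF := hatG_smooth hh R Th
  have hprog := fun x (hx : x ∈ S.P) => prox_progress (z := WithLp.toLp 2 fun i =>
    x i + 1 / β * (gradHatT h h' Th R x).val i) hF hβ hA.k_nonneg hA.lam_nonneg hx hu rfl
  have hmem : ∀ t, S.iterates step t ∈ S.P :=
    iterates_mem step hA.start_mem fun t x hx => (hprog x hx).1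
  set X := S.iterates step
  set φ := fun x => hatG (fun v => h v x) R + S.slack x
  -- Telescoping sum. Each step compares with two consecutive iterates, both at most the best value
  -- Φ, whence the factor 2.
  have hsum : ∀ s ≤ T, s * φ u ≤ 2 * s * Φ + β / 2 * (‖u - X 0‖ ^ 2 - ‖u - X s‖ ^ 2) := by
    intro s
    induction s with
    | zero => intro _; simp
    | succ s ih =>
      intro hs
      have h1 := ih (by omega)
      have h2 : φ u ≤ φ (X (s + 1)) + φ (X s) + β / 2 * (‖u - X s‖ ^ 2 - ‖u - X (s + 1)‖ ^ 2) :=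
        (hprog (X s) (hmem s)).2
      have h3 : φ (X (s + 1)) ≤ Φ := hbest (s + 1) hs
      have h4 : φ (X s) ≤ Φ := hbest s (by omega)
      push_cast
      linarith
  have hdist : ‖u - X 0‖ ≤ S.diam := hA.le_diam _ hu _ (hmem 0)
  have hε := hA.ε_pos
  have hε1 := hA.ε_lt_one
  have hTle : 3 * β * S.diam ^ 2 / (4 * S.ε) ≤ T := Nat.le_ceil _
  have hφu : hatG (fun v => h v u) R ≤ φ u := le_add_of_nonneg_right (slack_nonneg hA.lam_nonneg hu)
  have hnn := hF.nonneg u hu.1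
  -- As β > 0, no iterations are made only if Δ = 0, and then u is the starting point.
  rcases Nat.eq_zero_or_pos T with hT0 | hTpos
  · rw [hT0, Nat.cast_zero] at hTle
    have h1 : S.diam = 0 := by
      by_contra hne
      have : 0 < 3 * β * S.diam ^ 2 / (4 * S.ε) := by positivity
      linarith
    rw [h1] at hdist
    have h2 : u = X 0 := by
      rw [← sub_eq_zero, ← norm_eq_zero]
      exact le_antisymm hdist (norm_nonneg _)
    have h3 : φ (X 0) ≤ Φ := hbest 0 (Nat.zero_le _)
    rw [← h2] at h3
    change 0 ≤ hatG (fun v => h v u) R at hnn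
    linarith
  · have h1 := hsum T le_rfl
    have hTR : (0 : ℝ) < T := by exact_mod_cast hTpos
    have h2 : ‖u - X 0‖ ^ 2 ≤ S.diam ^ 2 := pow_le_pow_left₀ (norm_nonneg _) hdist 2
    have h3 := sq_nonneg ‖u - X T‖
    rw [div_le_iff₀ (by positivity)] at hTle
    have h4 : β / 2 * (‖u - X 0‖ ^ 2 - ‖u - X T‖ ^ 2) ≤ β / 2 * S.diam ^ 2 :=
      mul_le_mul_of_nonneg_left (by linarith) (by positivity)
    -- The choice of T gives βΔ²/2 ≤ (2ε/3) T ≤ (2/3) T. The weaker error 1/3 in place of ε/3 is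
    -- enough to control the stopping rule.
    have h5 : T * φ u ≤ T * (2 * Φ + 2 / 3) := by nlinarith
    have h6 := le_of_mul_le_mul_left h5 hTR
    linarith

/-- The cost of one evaluation of the objective function or of one step. -/
def unitCost (n d T : ℕ) : ℕ := n * d * T * (Nat.clog 2 d + 1)

/-- Collects every monomial that occurs in the step counts, so that these become linear in the
single quantity `unitCost`. -/
theorem le_unitCost [NeZero n] (hd : 1 ≤ d) {T : ℕ} (hT : 1 ≤ T) :
    1 ≤ unitCost n d T ∧ n * T ≤ unitCost n d T ∧ n * d * T ≤ unitCost n d T ∧ n * d ≤ unitCost n d T ∧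
      d * (Nat.clog 2 d + 1) ≤ unitCost n d T ∧ n ≤ unitCost n d T ∧ d ≤ unitCost n d T := by
  have hn : 1 ≤ n := Nat.one_le_iff_ne_zero.mpr (NeZero.ne n)
  have hc : 1 ≤ Nat.clog 2 d + 1 := by omega
  have h1 : n * d * T ≤ unitCost n d T := Nat.le_mul_of_pos_right _ hc
  have h2 : n * d ≤ n * d * T := Nat.le_mul_of_pos_right _ hT
  have h3 : n ≤ n * d := Nat.le_mul_of_pos_right _ hd
  have h4 : d ≤ n * d := Nat.le_mul_of_pos_left _ hn
  have h5 : n * T ≤ n * d * T := Nat.mul_le_mul_right _ h3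
  have h6 : d * (Nat.clog 2 d + 1) ≤ unitCost n d T := by
    refine Nat.mul_le_mul_right _ ?_
    omega
  refine ⟨?_, ?_, ?_, ?_, h6, ?_, ?_⟩ <;> omega

theorem time_objProx_le [NeZero n] (hd : 1 ≤ d) {Th : ℕ} (hT : 1 ≤ Th) {R : List (RRSet n)}
    (hR : S.IsRR R) (x : Mix d) :
    (S.objProx h Th R x).time ≤ 6 * (unitCost n d Th + S.totalWidth R) := by
  have h1 := S.time_objHatT_le (fun v x => do tick Th; pure (h v x)) Th (fun _ _ => le_rfl) hR x
  change (S.objProx h Th R x).time ≤ _ at h1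
  have := le_unitCost (n := n) hd hT
  rw [Nat.mul_add, mul_one] at h1
  omega

/-- The extra iteration in the bound pays for the evaluation at the starting point and for the two
moments. -/
theorem time_proxGrad_le [NeZero n] (hd : 1 ≤ d) {Th : ℕ} (hT : 1 ≤ Th) {R : List (RRSet n)}
    (hR : S.IsRR R) :
    (S.proxGrad h h' Lh βh Th R).time ≤ (⌈3 * ((moment 1 R).val * n * βh +
      (moment 2 R).val * n * Lh ^ 2) * S.diam ^ 2 / (4 * S.ε)⌉₊ + 1) *
        (40 * (unitCost n d Th + S.totalWidth R)) := by
  set β := (moment 1 R).val * n * βh + (moment 2 R).val * n * Lh ^ 2 with hβdef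
  set step : ℕ → Mix d → Timed (Mix d) := fun _ x => do
      let v ← gradHatT h h' Th R x
      let z ← tabulate fun i => do tick 1; pure (x i + 1 / β * v i)
      S.proxT (1 / β * S.lam) (WithLp.toLp 2 z) with hstep
  set T := ⌈3 * β * S.diam ^ 2 / (4 * S.ε)⌉₊ with hTdef
  have e : (S.proxGrad h h' Lh βh Th R).time = (moment 1 R).time + ((moment 2 R).time + (1 +
    (S.bestIterate step (S.objProx h Th R) T).time)) := rfl
  have hu := le_unitCost (n := n) hd hT
  have h1 := S.time_bestIterate_le step (S.objProx h Th R) T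
    (19 * unitCost n d Th + 3 * S.totalWidth R) (6 * (unitCost n d Th + S.totalWidth R))
    (fun t x => by
      have h2 := time_gradHatT_le h h' Th hR x
      have h3 := S.time_proxT_le (1 / β * S.lam) (WithLp.toLp 2
        (fun i => x i + 1 / β * (gradHatT h h' Th R x).val i)) hd
      have e : (step t x).time = (gradHatT h h' Th R x).time + ((∑ _ : Fin d, (1 + 0 + 1)) +
        (S.proxT (1 / β * S.lam) (WithLp.toLp 2
        (fun i => x i + 1 / β * (gradHatT h h' Th R x).val i))).time) := rfl
      simp only [Finset.sum_const, Finset.card_univ, Fintype.card_fin, smul_eq_mul] at e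
      have e2 : d * (2 * n + 2) = 2 * (n * d) + 2 * d := by ring
      have e3 : 8 * d * (Nat.clog 2 d + 1) = 8 * (d * (Nat.clog 2 d + 1)) := by ring
      rw [e2, Nat.mul_add, mul_one] at h2
      rw [e3] at h3
      omega)
    (fun x => time_objProx_le hd hT hR x)
  have h2 := time_moment_le 1 hR
  have h3 := time_moment_le 2 hR
  have h4 : T * (19 * unitCost n d Th + 3 * S.totalWidth R +
      6 * (unitCost n d Th + S.totalWidth R) + 2) ≤ T * (40 * (unitCost n d Th + S.totalWidth R)) :=
    Nat.mul_le_mul_left _ (by omega)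
  rw [e, Nat.add_mul]
  omega

end prox

end Setting

/-! ### Independent strategy activation and the concave upper bound -/

/-- What is assumed of the functions `q` under independent strategy activation. -/
structure ActivationConcave (q q' : Fin n → Fin d → ℝ → ℝ) (L : ℝ) : Prop where
  mem : ∀ v j, ∀ t ∈ Set.Ici (0 : ℝ), q v j t ∈ Set.Icc (0 : ℝ) 1
  mono : ∀ v j, MonotoneOn (q v j) (Set.Ici 0)
  concave : ∀ v j, ConcaveOn ℝ (Set.Ici 0) (q v j)
  lip : ∀ v j, ∀ t ∈ Set.Ici (0 : ℝ), ∀ u ∈ Set.Ici (0 : ℝ), |q v j t - q v j u| ≤ L * |t - u|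
  deriv : ∀ v j, ∀ t ∈ Set.Ici (0 : ℝ), HasDerivWithinAt (q v j) (q' v j t) (Set.Ici 0) t

namespace ActivationConcave

variable {q q' : Fin n → Fin d → ℝ → ℝ} {L : ℝ}

theorem deriv_mem (hq : ActivationConcave q q' L) (v : Fin n) (j : Fin d) {t : ℝ} (ht : 0 ≤ t) :
    q' v j t ∈ Set.Icc 0 L := by
  have hmap : Set.MapsTo (fun s : ℝ => t + s) (Set.Icc 0 1) (Set.Ici 0) :=
    fun s hs => add_nonneg ht hs.1
  have h1 : HasDerivWithinAt (fun s : ℝ => q v j (t + s)) (q' v j t) (Set.Icc 0 1) 0 := by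
    have h2 : HasDerivWithinAt (fun s : ℝ => t + s) 1 (Set.Icc 0 1) 0 :=
      (hasDerivWithinAt_id 0 _).const_add t
    have h3 : HasDerivWithinAt (q v j) (q' v j t) (Set.Ici 0) (t + 0) := by
      rw [add_zero]
      exact hq.deriv v j t ht
    simpa [Function.comp_def] using
      HasDerivWithinAt.scomp (g₁ := q v j) (h := fun s : ℝ => t + s) (0 : ℝ) h3 h2 hmap
  refine ⟨nonneg_of_monotoneOn_Icc h1 fun s hs u hu hsu =>
    hq.mono v j (hmap hs) (hmap hu) (by linarith), ?_⟩
  have h2 := nonneg_of_monotoneOn_Icc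
    (((hasDerivWithinAt_id (0 : ℝ) (Set.Icc (0 : ℝ) 1)).const_mul L).sub h1) ?_
  · linarith
  · intro s hs u hu hsu
    have h3 := hq.lip v j _ (hmap hu) _ (hmap hs)
    simp only [add_sub_add_left_eq_sub] at h3
    rw [abs_of_nonneg (sub_nonneg.mpr hsu)] at h3
    have h4 := (abs_le.mp h3).2
    simp only [Pi.sub_apply, id]
    linarith

theorem le_tangent (hq : ActivationConcave q q' L) (v : Fin n) (j : Fin d) {t u : ℝ} (ht : 0 ≤ t)
    (hu : 0 ≤ u) : q v j u ≤ q v j t + q' v j t * (u - t) := by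
  rcases lt_trichotomy t u with h | rfl | h
  · have := (hq.concave v j).slope_le_of_hasDerivWithinAt ht hu h (hq.deriv v j t ht)
    rw [slope_def_field, div_le_iff₀ (sub_pos.mpr h)] at this
    linarith
  · simp
  · have := (hq.concave v j).le_slope_of_hasDerivWithinAt hu ht h (hq.deriv v j t ht)
    rw [slope_def_field, le_div_iff₀ (sub_pos.mpr h)] at this
    linarith

theorem independentActivation_mem (hq : ActivationConcave q q' L) (v : Fin n) {x : Mix d}
    (hx : x ∈ orthant d) : independentActivation q v x ∈ Set.Icc (0 : ℝ) 1 := by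
  have h := fun j => hq.mem v j (x j) (hx j)
  have h1 : 0 ≤ ∏ j, (1 - q v j (x j)) := Finset.prod_nonneg fun j _ => sub_nonneg.mpr (h j).2
  have h2 : ∏ j, (1 - q v j (x j)) ≤ 1 :=
    Finset.prod_le_one (fun j _ => sub_nonneg.mpr (h j).2) fun j _ => by linarith [(h j).1]
  unfold independentActivation
  constructor <;> linarith

end ActivationConcave

/-- The sum of the values `q_{v,j}(x_j)` over `j`. -/
def activationSum (q : Fin n → Fin d → ℝ → ℝ) (x : Mix d) (v : Fin n) : ℝ := ∑ j, q v j (x j)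

namespace Setting

variable {S : Setting n d} {q q' : Fin n → Fin d → ℝ → ℝ} {L : ℝ}

/-- On [0, 1] the concave function 1 − e^{−b} lies above its chord; beyond 1 it only increases. -/
theorem one_sub_exp_ge (b : ℝ) (hb : 0 ≤ b) :
    (1 - 1 / Real.exp 1) * min 1 b ≤ 1 - Real.exp (-b) := by
  have e : 1 / Real.exp 1 = Real.exp (-1) := by rw [Real.exp_neg, one_div]
  rw [e]
  rcases le_total 1 b with h | h
  · rw [min_eq_left h]
    have := Real.exp_le_exp.mpr (neg_le_neg h)
    linarith
  · rw [min_eq_right h]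
    have := convexOn_exp.2 (Set.mem_univ (0 : ℝ)) (Set.mem_univ (-1 : ℝ)) (sub_nonneg.mpr h) hb
      (by ring)
    simp at this
    linarith

/-- A union bound for independent events of probabilities f i. -/
theorem one_sub_prod_le_sum {ι : Type*} (s : Finset ι) (f : ι → ℝ)
    (hf : ∀ i ∈ s, f i ∈ Set.Icc (0 : ℝ) 1) : 1 - ∏ i ∈ s, (1 - f i) ≤ ∑ i ∈ s, f i := by
  classical
  induction s using Finset.induction_on with
  | empty => simp
  | insert i s hi ih =>
    have h1 := ih fun j hj => hf j (Finset.mem_insert_of_mem hj)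
    have h2 := hf i (Finset.mem_insert_self i s)
    have h3 : ∏ j ∈ s, (1 - f j) ≤ 1 := Finset.prod_le_one
      (fun j hj => sub_nonneg.mpr (hf j (Finset.mem_insert_of_mem hj)).2)
      fun j hj => by linarith [(hf j (Finset.mem_insert_of_mem hj)).1]
    rw [Finset.prod_insert hi, Finset.sum_insert hi]
    nlinarith [h2.1]

/-- The hitting probability is estimated by the truncated sum up to a factor `1 - 1/e`. -/
theorem hit_bounds (hq : ActivationConcave q q' L) {x : Mix d} (hx : x ∈ orthant d)
    (r : RRSet n) :
    hit (fun v => independentActivation q v x) r ≤ min 1 (r.map (activationSum q x)).sum ∧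
      (1 - 1 / Real.exp 1) * min 1 (r.map (activationSum q x)).sum ≤
        hit (fun v => independentActivation q v x) r := by
  have hmem := fun v => hq.independentActivation_mem v hx
  have hqm := fun v j => hq.mem v j (x j) (hx j)
  have hQ : ∀ v, 0 ≤ activationSum q x v := fun v => Finset.sum_nonneg fun j _ => (hqm v j).1
  constructor
  · refine le_min (hit_mem _ r hmem).2 ?_
    induction r with
    | nil => simp [hit]
    | cons v r ih =>
      have h1 : independentActivation q v x ≤ activationSum q x v :=
        one_sub_prod_le_sum _ _ fun j _ => hqm v j
      have h2 := hit_mem _ r hmem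
      have h3 := hmem v
      rw [hit_cons, List.map_cons, List.sum_cons]
      nlinarith [h2.1, h3.1, mul_nonneg h2.1 h3.1]
  · refine (one_sub_exp_ge _ (List.sum_nonneg (by simpa using fun v _ => hQ v))).trans ?_
    refine sub_le_sub_left ?_ 1
    induction r with
    | nil => simp
    | cons v r ih =>
      -- By 1 − t ≤ e^{−t}, the probability of missing the set is at most the exponential of minus
      -- the untruncated sum.
      have h1 : 1 - independentActivation q v x ≤ Real.exp (-activationSum q x v) := by
        rw [independentActivation, sub_sub_cancel, activationSum, ← Finset.sum_neg_distrib,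
          Real.exp_sum]
        exact Finset.prod_le_prod (fun j _ => sub_nonneg.mpr (hqm v j).2)
          fun j _ => Real.one_sub_le_exp_neg _
      rw [List.map_cons, List.prod_cons, List.map_cons, List.sum_cons, neg_add, Real.exp_add]
      refine mul_le_mul h1 ih (List.prod_nonneg ?_) (Real.exp_pos _).le
      simpa using fun v _ => (hmem v).2

/-- The upper bound `ḡ_R`. -/
def barG (q : Fin n → Fin d → ℝ → ℝ) (R : List (RRSet n)) (x : Mix d) : ℝ :=
  (n : ℝ) / R.length * (R.map fun r => min 1 (r.map (activationSum q x)).sum).sum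

theorem hatG_bounds (hq : ActivationConcave q q' L) {x : Mix d} (hx : x ∈ orthant d)
    (R : List (RRSet n)) :
    hatG (fun v => independentActivation q v x) R ≤ barG q R x ∧
      (1 - 1 / Real.exp 1) * barG q R x ≤ hatG (fun v => independentActivation q v x) R := by
  have hc : 0 ≤ (n : ℝ) / R.length := by positivity
  constructor
  · exact mul_le_mul_of_nonneg_left (List.sum_le_sum fun r _ => (hit_bounds hq hx r).1) hc
  · rw [barG, mul_left_comm, ← List.sum_map_mul_left]
    exact mul_le_mul_of_nonneg_left (List.sum_le_sum fun r _ => (hit_bounds hq hx r).2) hc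

theorem val_objBarT (S : Setting n d) (q : Fin n → Fin d → ℝ → ℝ) (Tq : ℕ) (R : List (RRSet n))
    (x : Mix d) : (S.objBarT q Tq R x).val = barG q R x + S.slack x := by
  have e : (S.objBarT q Tq R x).val = (n : ℝ) / R.length *
      (R.map fun r => min 1 (r.map fun v => ((List.finRange d).map fun j => q v j (x j)).sum).sum).sum
      + S.lam * (S.k - (S.costT x).val) := rfl
  rw [e, val_costT]
  simp only [sum_finRange]
  rfl

theorem val_objUpper (S : Setting n d) (q : Fin n → Fin d → ℝ → ℝ) (Tq : ℕ) (R : List (RRSet n))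
    (x : Mix d) : (S.objUpper q Tq R x).val =
      hatG (fun v => independentActivation q v x) R + S.slack x := by
  rw [objUpper, val_objHatT]
  congr 2

/-! ## Subgradients -/

/-- The contribution of an RR set to the subgradient. -/
def hitSub (q q' : Fin n → Fin d → ℝ → ℝ) (x : Mix d) (r : RRSet n) : Mix d :=
  WithLp.toLp 2 fun i =>
    if (r.map (activationSum q x)).sum < 1 then (r.map fun v => q' v i (x i)).sum else 0

/-- A subgradient of the cost. -/
def costSub (c : CostNorm) (x : Mix d) : Mix d :=
  WithLp.toLp 2 fun i =>
    match c with
    | .one => 1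
    | .two => x i / ‖x‖

/-- Counting the nodes of an RR set in an array. -/
def countStep (a : Fin n → ℝ) (v : Fin n) : Timed (Fin n → ℝ) :=
  pure (Function.update a v (a v + 1))

/-- Counting the nodes of an RR set unless its truncated sum is saturated. -/
def countRR (Qs : Fin n → ℝ) (a : Fin n → ℝ) (r : RRSet n) : Timed (Fin n → ℝ) := do
  let b ← sumList (fun v => do tick 1; pure (Qs v)) r
  tick 1
  if b < 1 then loop countStep a r else pure a

theorem countStep_loop (c : Fin n → ℝ) (r : RRSet n) (a : Fin n → ℝ) :
    ∑ u, (loop countStep a r).val u * c u = ∑ u, a u * c u + (r.map c).sum := by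
  induction r generalizing a with
  | nil => simp
  | cons v r ih =>
    rw [val_loop_cons, ih]
    simp only [countStep, val_pure, sum_update_mul, List.map_cons, List.sum_cons]
    ring

theorem val_countRR (Qs a : Fin n → ℝ) (r : RRSet n) :
    (countRR Qs a r).val = if (r.map Qs).sum < 1 then (loop countStep a r).val else a := by
  change (if (r.map Qs).sum < 1 then loop countStep a r else pure a).val = _
  split_ifs <;> rfl

theorem time_countRR_le (Qs a : Fin n → ℝ) (r : RRSet n) :
    (countRR Qs a r).time ≤ 3 * r.length + 1 := by
  have h1 := time_loop_le countStep (fun _ => 0) r a fun _ _ _ => le_rfl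
  have e : (countRR Qs a r).time = (r.map fun _ => 1 + 0 + 1).sum +
    (1 + (if (r.map Qs).sum < 1 then loop countStep a r else pure a).time) := rfl
  rw [e]
  simp only [List.map_const', List.sum_replicate, smul_eq_mul] at *
  split_ifs
  · omega
  · simp only [time_pure]
    omega

theorem countRR_loop (Qs c : Fin n → ℝ) (R : List (RRSet n)) (a : Fin n → ℝ) :
    ∑ u, (loop (countRR Qs) a R).val u * c u = ∑ u, a u * c u +
      (R.map fun r => if (r.map Qs).sum < 1 then (r.map c).sum else 0).sum := by
  induction R generalizing a with
  | nil => simp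
  | cons r R ih =>
    rw [val_loop_cons, ih, List.map_cons, List.sum_cons, val_countRR]
    split_ifs
    · rw [countStep_loop]
      ring
    · ring

theorem val_subgradT (S : Setting n d) (q q' : Fin n → Fin d → ℝ → ℝ) (Tq : ℕ)
    (R : List (RRSet n)) (x : Mix d) :
    (S.subgradT q q' Tq R x).val = ((n : ℝ) / R.length) • (R.map (hitSub q q' x)).sum -
      S.lam • costSub S.costNorm x := by
  ext i
  have e : (S.subgradT q q' Tq R x).val i = (n : ℝ) / R.length *
      ((List.finRange n).map fun v => (loop (countRR fun v =>
        ((List.finRange d).map fun j => q v j (x j)).sum) (fun _ => 0) R).val v * q' v i (x i)).sum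
      - S.lam * (match S.costNorm with
        | .one => 1
        | .two => x i / (normT x).val) := rfl
  simp only [sum_finRange] at e
  rw [e, countRR_loop, val_normT, PiLp.sub_apply, PiLp.smul_apply, PiLp.smul_apply, list_sum_apply,
    List.map_map]
  simp only [zero_mul, Finset.sum_const_zero, zero_add, smul_eq_mul]
  rfl

theorem time_subgradT_le (S : Setting n d) (q q' : Fin n → Fin d → ℝ → ℝ) (Tq : ℕ)
    {R : List (RRSet n)} (hR : S.IsRR R) (x : Mix d) :
    (S.subgradT q q' Tq R x).time ≤ n * (d * (Tq + 1) + 1) + n * (2 * d + 1) + n +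
      5 * S.totalWidth R + (2 * d + 1) + d * (2 * n + 2) := by
  have e : (S.subgradT q q' Tq R x).time =
      (∑ _ : Fin n, ((∑ _ : Fin d, (Tq + 0 + 1)) + 1)) +
      ((∑ _ : Fin n, (((List.finRange d).map fun _ => 1 + 0 + 1).sum + 1)) +
      ((∑ _ : Fin n, (0 + 1)) +
      ((loop (countRR fun v => ((List.finRange d).map fun j => q v j (x j)).sum)
        (fun _ => 0) R).time +
      ((normT x).time +
      ((∑ _ : Fin d, (((List.finRange n).map fun _ => 1 + 0 + 1).sum + (1 + 0) + 1)) + 0))))) := rfl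
  have h1 := time_loop_le (countRR fun v => ((List.finRange d).map fun j => q v j (x j)).sum)
    (fun r => 3 * r.length + 1) R (fun _ => 0) fun a r _ => time_countRR_le _ a r
  have h2 := sum_le_totalWidth hR 3 2
  rw [e, time_normT]
  simp only [Finset.sum_const, Finset.card_univ, Fintype.card_fin, smul_eq_mul, List.map_const',
    List.sum_replicate, List.length_finRange, add_assoc, add_zero, mul_one, Nat.reduceAdd] at *
  rw [mul_comm 2 d, mul_comm 2 n]
  omega

theorem norm_le_of_abs_le (x : Mix d) {c : ℝ} (hc : 0 ≤ c) (h : ∀ i, |x i| ≤ c) :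
    ‖x‖ ≤ √(d : ℝ) * c := by
  refine abs_le_of_sq_le_sq' ?_ (by positivity) |>.2
  rw [norm_sq_eq_sum, mul_pow, Real.sq_sqrt (Nat.cast_nonneg _)]
  have : ∑ i, x i ^ 2 ≤ ∑ _ : Fin d, c ^ 2 :=
    Finset.sum_le_sum fun i _ => by rw [← sq_abs]; exact pow_le_pow_left₀ (abs_nonneg _) (h i) 2
  simpa using this

theorem norm_hitSub_le (hq : ActivationConcave q q' L) (hL : 0 ≤ L) {x : Mix d}
    (hx : x ∈ orthant d) (r : RRSet n) : ‖hitSub q q' x r‖ ≤ √(d : ℝ) * (r.length * L) := by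
  refine norm_le_of_abs_le _ (by positivity) fun i => ?_
  change |if (r.map (activationSum q x)).sum < 1 then (r.map fun v => q' v i (x i)).sum else 0| ≤ _
  split_ifs
  · have h1 : 0 ≤ (r.map fun v => q' v i (x i)).sum :=
      List.sum_nonneg (by simpa using fun v _ => (hq.deriv_mem v i (hx i)).1)
    have h2 : (r.map fun v => q' v i (x i)).sum ≤ (r.map fun _ => L).sum :=
      List.sum_le_sum fun v _ => (hq.deriv_mem v i (hx i)).2
    rw [abs_of_nonneg h1]
    simpa using h2
  · rw [abs_zero]
    positivity

theorem norm_costSub_le (c : CostNorm) (x : Mix d) : ‖costSub c x‖ ≤ costLip c d := by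
  cases c
  · simpa [costLip] using
      norm_le_of_abs_le (costSub .one x) zero_le_one fun i => by simp [costSub]
  · have : costSub .two x = (1 / ‖x‖) • x := by
      ext i
      simp [costSub, div_eq_inv_mul]
    rw [this, norm_smul, norm_div, norm_norm, norm_one, one_div]
    exact inv_mul_le_one

theorem norm_list_sum_le {ι : Type*} (l : List ι) (f : ι → Mix d) (B : ι → ℝ)
    (h : ∀ i ∈ l, ‖f i‖ ≤ B i) : ‖(l.map f).sum‖ ≤ (l.map B).sum := by
  induction l with
  | nil => simp
  | cons i l ih =>
    rw [List.map_cons, List.sum_cons, List.map_cons, List.sum_cons]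
    exact (norm_add_le _ _).trans (add_le_add (h i (by simp)) (ih fun j hj => h j (by simp [hj])))

theorem norm_subgradT_le (S : Setting n d) (hq : ActivationConcave q q' L) (hL : 0 ≤ L)
    (hlam : 0 ≤ S.lam) (Tq : ℕ) (R : List (RRSet n)) {x : Mix d} (hx : x ∈ orthant d) :
    ‖(S.subgradT q q' Tq R x).val‖ ≤
      (moment 1 R).val * n * √(d : ℝ) * L + S.lam * costLip S.costNorm d := by
  rw [val_subgradT, val_moment]
  refine (norm_sub_le _ _).trans (add_le_add ?_ ?_)
  · have h1 := norm_list_sum_le R (hitSub q q' x) _ fun r _ => norm_hitSub_le hq hL hx r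
    rw [norm_smul, Real.norm_of_nonneg (by positivity)]
    refine (mul_le_mul_of_nonneg_left h1 (by positivity)).trans (le_of_eq ?_)
    rw [List.sum_map_mul_left, List.sum_map_mul_right]
    simp only [pow_one]
    ring
  · rw [norm_smul, Real.norm_of_nonneg hlam]
    exact mul_le_mul_of_nonneg_left (norm_costSub_le _ _) hlam

theorem inner_list_sum {ι : Type*} (l : List ι) (f : ι → Mix d) (y : Mix d) :
    inner ℝ (l.map f).sum y = (l.map fun i => inner ℝ (f i) y).sum := by
  induction l with
  | nil => simp
  | cons i l ih => simp [inner_add_left, ih]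

/-- The truncated sum is the minimum of a constant and a concave function. Where the constant is
active, 0 is a supergradient; otherwise the derivative of the sum is one. -/
theorem hit_le_tangent (hq : ActivationConcave q q' L) {x u : Mix d} (hx : x ∈ orthant d)
    (hu : u ∈ orthant d) (r : RRSet n) :
    min 1 (r.map (activationSum q u)).sum ≤
      min 1 (r.map (activationSum q x)).sum + inner ℝ (hitSub q q' x r) (u - x) := by
  by_cases hr : (r.map (activationSum q x)).sum < 1
  · rw [min_eq_right hr.le]
    refine (min_le_right _ _).trans ?_
    have e : inner ℝ (hitSub q q' x r) (u - x) =
        (r.map fun v => ∑ i, q' v i (x i) * (u i - x i)).sum := by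
      rw [inner_eq_sum]
      simp only [hitSub, if_pos hr, PiLp.sub_apply]
      clear hr
      induction r with
      | nil => simp
      | cons v r ih => simp only [List.map_cons, List.sum_cons, add_mul, Finset.sum_add_distrib, ih]
    rw [e, ← List.sum_map_add]
    refine List.sum_le_sum fun v _ => ?_
    rw [activationSum, activationSum, ← Finset.sum_add_distrib]
    exact Finset.sum_le_sum fun i _ => hq.le_tangent v i (hx i) (hu i)
  · have e : hitSub q q' x r = 0 := by
      ext i
      simp [hitSub, if_neg hr]
    rw [e, inner_zero_left, add_zero, min_eq_left (not_lt.mp hr)]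
    exact min_le_left _ _

theorem cost_ge_tangent (c : CostNorm) {x u : Mix d} (hx : x ∈ orthant d) (hu : u ∈ orthant d) :
    cost c x + inner ℝ (costSub c x) (u - x) ≤ cost c u := by
  cases c
  · rw [inner_eq_sum]
    simp only [cost, costSub, abs_of_nonneg (hx _), abs_of_nonneg (hu _), PiLp.sub_apply, one_mul,
      Finset.sum_sub_distrib]
    linarith
  · have e : costSub .two x = (1 / ‖x‖) • x := by
      ext i
      simp [costSub, div_eq_inv_mul]
    rw [e, real_inner_smul_left, inner_sub_right, real_inner_self_eq_norm_sq]
    simp only [cost]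
    by_cases h : ‖x‖ = 0
    -- At x = 0 the convention x / 0 = 0 selects the subgradient 0.
    · simp [h]
    · have h1 := real_inner_le_norm x u
      have hpos : 0 < ‖x‖ := lt_of_le_of_ne (norm_nonneg _) (Ne.symm h)
      have h2 : 1 / ‖x‖ * (inner ℝ x u - ‖x‖ ^ 2) ≤ 1 / ‖x‖ * (‖x‖ * ‖u‖ - ‖x‖ ^ 2) :=
        mul_le_mul_of_nonneg_left (by linarith) (by positivity)
      have h3 : 1 / ‖x‖ * (‖x‖ * ‖u‖ - ‖x‖ ^ 2) = ‖u‖ - ‖x‖ := by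
        field_simp
      linarith

/-- `subgradT` computes a supergradient of the concave function `ḡ_R + s`. -/
theorem obj_le_tangent (S : Setting n d) (hq : ActivationConcave q q' L) (hlam : 0 ≤ S.lam)
    (Tq : ℕ) (R : List (RRSet n)) {x u : Mix d} (hx : x ∈ orthant d) (hu : u ∈ orthant d) :
    barG q R u + S.slack u ≤
      barG q R x + S.slack x + inner ℝ (S.subgradT q q' Tq R x).val (u - x) := by
  have h1 : barG q R u ≤ barG q R x +
      (n : ℝ) / R.length * (R.map fun r => inner ℝ (hitSub q q' x r) (u - x)).sum := by
    rw [barG, barG, ← mul_add, ← List.sum_map_add]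
    exact mul_le_mul_of_nonneg_left (List.sum_le_sum fun r _ => hit_le_tangent hq hx hu r)
      (by positivity)
  have h2 := mul_le_mul_of_nonneg_left (cost_ge_tangent S.costNorm hx hu) hlam
  rw [val_subgradT, inner_sub_left, real_inner_smul_left, real_inner_smul_left, inner_list_sum]
  simp only [slack]
  linarith

/-- Progress made by one projected subgradient step of size `η`. -/
theorem subgrad_progress (S : Setting n d) (hk : 0 ≤ S.k) {x u g z : Mix d} {η : ℝ}
    (hu : u ∈ S.P) (hz : z = x + η • g) :
    let y := (S.proxT 0 z).val
    y ∈ S.P ∧ 2 * η * inner ℝ g (u - x) ≤ ‖u - x‖ ^ 2 - ‖u - y‖ ^ 2 + η ^ 2 * ‖g‖ ^ 2 := by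
  intro y
  obtain ⟨hy, hvi⟩ := S.proxT_spec 0 z le_rfl hk
  refine ⟨hy, ?_⟩
  have h1 := hvi u hu
  rw [zero_mul] at h1
  change inner ℝ (z - y) (u - y) ≤ 0 at h1
  -- The variational inequality gives ‖u − y‖² ≤ ‖u − z‖², that is, projecting brings z no farther
  -- from u; then ‖u − z‖² is expanded around x.
  have h2 := norm_sub_sq_real (u - y) (z - y)
  have h3 := norm_sub_sq_real (u - x) (η • g)
  have e1 : u - y - (z - y) = u - z := by abel
  have e2 : u - x - η • g = u - z := by rw [hz]; abel
  rw [e1, real_inner_comm] at h2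
  rw [e2, real_inner_smul_right, real_inner_comm, norm_smul, mul_pow, Real.norm_eq_abs, sq_abs] at h3
  have := sq_nonneg ‖z - y‖
  linarith

/-! ### Convergence and cost of the projected subgradient method -/

section upper

variable {a : ℕ}

/-- The approximation guarantee of the projected subgradient method. -/
theorem upperGrad_spec [NeZero n] (hA : S.Admissible a (independentActivation q))
    (hq : ActivationConcave q q' L) (hL : 0 < L) (hd : 1 ≤ d) (Tq : ℕ) {R : List (RRSet n)}
    (hR : S.IsRR R) (h0 : R ≠ []) {u : Mix d} (hu : u ∈ S.P) :
    1 / 2 * hatG (fun v => independentActivation q v u) R - 1 / 3 ≤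
      (S.objUpper q Tq R (S.upperGrad q q' L Tq R).val).val := by
  have hn : (0 : ℝ) < n := by exact_mod_cast Nat.pos_of_ne_zero (NeZero.ne n)
  have hdR : (0 : ℝ) < d := by exact_mod_cast hd
  have hc : 0 ≤ costLip S.costNorm d := by
    cases S.costNorm
    · exact Real.sqrt_nonneg _
    · exact zero_le_one
  have hlam := hA.lam_nonneg
  set Λ := (moment 1 R).val * n * √(d : ℝ) * L + S.lam * costLip S.costNorm d with hΛdef
  have hΛ : 0 < Λ := by
    have m1 := one_le_moment 1 hR h0
    positivity
  set step : ℕ → Mix d → Timed (Mix d) := fun t x => do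
      let v ← S.subgradT q q' Tq R x
      let z ← tabulate fun i => do
        tick 1
        pure (x i + S.diam / (Λ * √((t : ℝ) + 1)) * v i)
      S.proxT 0 (WithLp.toLp 2 z) with hstep
  set T := ⌈9 * (S.diam * Λ) ^ 2 / S.ε ^ 2⌉₊ with hT
  have hval : (S.upperGrad q q' L Tq R).val = (S.bestIterate step (S.objBarT q Tq R) T).val := rfl
  obtain ⟨⟨t₀, -, ht₀⟩, hbest⟩ := S.bestIterate_spec step (S.objBarT q Tq R) T
  rw [← hval] at hbest ht₀
  simp only [val_objBarT] at hbest
  set y := (S.upperGrad q q' L Tq R).val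
  set φ := fun x => barG q R x + S.slack x
  have hprog := fun (t : ℕ) (x : Mix d) => S.subgrad_progress (x := x)
    (g := (S.subgradT q q' Tq R x).val) (η := S.diam / (Λ * √((t : ℝ) + 1)))
    (z := WithLp.toLp 2 fun i =>
      x i + S.diam / (Λ * √((t : ℝ) + 1)) * (S.subgradT q q' Tq R x).val i) hA.k_nonneg hu rfl
  have hmem : ∀ t, S.iterates step t ∈ S.P :=
    iterates_mem step hA.start_mem fun t x _ => (hprog t x).1
  have hε := hA.ε_pos
  have hε1 := hA.ε_lt_one
  have hTle : 9 * (S.diam * Λ) ^ 2 / S.ε ^ 2 ≤ T := Nat.le_ceil _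
  set X := S.iterates step
  have hdist : ∀ t, ‖u - X t‖ ≤ S.diam := fun t => hA.le_diam _ hu _ (hmem t)
  have hD : 0 ≤ S.diam := (norm_nonneg _).trans (hdist 0)
  have hgap : φ u - S.ε / 2 ≤ φ y := by
    -- If Δ = 0, the step sizes vanish and T = 0, but then u is the starting point.
    rcases hD.eq_or_lt with hD | hD
    · have h1 := hdist 0
      rw [← hD] at h1
      have h2 : u = X 0 := by
        rw [← sub_eq_zero, ← norm_eq_zero]
        exact le_antisymm h1 (norm_nonneg _)
      have h3 : φ (X 0) ≤ φ y := hbest 0 (Nat.zero_le _)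
      rw [← h2] at h3
      linarith
    -- Summation by parts for the step sizes Δ / (Λ√t) is built into this invariant. The weight Λ√s
    -- / (2Δ) may grow with s since its factor Δ² − ‖u − X s‖² is nonnegative.
    · have hsum : ∀ s ≤ T, s * (φ u - φ y) ≤
          Λ * √(s : ℝ) / (2 * S.diam) * (S.diam ^ 2 - ‖u - X s‖ ^ 2) + S.diam * Λ * √(s : ℝ) := by
        intro s
        induction s with
        | zero => intro _; simp
        | succ s ih =>
          intro hs
          have h1 := ih (by omega)
          have h2 : φ (X s) ≤ φ y := hbest s (by omega)
          have h3 := S.obj_le_tangent hq hlam Tq R (hmem s).1 hu.1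
          change φ u ≤ φ (X s) + inner ℝ (S.subgradT q q' Tq R (X s)).val (u - X s) at h3
          set w : ℝ := √((s : ℝ) + 1) with hw
          have hw0 : 0 < w := Real.sqrt_pos.mpr (by positivity)
          have h4 : 2 * (S.diam / (Λ * w)) * inner ℝ (S.subgradT q q' Tq R (X s)).val (u - X s) ≤
            ‖u - X s‖ ^ 2 - ‖u - X (s + 1)‖ ^ 2 +
              (S.diam / (Λ * w)) ^ 2 * ‖(S.subgradT q q' Tq R (X s)).val‖ ^ 2 := (hprog s (X s)).2
          have h5 : ‖(S.subgradT q q' Tq R (X s)).val‖ ^ 2 ≤ Λ ^ 2 :=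
            pow_le_pow_left₀ (norm_nonneg _) (S.norm_subgradT_le hq hL.le hlam Tq R (hmem s).1) 2
          have h6 : inner ℝ (S.subgradT q q' Tq R (X s)).val (u - X s) ≤
              Λ * w / (2 * S.diam) * (‖u - X s‖ ^ 2 - ‖u - X (s + 1)‖ ^ 2) +
                S.diam * Λ / (2 * w) := by
            have h7 := h4.trans (add_le_add_right
              (mul_le_mul_of_nonneg_left h5 (sq_nonneg (S.diam / (Λ * w)))) _)
            have h8 := mul_le_mul_of_nonneg_left h7
              (show 0 ≤ Λ * w / (2 * S.diam) by positivity)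
            have e1 : Λ * w / (2 * S.diam) * (2 * (S.diam / (Λ * w)) *
                inner ℝ (S.subgradT q q' Tq R (X s)).val (u - X s)) =
                inner ℝ (S.subgradT q q' Tq R (X s)).val (u - X s) := by field_simp
            have e2 : Λ * w / (2 * S.diam) * (‖u - X s‖ ^ 2 - ‖u - X (s + 1)‖ ^ 2 +
                (S.diam / (Λ * w)) ^ 2 * Λ ^ 2) =
                Λ * w / (2 * S.diam) * (‖u - X s‖ ^ 2 - ‖u - X (s + 1)‖ ^ 2) +
                S.diam * Λ / (2 * w) := by field_simp
            rwa [e1, e2] at h8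
          have h9 : √(s : ℝ) ≤ w := Real.sqrt_le_sqrt (by linarith)
          -- Here w − √s = 1 / (w + √s), so the error terms 1 / (2√t) sum to at most √s.
          have h10 : 1 / (2 * w) ≤ w - √(s : ℝ) := by
            rw [div_le_iff₀ (by positivity)]
            have i1 : w ^ 2 = s + 1 := Real.sq_sqrt (by positivity)
            have i2 : √(s : ℝ) ^ 2 = s := Real.sq_sqrt (Nat.cast_nonneg _)
            nlinarith [sq_nonneg (w - √(s : ℝ))]
          have h11 : 0 ≤ S.diam ^ 2 - ‖u - X s‖ ^ 2 :=
            sub_nonneg.mpr (pow_le_pow_left₀ (norm_nonneg _) (hdist s) 2)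
          have h12 : Λ * √(s : ℝ) / (2 * S.diam) * (S.diam ^ 2 - ‖u - X s‖ ^ 2) ≤
              Λ * w / (2 * S.diam) * (S.diam ^ 2 - ‖u - X s‖ ^ 2) := by
            gcongr
          have h13 : S.diam * Λ / (2 * w) ≤ S.diam * Λ * (w - √(s : ℝ)) := by
            have := mul_le_mul_of_nonneg_left h10 (mul_pos hD hΛ).le
            rwa [mul_one_div] at this
          push_cast
          linarith
      have h1 := hsum T le_rfl
      have hTpos : 0 < T := Nat.ceil_pos.mpr (by positivity)
      have hTR : (0 : ℝ) < T := by exact_mod_cast hTpos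
      set w : ℝ := √(T : ℝ) with hw
      have hw0 : 0 < w := Real.sqrt_pos.mpr hTR
      have hww : w * w = T := Real.mul_self_sqrt hTR.le
      -- The invariant at T gives T(φ u − φ y) ≤ (3/2) ΔΛ√T, and this inequality turns the right
      -- side into Tε/2.
      have h2 : 3 * (S.diam * Λ) ≤ S.ε * w := by
        rw [div_le_iff₀ (by positivity)] at hTle
        refine abs_le_of_sq_le_sq' ?_ (by positivity) |>.2
        nlinarith
      have h3 : Λ * w / (2 * S.diam) * (S.diam ^ 2 - ‖u - X T‖ ^ 2) ≤
          Λ * w / (2 * S.diam) * S.diam ^ 2 :=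
        mul_le_mul_of_nonneg_left (by linarith [sq_nonneg ‖u - X T‖]) (by positivity)
      have h4 : Λ * w / (2 * S.diam) * S.diam ^ 2 = S.diam * Λ * w / 2 := by
        field_simp
      have h5 : (T : ℝ) * (φ u - φ y) ≤ T * (S.ε / 2) := by
        have : 3 * (S.diam * Λ) * w ≤ S.ε * w * w := mul_le_mul_of_nonneg_right h2 hw0.le
        rw [mul_assoc S.ε, hww] at this
        linarith
      have := le_of_mul_le_mul_left h5 hTR
      linarith
  have hyP : y ∈ S.P := by rw [ht₀]; exact hmem t₀
  have hbu := (hatG_bounds hq hu.1 R).1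
  have hby := (hatG_bounds hq hyP.1 R).2
  have hsu := S.slack_nonneg hlam hu
  have hsy := S.slack_nonneg hlam hyP
  have hu0 : 0 ≤ hatG (fun v => independentActivation q v u) R :=
    mul_nonneg (by positivity) (List.sum_nonneg (by
      simpa using fun r _ => (hit_mem _ r fun v => hq.independentActivation_mem v hu.1).1))
  rw [val_objUpper]
  change barG q R u + S.slack u - S.ε / 2 ≤ barG q R y + S.slack y at hgap
  have he1 : 1 / Real.exp 1 ≤ 1 / 2 :=
    one_div_le_one_div_of_le two_pos (by linarith [Real.exp_one_gt_d9])
  have he2 : 1 / 3 ≤ 1 / Real.exp 1 :=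
    one_div_le_one_div_of_le (Real.exp_pos 1) (by linarith [Real.exp_one_lt_d9])
  -- Only 1/3 ≤ 1/e ≤ 1/2 is used: 1 − 1/e ≥ 1/2 yields half of ĝ_R(u), and the error (1 − 1/e)/2 is
  -- at most 1/3. The guarantee thus has the same form as for the proximal method.
  generalize 1 / Real.exp 1 = e at *
  have h1 : (1 - e) * (hatG (fun v => independentActivation q v u) R - 1 / 2) ≤
      (1 - e) * (barG q R y + S.slack y) :=
    mul_le_mul_of_nonneg_left (by linarith) (by linarith)
  have h2 : (1 - e) * S.slack y ≤ S.slack y := mul_le_of_le_one_left hsy (by linarith)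
  nlinarith

theorem time_objUpper_le [NeZero n] (hd : 1 ≤ d) {Tq : ℕ} (hT : 1 ≤ Tq) {R : List (RRSet n)}
    (hR : S.IsRR R) (x : Mix d) :
    (S.objUpper q Tq R x).time ≤ 9 * (unitCost n d Tq + S.totalWidth R) := by
  have h1 := S.time_objHatT_le (fun v x => do
    let p ← prodList (fun j => do tick (Tq + 1); pure (1 - q v j (x j))) (List.finRange d)
    tick 1
    pure (1 - p)) (d * (Tq + 2) + 1) (fun v x => by simp) hR x
  change (S.objUpper q Tq R x).time ≤ _ at h1
  have := le_unitCost (n := n) hd hT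
  have e : n * (d * (Tq + 2) + 1 + 1) = n * d * Tq + 2 * (n * d) + 2 * n := by ring
  rw [e] at h1
  omega

theorem time_objBarT_le [NeZero n] (hd : 1 ≤ d) {Tq : ℕ} (hT : 1 ≤ Tq) {R : List (RRSet n)}
    (hR : S.IsRR R) (x : Mix d) :
    (S.objBarT q Tq R x).time ≤ 7 * (unitCost n d Tq + S.totalWidth R) := by
  have e : (S.objBarT q Tq R x).time =
      (∑ _ : Fin n, (((List.finRange d).map fun _ => Tq + 0 + 1).sum + 1)) +
      ((R.map fun r => (r.map fun _ => 1 + 0 + 1).sum + (1 + 0) + 1).sum +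
      ((S.costT x).time + (1 + 0))) := rfl
  have h2 := sum_le_totalWidth hR 2 2
  have h3 := S.time_costT_le x
  have h5 : (R.map fun r => (r.map fun _ => 1 + 0 + 1).sum + (1 + 0) + 1) =
      R.map fun r => 2 * r.length + 2 := by
    refine List.map_congr_left fun r _ => ?_
    simp [mul_comm]
  have := le_unitCost (n := n) hd hT
  rw [e, h5]
  simp only [Finset.sum_const, Finset.card_univ, Fintype.card_fin, smul_eq_mul, List.map_const',
    List.sum_replicate, List.length_finRange]
  have e2 : n * (d * (Tq + 0 + 1) + 1) = n * d * Tq + n * d + n := by ring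
  rw [e2]
  omega

theorem time_upperGrad_le [NeZero n] (hd : 1 ≤ d) {Tq : ℕ} (hT : 1 ≤ Tq) {R : List (RRSet n)}
    (hR : S.IsRR R) :
    (S.upperGrad q q' L Tq R).time ≤ (⌈9 * (S.diam * ((moment 1 R).val * n * √(d : ℝ) * L +
      S.lam * costLip S.costNorm d)) ^ 2 / S.ε ^ 2⌉₊ + 1) *
        (40 * (unitCost n d Tq + S.totalWidth R)) := by
  set Λ := (moment 1 R).val * n * √(d : ℝ) * L + S.lam * costLip S.costNorm d with hΛdef
  set step : ℕ → Mix d → Timed (Mix d) := fun t x => do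
      let v ← S.subgradT q q' Tq R x
      let z ← tabulate fun i => do
        tick 1
        pure (x i + S.diam / (Λ * √((t : ℝ) + 1)) * v i)
      S.proxT 0 (WithLp.toLp 2 z) with hstep
  set T := ⌈9 * (S.diam * Λ) ^ 2 / S.ε ^ 2⌉₊ with hTdef
  have e : (S.upperGrad q q' L Tq R).time = (moment 1 R).time + (1 +
    (S.bestIterate step (S.objBarT q Tq R) T).time) := rfl
  have hu := le_unitCost (n := n) hd hT
  have h1 := S.time_bestIterate_le step (S.objBarT q Tq R) T
    (25 * unitCost n d Tq + 5 * S.totalWidth R) (7 * (unitCost n d Tq + S.totalWidth R))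
    (fun t x => by
      have h2 := S.time_subgradT_le q q' Tq hR x
      have h3 := S.time_proxT_le 0 (WithLp.toLp 2
        (fun i => x i + S.diam / (Λ * √((t : ℝ) + 1)) * (S.subgradT q q' Tq R x).val i)) hd
      have e : (step t x).time = (S.subgradT q q' Tq R x).time + ((∑ _ : Fin d, (1 + 0 + 1)) +
        (S.proxT 0 (WithLp.toLp 2 (fun i => x i + S.diam / (Λ * √((t : ℝ) + 1)) *
          (S.subgradT q q' Tq R x).val i))).time) := rfl
      simp only [Finset.sum_const, Finset.card_univ, Fintype.card_fin, smul_eq_mul] at e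
      have e1 : n * (d * (Tq + 1) + 1) + n * (2 * d + 1) + n +
        5 * S.totalWidth R + (2 * d + 1) + d * (2 * n + 2) =
        n * d * Tq + 5 * (n * d) + 3 * n + 4 * d + 1 + 5 * S.totalWidth R := by ring
      have e3 : 8 * d * (Nat.clog 2 d + 1) = 8 * (d * (Nat.clog 2 d + 1)) := by ring
      rw [e1] at h2
      rw [e3] at h3
      omega)
    (fun x => time_objBarT_le hd hT hR x)
  have h2 := time_moment_le 1 hR
  have h4 : T * (25 * unitCost n d Tq + 5 * S.totalWidth R +
      7 * (unitCost n d Tq + S.totalWidth R) + 2) ≤ T * (40 * (unitCost n d Tq + S.totalWidth R)) :=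
    Nat.mul_le_mul_left _ (by omega)
  rw [e, Nat.add_mul]
  omega

end upper

end Setting

/-! ## Covering numbers -/

theorem apply_le_of_mem_feasible {c : CostNorm} {k : ℝ} {x : Mix d} (hx : x ∈ feasible c k d)
    (i : Fin d) : x i ≤ k := by
  refine le_trans ?_ hx.2
  cases c
  · simp only [cost, abs_of_nonneg (hx.1 _)]
    exact Finset.single_le_sum (f := fun i => x i) (fun j _ => hx.1 j) (Finset.mem_univ i)
  · exact (le_abs_self _).trans (PiLp.norm_apply_le x i)

theorem single_mem_feasible {c : CostNorm} {k t : ℝ} (ht : 0 ≤ t) (htk : t ≤ k) (i : Fin d) :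
    EuclideanSpace.single i t ∈ feasible c k d := by
  constructor
  · intro j
    by_cases h : j = i <;> simp [h, ht]
  · cases c
    · simp only [cost, PiLp.single_apply]
      rw [Finset.sum_eq_single i (fun j _ hj => by simp [hj]) (by simp)]
      simpa [abs_of_nonneg ht] using htk
    · simpa [cost, abs_of_nonneg ht] using htk

/-- Feasible points have coordinates in [0, k]. Rounding them down to a grid of mesh r/√d moves a
point by at most r, and the grid has ⌊√d k/r⌋ + 1 values per coordinate. -/
theorem covering_le {c : CostNorm} {k r : ℝ} (hk : 0 ≤ k) (hr : 0 < r) (hd : 1 ≤ d) :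
    covering (feasible c k d) r ≤ (2 + √(d : ℝ) * k / r) ^ d := by
  have hsd : 0 < √(d : ℝ) := Real.sqrt_pos.mpr (by exact_mod_cast hd)
  set M := ⌊√(d : ℝ) * k / r⌋₊ with hM
  set f : (Fin d → Fin (M + 1)) → Mix d := fun a =>
    WithLp.toLp 2 fun i => r / √(d : ℝ) * (a i : ℕ) with hf
  have hcov : Metric.IsCover r.toNNReal (feasible c k d) (Set.range f) := by
    intro x hx
    have hxi : ∀ i, √(d : ℝ) / r * x i ≤ √(d : ℝ) * k / r := fun i => by
      rw [div_mul_eq_mul_div]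
      have := apply_le_of_mem_feasible hx i
      gcongr
    refine ⟨f fun i => ⟨⌊√(d : ℝ) / r * x i⌋₊, Nat.lt_succ_of_le (Nat.floor_mono (hxi i))⟩,
      ⟨_, rfl⟩, ?_⟩
    change edist x _ ≤ _
    rw [edist_dist, dist_eq_norm]
    refine ENNReal.ofReal_le_ofReal ?_
    have h1 := Setting.norm_le_of_abs_le (x - f fun i => ⟨⌊√(d : ℝ) / r * x i⌋₊,
      Nat.lt_succ_of_le (Nat.floor_mono (hxi i))⟩) (c := r / √(d : ℝ)) (by positivity) fun i => by
        have h0 : 0 ≤ √(d : ℝ) / r * x i := mul_nonneg (by positivity) (hx.1 i)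
        have h2 := Nat.floor_le h0
        have h3 := (Nat.lt_floor_add_one (√(d : ℝ) / r * x i)).le
        have e : x i = r / √(d : ℝ) * (√(d : ℝ) / r * x i) := by field_simp
        change |x i - r / √(d : ℝ) * (⌊√(d : ℝ) / r * x i⌋₊ : ℝ)| ≤ _
        have e2 : x i - r / √(d : ℝ) * (⌊√(d : ℝ) / r * x i⌋₊ : ℝ) =
          r / √(d : ℝ) * (√(d : ℝ) / r * x i - ⌊√(d : ℝ) / r * x i⌋₊) := by
          rw [mul_sub, ← e]
        rw [e2, abs_of_nonneg (mul_nonneg (by positivity) (by linarith))]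
        exact mul_le_of_le_one_right (by positivity) (by linarith)
    have h2 : √(d : ℝ) * (r / √(d : ℝ)) = r := by field_simp
    rwa [h2] at h1
  have h1 := hcov.externalCoveringNumber_le_encard
  have h2 : (Set.range f).encard ≤ ((M + 1) ^ d : ℕ) := by
    rw [← Set.image_univ]
    refine (Set.encard_image_le _ _).trans ?_
    rw [Set.encard_univ, ENat.card_eq_coe_fintype_card]
    simp
  have h3 : (Metric.externalCoveringNumber r.toNNReal (feasible c k d)).toNat ≤ (M + 1) ^ d := by
    have := ENat.toNat_le_toNat (h1.trans h2) (ENat.natCast_ne_top _)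
    simpa only [ENat.toNat_natCast] using this
  have h4 : (M : ℝ) ≤ √(d : ℝ) * k / r := Nat.floor_le (by positivity)
  calc covering (feasible c k d) r ≤ (((M + 1) ^ d : ℕ) : ℝ) := Nat.cast_le.mpr h3
    _ = ((M : ℝ) + 1) ^ d := by push_cast; ring
    _ ≤ _ := pow_le_pow_left₀ (by positivity) (by linarith) d

/-- Radius 0 arises from a division by L = 0. The covering number is then the cardinality, and
`toNat` sends an infinite one to 0; a finite one occurs only for k = 0, when the feasible set is the
origin. -/
theorem covering_zero_le_one {c : CostNorm} {k : ℝ} (hk : 0 ≤ k) (hd : 1 ≤ d) :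
    covering (feasible c k d) 0 ≤ 1 := by
  unfold covering
  rw [Real.toNNReal_zero, Metric.externalCoveringNumber_zero]
  rcases hk.eq_or_lt with rfl | hk
  · have : feasible c 0 d ⊆ {0} := by
      intro x hx
      ext i
      exact le_antisymm (apply_le_of_mem_feasible hx i) (hx.1 i)
    have h1 := Set.encard_le_encard this
    rw [Set.encard_singleton] at h1
    have := ENat.toNat_le_toNat h1 (by simp)
    exact_mod_cast this
  · have : (feasible c k d).Infinite := by
      refine Set.Infinite.mono (s := (fun t : ℝ => EuclideanSpace.single (⟨0, hd⟩ : Fin d) t) ''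
        Set.Icc 0 k) ?_ ?_
      · rintro _ ⟨t, ht, rfl⟩
        exact single_mem_feasible ht.1 ht.2 _
      · refine Set.Infinite.image (fun s _ t _ hst => ?_) (Set.Icc_infinite hk)
        simpa using congrArg (fun x : Mix d => x ⟨0, hd⟩) hst
    rw [this.encard_eq]
    simp

theorem log_covering_nonneg (P : Set (Mix d)) (r : ℝ) : 0 ≤ Real.log (covering P r) :=
  Real.log_natCast_nonneg _

theorem log_covering_le {c : CostNorm} {k r : ℝ} (hk : 0 ≤ k) (hr : 0 ≤ r) (hd : 1 ≤ d) :
    Real.log (covering (feasible c k d) r) ≤ d * Real.log (2 + √(d : ℝ) * k / r) := by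
  rw [← Real.log_pow]
  have hnn : 0 ≤ covering (feasible c k d) r := Nat.cast_nonneg _
  rcases hnn.eq_or_lt with h0 | h0
  · rw [← h0, Real.log_zero]
    refine Real.log_nonneg (one_le_pow₀ ?_)
    have : 0 ≤ √(d : ℝ) * k / r := by positivity
    linarith
  refine Real.log_le_log h0 ?_
  rcases hr.eq_or_lt with rfl | hr
  · refine (covering_zero_le_one hk hd).trans (one_le_pow₀ ?_)
    simp
  · exact covering_le hk hr hd

namespace Setting

variable {S : Setting n d} {a : ℕ} {h : Fin n → Mix d → ℝ}

theorem Admissible.diam_nonneg (hA : S.Admissible a h) : 0 ≤ S.diam :=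
  (norm_nonneg _).trans (hA.le_diam _ hA.start_mem _ hA.start_mem)

theorem Admissible.k_le_diam (hA : S.Admissible a h) (hd : 1 ≤ d) : S.k ≤ S.diam := by
  have h1 := hA.le_diam _ (single_mem_feasible hA.k_nonneg le_rfl ⟨0, hd⟩) _
    (single_mem_feasible le_rfl hA.k_nonneg ⟨0, hd⟩)
  have e : EuclideanSpace.single (⟨0, hd⟩ : Fin d) (0 : ℝ) = 0 := by
    ext j
    simp
  simpa [e, abs_of_nonneg hA.k_nonneg] using h1

/-! ## Numbers of RR sets -/

/-- One bound serves both radii, b = 1 for θ_i and b = 2 for θ^(2); the constant 6 is 3b for the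
larger b. For L = 0 the ratio k/r vanishes by convention. -/
theorem log_covering_guess_le (hA : S.Admissible a h) (hd : 1 ≤ d) {L Γ b x : ℝ} (hL : 0 ≤ L)
    (hΓ : Real.log (2 + 6 * √(d : ℝ) * S.k * L / S.ε) ≤ Γ) (hb : b = 1 ∨ b = 2) (hx : 1 ≤ x) :
    Real.log (covering S.P (S.ε / 3 / (b * L) * x)) ≤ d * Γ := by
  have hε := hA.ε_pos
  have hk := hA.k_nonneg
  have hb0 : 0 < b := by rcases hb with rfl | rfl <;> norm_num
  have hb2 : b ≤ 2 := by rcases hb with rfl | rfl <;> norm_num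
  refine (log_covering_le hk (by positivity) hd).trans ?_
  refine mul_le_mul_of_nonneg_left (le_trans (Real.log_le_log (by positivity) ?_) hΓ)
    (Nat.cast_nonneg _)
  refine add_le_add_right ?_ 2
  rcases hL.eq_or_lt with rfl | hL
  · simp
  · have e : √(d : ℝ) * S.k / (S.ε / 3 / (b * L) * x) = (b / x * 3) * (√(d : ℝ) * S.k * L / S.ε) := by
      field_simp
    have e2 : 6 * √(d : ℝ) * S.k * L / S.ε = 6 * (√(d : ℝ) * S.k * L / S.ε) := by ring
    rw [e, e2]
    refine mul_le_mul_of_nonneg_right ?_ (by positivity)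
    have : b / x ≤ 2 := by
      rw [div_le_iff₀ (by linarith)]
      linarith
    linarith

theorem ε'_bounds (hA : S.Admissible a h) :
    0 < S.ε' ∧ S.ε' ≤ 1 / 2 ∧ S.ε' ^ 2 = 2 / 9 * S.ε ^ 2 := by
  have hε := hA.ε_pos
  have hε1 := hA.ε_lt_one
  have h2 : √2 * √2 = (2 : ℝ) := Real.mul_self_sqrt (by norm_num)
  have h0 : 0 < √(2 : ℝ) := Real.sqrt_pos.mpr two_pos
  have h1 : √(2 : ℝ) ≤ 3 / 2 := by nlinarith
  unfold ε'
  refine ⟨by positivity, by nlinarith, ?_⟩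
  have : (√2 * S.ε / 3) ^ 2 = (√2 * √2) * S.ε ^ 2 / 9 := by ring
  rw [this, h2]
  ring

theorem guess_succ (S : Setting n d) (i : ℕ) : S.guess (i + 1) = S.guess i / 2 := by
  unfold guess
  rw [pow_succ]
  field_simp

theorem guess_zero_le (hA : S.Admissible a h) : S.guess 0 ≤ 2 * n := by
  have := hA.lam_mul_k_le
  simp only [guess, pow_zero, div_one]
  linarith

theorem natCast_le_guess_zero (hA : S.Admissible a h) : (n : ℝ) ≤ S.guess 0 := by
  have h2 := mul_nonneg hA.lam_nonneg hA.k_nonneg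
  simp only [guess, pow_zero, div_one]
  linarith

theorem guess_zero_eq (S : Setting n d) : S.guess 0 = n + S.lam * S.k := by
  simp [guess]

theorem two_le_logb (hr : 1 ≤ S.rounds) : 2 ≤ Real.logb 2 (n + S.lam * S.k) := by
  have := (Nat.le_floor_iff' (by omega)).mp hr
  push_cast at this
  linarith

section theta

variable [NeZero n] {L Γ : ℝ}

theorem Admissible.natCast_pos (_ : S.Admissible a h) : (1 : ℝ) ≤ n := by
  exact_mod_cast Nat.one_le_iff_ne_zero.mpr (NeZero.ne n)

theorem guess_pos (hA : S.Admissible a h) (i : ℕ) : 0 < S.guess i := by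
  have h1 := hA.natCast_pos
  have h2 := mul_nonneg hA.lam_nonneg hA.k_nonneg
  unfold guess
  positivity

theorem guess_anti (hA : S.Admissible a h) {i j : ℕ} (hij : i ≤ j) : S.guess j ≤ S.guess i := by
  induction hij with
  | refl => exact le_rfl
  | step _ ih =>
    rw [guess_succ]
    linarith [guess_pos hA i]

/-- The − 1 in the number of rounds keeps every guess at least 2, so that the additive error 1/3 of
the gradient methods is small compared with it. -/
theorem two_le_guess (hA : S.Admissible a h) {i : ℕ} (hi1 : 1 ≤ i) (hi : i ≤ S.rounds) :
    2 ≤ S.guess i := by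
  have h0 := guess_pos hA 0
  rw [guess_zero_eq] at h0
  have h1 := (Nat.le_floor_iff' (by omega)).mp hi
  have h2 : ((i + 1 : ℕ) : ℝ) ≤ Real.logb 2 (n + S.lam * S.k) := by push_cast; linarith
  rw [Real.le_logb_iff_rpow_le one_lt_two h0, Real.rpow_natCast] at h2
  rw [guess, le_div_iff₀ (by positivity)]
  rw [pow_succ] at h2
  linarith

/-- If no round stops, the default LB = 1 is below the last guess by a factor of at most 4. -/
theorem guess_rounds_le (hA : S.Admissible a h) : S.guess S.rounds ≤ 4 := by
  have h0 := guess_pos hA 0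
  rw [guess_zero_eq] at h0
  have h1 : Real.logb 2 (n + S.lam * S.k) - 1 < S.rounds + 1 := Nat.lt_floor_add_one _
  have h2 : Real.logb 2 (n + S.lam * S.k) ≤ ((S.rounds + 2 : ℕ) : ℝ) := by push_cast; linarith
  rw [Real.logb_le_iff_le_rpow one_lt_two h0, Real.rpow_natCast] at h2
  rw [guess, div_le_iff₀ (by positivity)]
  rw [pow_add] at h2
  linarith

theorem logb_le (hA : S.Admissible a h) (hΓ : Real.log (2 * n) ≤ Γ) :
    Real.logb 2 (n + S.lam * S.k) ≤ 2 * Γ := by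
  have h1 := hA.natCast_pos
  have h2 := guess_zero_le hA
  have h0 := guess_pos hA 0
  rw [guess_zero_eq] at h2 h0
  have h3 := Real.log_le_log h0 h2
  have h4 : 0 ≤ Real.log (2 * n) := Real.log_nonneg (by linarith)
  rw [Real.logb, div_le_iff₀ (Real.log_pos one_lt_two)]
  have := Real.log_two_gt_d9
  nlinarith

theorem rounds_le (hA : S.Admissible a h) (hΓ : Real.log (2 * n) ≤ Γ) :
    (S.rounds : ℝ) ≤ 2 * Γ := by
  rcases Nat.eq_zero_or_pos S.rounds with h0 | h0
  · rw [h0, Nat.cast_zero]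
    have : 0 ≤ Real.log (2 * n) := Real.log_nonneg (by linarith [hA.natCast_pos])
    linarith
  · have := (Nat.le_floor_iff' (by omega)).mp (le_refl S.rounds)
    linarith [logb_le hA hΓ]

/-- The four logarithms in the numerator add up to at most 4Γ(d + ℓ). With 2 + 2ε'/3 ≤ 7/3 and ε'² =
2ε²/9 the constant is (7/3)·4·(9/2) = 42; the + 1 comes from rounding up. -/
theorem theta_le (hA : S.Admissible a h) (hd : 1 ≤ d) (hL : 0 ≤ L) (hΓ1 : 1 ≤ Γ)
    (hΓ : Real.log (2 + 6 * √(d : ℝ) * S.k * L / S.ε) ≤ Γ) (hΓn : Real.log (2 * n) ≤ Γ) {i : ℕ}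
    (hi1 : 1 ≤ i) (hi : i ≤ S.rounds) :
    (S.theta L i : ℝ) ≤ 42 * n * (Γ * (d + S.ℓ) / S.ε ^ 2) / S.guess i + 1 := by
  obtain ⟨h1, h2, h3⟩ := ε'_bounds hA
  have hn := hA.natCast_pos
  have hε := hA.ε_pos
  have hℓ := hA.ℓ_pos
  have hdR : (1 : ℝ) ≤ d := by exact_mod_cast hd
  have hx := two_le_guess hA hi1 hi
  have hcov := log_covering_guess_le hA hd hL hΓ (Or.inl rfl) (by linarith : 1 ≤ S.guess i)
  rw [one_mul] at hcov
  have hcov0 := log_covering_nonneg S.P (S.ε / 3 / L * S.guess i)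
  have hlb := two_le_logb (hi1.trans hi)
  have hlog : Real.log (Real.logb 2 (n + S.lam * S.k)) ≤ 2 * Γ :=
    (Real.log_le_self (by linarith)).trans (logb_le hA hΓn)
  have hlog0 : 0 ≤ Real.log (Real.logb 2 (n + S.lam * S.k)) := Real.log_nonneg (by linarith)
  have hlogn : Real.log n ≤ Γ := (Real.log_le_log (by linarith) (by linarith)).trans hΓn
  have hlogn0 : 0 ≤ Real.log n := Real.log_nonneg hn
  have hl2 := Real.log_two_lt_d9
  have hl2' := Real.log_two_gt_d9
  set E := Real.log (covering S.P (S.ε / 3 / L * S.guess i)) + S.ℓ * Real.log n + Real.log 2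
          + Real.log (Real.logb 2 (n + S.lam * S.k)) with hE
  have hEle : E ≤ 4 * (Γ * (d + S.ℓ)) := by
    have := mul_le_mul_of_nonneg_left hlogn hℓ.le
    nlinarith
  have hE0 : 0 ≤ E := by positivity
  have hnn : 0 ≤ (n : ℝ) * (2 + 2 / 3 * S.ε') * (E / (S.ε' ^ 2 * S.guess i)) := by positivity
  refine (Nat.ceil_lt_add_one hnn).le.trans (add_le_add_left ?_ 1)
  rw [h3]
  calc (n : ℝ) * (2 + 2 / 3 * S.ε') * (E / (2 / 9 * S.ε ^ 2 * S.guess i))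
      ≤ (n : ℝ) * (7 / 3) * (4 * (Γ * (d + S.ℓ)) / (2 / 9 * S.ε ^ 2 * S.guess i)) := by
        gcongr
        linarith
    _ = _ := by field_simp; ring

/-- Enough samples for concentration up to a constant factor. A round exists only if log₂ N ≥ 2, so
ln 2 + ln log₂ N ≥ 2 ln 2 > 4/3, and ε'² ≤ 2/9. -/
theorem le_theta (hA : S.Admissible a h) {i : ℕ} (hi1 : 1 ≤ i) (hi : i ≤ S.rounds) :
    12 * n / S.guess i ≤ S.theta L i := by
  obtain ⟨h1, h2, h3⟩ := ε'_bounds hA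
  have hn := hA.natCast_pos
  have hε := hA.ε_pos
  have hε1 := hA.ε_lt_one
  have hx := two_le_guess hA hi1 hi
  have hcov0 := log_covering_nonneg S.P (S.ε / 3 / L * S.guess i)
  have hlb := two_le_logb (hi1.trans hi)
  have hlog0 : Real.log 2 ≤ Real.log (Real.logb 2 (n + S.lam * S.k)) :=
    Real.log_le_log two_pos hlb
  have hlogn0 : 0 ≤ S.ℓ * Real.log n := mul_nonneg hA.ℓ_pos.le (Real.log_nonneg hn)
  have hl2' := Real.log_two_gt_d9
  refine le_trans ?_ (Nat.le_ceil _)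
  set E := Real.log (covering S.P (S.ε / 3 / L * S.guess i)) + S.ℓ * Real.log n + Real.log 2
          + Real.log (Real.logb 2 (n + S.lam * S.k)) with hE
  have hE1 : 4 / 3 ≤ E := by linarith
  have h4 : S.ε' ^ 2 ≤ 2 / 9 := by
    rw [h3]
    nlinarith
  calc 12 * n / S.guess i = (n : ℝ) * 2 * (4 / 3 / (2 / 9 * S.guess i)) := by field_simp; ring
    _ ≤ (n : ℝ) * (2 + 2 / 3 * S.ε') * (E / (S.ε' ^ 2 * S.guess i)) := by
        gcongr
        linarith

/-- The range of α forces 1/6 ≤ α' ≤ 2/3, so all factors in α' are constants. The first number of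
sets is the critical one, with 8·2·36·9 = 5184; the second only needs 72. -/
theorem thetaFinal_le (hA : S.Admissible a h) (hd : 1 ≤ d) (hL : 0 ≤ L) (hΓ1 : 1 ≤ Γ)
    (hΓ : Real.log (2 + 6 * √(d : ℝ) * S.k * L / S.ε) ≤ Γ) (hΓn : Real.log (2 * n) ≤ Γ) {α LB : ℝ}
    (hα1 : 1 / 2 ≤ α) (hα2 : α ≤ 2 / 3) (hLB : 1 ≤ LB) :
    (S.thetaFinal α L LB : ℝ) ≤ 5184 * n * (Γ * (d + S.ℓ) / S.ε ^ 2) * (1 / LB) + 1 := by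
  have hn := hA.natCast_pos
  have hε := hA.ε_pos
  have hε1 := hA.ε_lt_one
  have hℓ := hA.ℓ_pos
  have hdR : (1 : ℝ) ≤ d := by exact_mod_cast hd
  have hcov := log_covering_guess_le hA hd hL hΓ (Or.inr rfl) hLB
  rw [two_mul] at hcov
  have hcov0 := log_covering_nonneg S.P (S.ε / 3 / (L + L) * LB)
  have hlogn : Real.log n ≤ Γ := (Real.log_le_log (by linarith) (by linarith)).trans hΓn
  have hlogn0 : 0 ≤ Real.log n := Real.log_nonneg hn
  have hl2 := Real.log_two_lt_d9
  have hl4 : Real.log 4 = 2 * Real.log 2 := by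
    rw [show (4 : ℝ) = 2 ^ 2 by norm_num, Real.log_pow]
    norm_num
  have hl2' := Real.log_two_gt_d9
  have hpow : 0 < (n : ℝ) ^ S.ℓ := Real.rpow_pos_of_pos (by linarith) _
  have hE : Real.log (4 * (n : ℝ) ^ S.ℓ) = Real.log 4 + S.ℓ * Real.log n := by
    rw [Real.log_mul (by norm_num) hpow.ne', Real.log_rpow (by linarith)]
  have hE0 : 0 ≤ Real.log (4 * (n : ℝ) ^ S.ℓ) := by rw [hE, hl4]; positivity
  have hE1 : Real.log (4 * (n : ℝ) ^ S.ℓ) ≤ 2 * (Γ * (d + S.ℓ)) := by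
    rw [hE, hl4]
    nlinarith [mul_le_mul_of_nonneg_left hlogn hℓ.le]
  have hF : Real.log (4 * (n : ℝ) ^ S.ℓ * covering S.P (S.ε / 3 / (L + L) * LB)) ≤
      3 * (Γ * (d + S.ℓ)) := by
    by_cases h0 : covering S.P (S.ε / 3 / (L + L) * LB) = 0
    · rw [h0, mul_zero, Real.log_zero]
      positivity
    · rw [Real.log_mul (by positivity) h0]
      nlinarith
  set α' := α - S.ε / 3 with hα'
  have ha1 : 1 / 6 ≤ α' := by linarith
  have ha2 : α' ≤ 2 / 3 := by linarith
  have hLB0 : 0 < LB := by linarith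
  have hK : 0 ≤ 5184 * n * (Γ * (d + S.ℓ) / S.ε ^ 2) * (1 / LB) := by positivity
  unfold thetaFinal
  rw [← hα']
  refine (Nat.cast_le.mpr (Nat.ceil_le_ceil (max_le ?_ ?_))).trans (Nat.ceil_lt_add_one hK).le
  · have hsq : (1 / 6 : ℝ) ^ 2 ≤ α' ^ 2 := pow_le_pow_left₀ (by norm_num) ha1 2
    calc 8 * n * Real.log (4 * (n : ℝ) ^ S.ℓ) / (LB * α' ^ 2 * (S.ε ^ 2 / 9))
        ≤ 8 * n * (2 * (Γ * (d + S.ℓ))) / (LB * (1 / 6) ^ 2 * (S.ε ^ 2 / 9)) := by gcongr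
      _ = _ := by field_simp; ring
  · have hsq : α' ^ 2 ≤ (2 / 3 : ℝ) ^ 2 := pow_le_pow_left₀ (by linarith) ha2 2
    have hden : S.ε ^ 2 / 18 ≤ (S.ε / 3 - 1 / 4 * α' ^ 2 * (S.ε / 3)) ^ 2 := by
      have e : (S.ε / 3 - 1 / 4 * α' ^ 2 * (S.ε / 3)) ^ 2 =
        S.ε ^ 2 * ((1 - 1 / 4 * α' ^ 2) ^ 2 / 9) := by ring
      have h8 : (8 / 9 : ℝ) ^ 2 ≤ (1 - 1 / 4 * α' ^ 2) ^ 2 :=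
        pow_le_pow_left₀ (by norm_num) (by linarith) 2
      rw [e, div_eq_mul_inv]
      refine mul_le_mul_of_nonneg_left ?_ (sq_nonneg _)
      linarith
    calc 2 * α' * n * Real.log (4 * (n : ℝ) ^ S.ℓ * covering S.P (S.ε / 3 / (L + L) * LB)) /
          ((S.ε / 3 - 1 / 4 * α' ^ 2 * (S.ε / 3)) ^ 2 * LB)
        ≤ 2 * α' * n * (3 * (Γ * (d + S.ℓ))) /
          ((S.ε / 3 - 1 / 4 * α' ^ 2 * (S.ε / 3)) ^ 2 * LB) := by gcongr
      _ ≤ 2 * (2 / 3) * n * (3 * (Γ * (d + S.ℓ))) / (S.ε ^ 2 / 18 * LB) := by gcongr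
      _ = 72 * n * (Γ * (d + S.ℓ) / S.ε ^ 2) * (1 / LB) := by field_simp; ring
      _ ≤ _ := by
        have : 0 ≤ n * (Γ * (d + S.ℓ) / S.ε ^ 2) * (1 / LB) := by positivity
        linarith

end theta

end Setting

/-! ## Sequences of independent samples -/

/-- The law of a sequence of independent samples. -/
def seqLaw [NeZero n] (G : Network n) : Measure (ℕ → Sample n) :=
  Measure.infinitePi fun _ : ℕ => sampleLaw G

instance [NeZero n] (G : Network n) : IsProbabilityMeasure (seqLaw G) := by
  unfold seqLaw
  infer_instance

theorem lintegral_eval [NeZero n] (G : Network n) (f : Sample n → ℝ≥0∞) (j : ℕ) :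
    ∫⁻ w, f (w j) ∂(seqLaw G) = ∫⁻ s, f s ∂(sampleLaw G) :=
  (measurePreserving_eval_infinitePi (fun _ : ℕ => sampleLaw G) j).lintegral_comp
    (Measurable.of_discrete (f := f))

theorem lintegral_prod_eval [NeZero n] (G : Network n) (s : Finset ℕ)
    (f : ℕ → Sample n → ℝ≥0∞) :
    ∫⁻ w, ∏ j ∈ s, f j (w j) ∂(seqLaw G) = ∏ j ∈ s, ∫⁻ v, f j v ∂(sampleLaw G) := by
  have hmeas : ∀ j, Measurable (f j) := fun j => Measurable.of_discrete
  have h1 : ProbabilityTheory.iIndepFun (fun j (w : ℕ → Sample n) => f j (w j)) (seqLaw G) :=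
    ProbabilityTheory.iIndepFun_infinitePi hmeas
  rw [ProbabilityTheory.lintegral_prod_eq_prod_lintegral_of_indepFun s _ h1
    fun j => (hmeas j).comp (measurable_pi_apply j)]
  exact Finset.prod_congr rfl fun j _ => lintegral_eval G (f j) j

/-- The chord of e^{−y} over [0, 1], with e^{−1} ≤ 1/2. -/
theorem exp_neg_le_of_mem {y : ℝ} (hy : y ∈ Set.Icc (0 : ℝ) 1) :
    Real.exp (-y) ≤ 1 - 1 / 2 * y := by
  have := convexOn_exp.2 (Set.mem_univ (0 : ℝ)) (Set.mem_univ (-1 : ℝ)) (sub_nonneg.mpr hy.2) hy.1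
    (by ring)
  simp only [smul_eq_mul, mul_zero, zero_add, mul_neg, mul_one, Real.exp_zero] at this
  have he : Real.exp (-1) ≤ 1 / 2 := by
    rw [Real.exp_neg, ← one_div]
    exact one_div_le_one_div_of_le two_pos (by linarith [Real.exp_one_gt_d9])
  nlinarith [hy.1]

/-! ### Exponential moments and the probability that a round does not stop -/

namespace Setting

variable {S : Setting n d} {a : ℕ} {h : Fin n → Mix d → ℝ}

/-- An exponential moment bound, in the presence of a function of one of the samples. -/
theorem lintegral_exp_mul_le [NeZero n] (S : Setting n d) {Y : Sample n → ℝ}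
    (hY : ∀ s, Y s ∈ Set.Icc (0 : ℝ) 1) {σ : ℝ} (hσ0 : 0 ≤ σ) (hσn : σ ≤ n) (hσ : σ ≤ S.mean Y)
    (f : Sample n → ℝ≥0∞) (M j : ℕ) :
    ∫⁻ w, (∏ i ∈ Finset.range M, ENNReal.ofReal (Real.exp (-Y (w i)))) * f (w j) ∂(seqLaw S.net) ≤
      ENNReal.ofReal (Real.exp (1 / 2 - M * σ / (2 * n))) * ∫⁻ s, f s ∂(sampleLaw S.net) := by
  have hn : (0 : ℝ) < n := by exact_mod_cast Nat.pos_of_ne_zero (NeZero.ne n)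
  set g : Sample n → ℝ≥0∞ := fun s => ENNReal.ofReal (Real.exp (-Y s)) with hg
  have hg1 : ∀ s, g s ≤ 1 := fun s => by
    rw [hg, ENNReal.ofReal_le_one, Real.exp_le_one_iff]
    linarith [(hY s).1]
  have hint : ∫⁻ s, g s ∂(sampleLaw S.net) ≤ ENNReal.ofReal (Real.exp (-(σ / (2 * n)))) := by
    calc ∫⁻ s, g s ∂(sampleLaw S.net)
        ≤ ∫⁻ s, ENNReal.ofReal (1 - 1 / 2 * Y s) ∂(sampleLaw S.net) :=
          lintegral_mono fun s => ENNReal.ofReal_le_ofReal (exp_neg_le_of_mem (hY s))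
      _ = ENNReal.ofReal ((n - 1 / 2 * S.mean Y) / n) := by
          rw [S.lintegral_sampleLaw _ fun s => by linarith [(hY s).2], S.mean_sub, S.mean_one,
            S.mean_const_mul]
      _ ≤ _ := by
          refine ENNReal.ofReal_le_ofReal (le_trans ?_ (Real.one_sub_le_exp_neg _))
          rw [div_le_iff₀ hn, sub_mul, one_mul, div_mul_eq_mul_div, le_sub_iff_add_le]
          have : σ / (2 * n) * n = σ / 2 := by field_simp
          rw [this]
          linarith
  -- Sample j is correlated with f (w j), so its factor, at most 1, is dropped. This replaces M by
  -- at least M − 1 and costs at most e^{σ/(2n)} ≤ e^{1/2}.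
  set s := (Finset.range M).erase j with hs
  have hjs : j ∉ s := Finset.notMem_erase _ _
  set F : ℕ → Sample n → ℝ≥0∞ := fun i => if i = j then f else g with hF
  have hFs : ∀ i ∈ s, F i = g := fun i hi => if_neg (Finset.ne_of_mem_erase hi)
  have hFj : F j = f := if_pos rfl
  have hcard : M ≤ s.card + 1 := by
    have := Finset.pred_card_le_card_erase (s := Finset.range M) (a := j)
    rw [Finset.card_range, ← hs] at this
    omega
  have hprod : ∀ w : ℕ → Sample n, ∏ i ∈ s, F i (w i) = ∏ i ∈ s, g (w i) := fun w =>
    Finset.prod_congr rfl fun i hi => by rw [hFs i hi]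
  calc ∫⁻ w, (∏ i ∈ Finset.range M, g (w i)) * f (w j) ∂(seqLaw S.net)
      ≤ ∫⁻ w, ∏ i ∈ insert j s, F i (w i) ∂(seqLaw S.net) := by
        refine lintegral_mono fun w => ?_
        rw [Finset.prod_insert hjs, hFj, hprod, mul_comm]
        refine mul_le_mul_right ?_ _
        exact Finset.prod_le_prod_of_subset_of_le_one' (Finset.erase_subset _ _)
          fun i _ _ => hg1 _
    _ = (∫⁻ s, g s ∂(sampleLaw S.net)) ^ s.card * ∫⁻ s, f s ∂(sampleLaw S.net) := by
        rw [lintegral_prod_eval, Finset.prod_insert hjs, hFj, mul_comm,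
          Finset.prod_congr rfl fun i hi => by rw [hFs i hi], Finset.prod_const]
    _ ≤ ENNReal.ofReal (Real.exp (-(σ / (2 * n)))) ^ s.card * ∫⁻ s, f s ∂(sampleLaw S.net) := by
        gcongr
    _ ≤ _ := by
        refine mul_le_mul_left ?_ _
        rw [← ENNReal.ofReal_pow (Real.exp_pos _).le, ← Real.exp_nat_mul]
        refine ENNReal.ofReal_le_ofReal (Real.exp_le_exp.mpr ?_)
        have h1 : (M : ℝ) ≤ s.card + 1 := by exact_mod_cast hcard
        have h2 : σ / (2 * n) ≤ 1 / 2 := by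
          rw [div_le_iff₀ (by positivity)]
          linarith
        have h3 : 0 ≤ σ / (2 * n) := by positivity
        have h4 : M * σ / (2 * n) = M * (σ / (2 * n)) := by ring
        rw [h4]
        nlinarith

/-- A bound for the indicator that the estimate from `M` samples is below `4 x`, although its mean
is at least `σ`, together with its moments. -/
theorem exists_failure_bound [NeZero n] (S : Setting n d) {Y : Sample n → ℝ}
    (hY : ∀ s, Y s ∈ Set.Icc (0 : ℝ) 1) {σ x : ℝ} (hσ0 : 0 < σ) (hσn : σ ≤ n)
    (hσ : σ ≤ S.mean Y) (hx : 0 < x) (M : ℕ) (hM : 12 * n / x ≤ M) :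
    ∃ ρ : (ℕ → Sample n) → ℝ≥0∞, Measurable ρ ∧
      (∀ w, (n : ℝ) / M * ∑ j ∈ Finset.range M, Y (w j) < 4 * x → 1 ≤ ρ w) ∧
      ∀ (f : Sample n → ℝ≥0∞) (j : ℕ), ∫⁻ w, ρ w * f (w j) ∂(seqLaw S.net) ≤
        ENNReal.ofReal (min 1 (16 * x / σ)) * ∫⁻ s, f s ∂(sampleLaw S.net) := by
  have hn : (0 : ℝ) < n := by exact_mod_cast Nat.pos_of_ne_zero (NeZero.ne n)
  -- If x is of the order of σ or larger, the trivial bound 1 suffices.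
  by_cases hσx : σ < 16 * x
  · refine ⟨fun _ => 1, measurable_const, fun _ _ => le_rfl, fun f j => ?_⟩
    have : 1 ≤ 16 * x / σ := by
      rw [le_div_iff₀ hσ0]
      linarith
    simp only [one_mul]
    rw [min_eq_left this, ENNReal.ofReal_one, one_mul, lintegral_eval]
  · push Not at hσx
    have hMpos : (0 : ℝ) < M := lt_of_lt_of_le (by positivity) hM
    -- Exponential Markov inequality: the indicator of ∑ Y < 4xM/n is at most e^{4xM/n} ∏ e^{−Y}.
    -- Unlike the stopping event, this bound factorizes over the samples.
    refine ⟨fun w => ENNReal.ofReal (Real.exp (4 * x * M / n)) *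
      ∏ i ∈ Finset.range M, ENNReal.ofReal (Real.exp (-Y (w i))), ?_, fun w hw => ?_, fun f j => ?_⟩
    · refine Measurable.const_mul (Finset.measurable_prod _ fun i _ => ?_) _
      exact (Measurable.of_discrete (f := fun s => ENNReal.ofReal (Real.exp (-Y s)))).comp
        (measurable_pi_apply i)
    · beta_reduce
      rw [← ENNReal.ofReal_prod_of_nonneg fun _ _ => (Real.exp_pos _).le,
        ← ENNReal.ofReal_mul (Real.exp_pos _).le, ← Real.exp_sum, ← Real.exp_add,
        ENNReal.one_le_ofReal, Real.one_le_exp_iff, Finset.sum_neg_distrib]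
      rw [div_mul_eq_mul_div, div_lt_iff₀ hMpos] at hw
      have : ∑ j ∈ Finset.range M, Y (w j) ≤ 4 * x * M / n := by
        rw [le_div_iff₀ hn]
        linarith
      linarith
    · simp only [mul_assoc (ENNReal.ofReal _)]
      rw [lintegral_const_mul' _ _ ENNReal.ofReal_ne_top]
      refine (mul_le_mul_right (S.lintegral_exp_mul_le hY hσ0.le hσn hσ f M j) _).trans ?_
      rw [← mul_assoc, ← ENNReal.ofReal_mul (Real.exp_pos _).le, ← Real.exp_add]
      refine mul_le_mul_left (ENNReal.ofReal_le_ofReal ?_) _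
      have h1 : 16 * x / σ ≤ 1 := by
        rw [div_le_iff₀ hσ0]
        linarith
      rw [min_eq_right h1]
      set z := σ / x with hz
      have hz0 : 0 < z := by positivity
      -- As σ ≥ 16x, the first term is at most half of Mσ/(2n); the remaining Mσ/(4n) is at least
      -- 3σ/x because M ≥ 12n/x. Exponential decay in z = σ/x is then weakened to 1/z.
      have h2 : 4 * x * M / n + (1 / 2 - M * σ / (2 * n)) ≤ -(3 * z - 1 / 2) := by
        have e1 : 4 * x * M / n ≤ M * σ / (4 * n) := by
          rw [div_le_div_iff₀ hn (by positivity)]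
          nlinarith [mul_pos hMpos hn]
        have e2 : 3 * z ≤ M * σ / (4 * n) := by
          rw [le_div_iff₀ (by positivity)]
          have := mul_le_mul_of_nonneg_right hM hσ0.le
          have e : 3 * z * (4 * n) = 12 * n / x * σ := by rw [hz]; field_simp; ring
          rw [e]
          exact this
        have e3 : M * σ / (2 * n) = 2 * (M * σ / (4 * n)) := by field_simp; ring
        rw [e3]
        linarith
      have h3 : 16 * x / σ = 16 * z⁻¹ := by rw [hz]; field_simp
      refine (Real.exp_le_exp.mpr h2).trans ?_
      rw [Real.exp_neg, h3]
      have h4 : z ≤ Real.exp (3 * z - 1 / 2) := by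
        have := Real.add_one_le_exp (3 * z - 1 / 2)
        linarith
      have h5 := inv_anti₀ hz0 h4
      have h6 : 0 < z⁻¹ := by positivity
      linarith

/-! ## The sampling procedure -/

variable (S) in
/-- The first `M` RR sets of a sequence of samples. -/
def sampleList (w : ℕ → Sample n) (M : ℕ) : List (RRSet n) := (List.range M).map fun j => S.rr (w j)

variable (S) in
/-- The number of RR sets at the end of round `i`. -/
def sampleSize (L : ℝ) : ℕ → ℕ
  | 0 => 0
  | i + 1 => max (sampleSize L i) (S.theta L (i + 1))

theorem length_sampleList (w : ℕ → Sample n) (M : ℕ) : (S.sampleList w M).length = M := by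
  simp [sampleList]

theorem isRR_sampleList (w : ℕ → Sample n) (M : ℕ) : S.IsRR (S.sampleList w M) := by
  intro r hr
  obtain ⟨j, -, rfl⟩ := List.mem_map.mp hr
  exact ⟨_, rfl⟩

theorem sum_range_list {β : Type*} [AddCommMonoid β] (f : ℕ → β) (M : ℕ) :
    ((List.range M).map f).sum = ∑ j ∈ Finset.range M, f j := by
  induction M with
  | zero => simp
  | succ M ih => simp [List.range_succ, Finset.sum_range_succ, ih]

theorem totalWidth_sampleList (w : ℕ → Sample n) (M : ℕ) :
    S.totalWidth (S.sampleList w M) = ∑ j ∈ Finset.range M, S.net.width (S.rr (w j)) := by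
  rw [totalWidth, sampleList, List.map_map, sum_range_list]
  rfl

theorem hatG_sampleList (H : Fin n → ℝ) (w : ℕ → Sample n) (M : ℕ) :
    hatG H (S.sampleList w M) = (n : ℝ) / M * ∑ j ∈ Finset.range M, hit H (S.rr (w j)) := by
  rw [hatG, length_sampleList, sampleList, List.map_map, sum_range_list]
  rfl

/-- The subtraction truncates at 0: if a round asks for no more sets than there are, none is added.
Hence the maximum. -/
theorem sampleList_append (w : ℕ → Sample n) (M θ : ℕ) :
    S.sampleList w M ++ (mapList (fun j => rrGenerate S.net S.sampleTime (w j))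
      (List.range' M (θ - M))).val = S.sampleList w (max M θ) := by
  have e : max M θ = M + (θ - M) := by omega
  rw [val_mapList, e, sampleList, sampleList, List.range_eq_range', List.range_eq_range',
    ← List.range'_append_1, List.map_append, zero_add]
  rfl

theorem time_generate_le (ha : ∀ v, S.sampleTime v ≤ a * (S.net.inDegree v + 1))
    (w : ℕ → Sample n) (M m : ℕ) :
    (mapList (fun j => rrGenerate S.net S.sampleTime (w j)) (List.range' M m)).time ≤
      (a + 3) * S.totalWidth (S.sampleList w (M + m)) := by
  have h1 : ((List.range' M m).map fun j => S.net.width (S.rr (w j))).sum ≤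
      S.totalWidth (S.sampleList w (M + m)) := by
    rw [totalWidth, sampleList, List.map_map, List.range_eq_range', ← List.range'_append_1,
      List.map_append, List.sum_append, zero_add]
    exact Nat.le_add_left _ _
  refine le_trans ?_ (Nat.mul_le_mul_left _ h1)
  rw [time_mapList, ← List.sum_map_mul_left]
  refine List.sum_le_sum fun j _ => ?_
  have h2 := S.time_rrGenerate_le a ha (w j)
  have h3 := S.one_le_width_rr (w j)
  nlinarith

/-- The stopping condition of round `i` of the sampling procedure. -/
def Stops (S : Setting n d) (L : ℝ) (grad : List (RRSet n) → Timed (Mix d))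
    (obj : List (RRSet n) → Mix d → Timed ℝ) (w : ℕ → Sample n) (i : ℕ) : Prop :=
  (1 + S.ε' + S.ε / 3) * S.guess i ≤ (obj (S.sampleList w (S.sampleSize L i))
    (grad (S.sampleList w (S.sampleSize L i))).val).val

section loop

variable {L : ℝ} {grad : List (RRSet n) → Timed (Mix d)} {obj : List (RRSet n) → Mix d → Timed ℝ}

/-- Isolates one round: t is its own cost, and it ends the loop or passes its RR sets on to the next
round. -/
theorem samplingLoop_succ (w : ℕ → Sample n) (fuel i : ℕ) :
    ∃ t ≤ 1 + (mapList (fun j => rrGenerate S.net S.sampleTime (w j)) (List.range' (S.sampleSize L i)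
        (S.theta L (i + 1) - S.sampleSize L i))).time +
        (grad (S.sampleList w (S.sampleSize L (i + 1)))).time +
        (obj (S.sampleList w (S.sampleSize L (i + 1)))
          (grad (S.sampleList w (S.sampleSize L (i + 1)))).val).time,
      (S.Stops L grad obj w (i + 1) ∧
        (S.samplingLoop L grad obj w (fuel + 1) (i + 1) (S.sampleList w (S.sampleSize L i))).time = t ∧
        (S.samplingLoop L grad obj w (fuel + 1) (i + 1) (S.sampleList w (S.sampleSize L i))).val =
          (obj (S.sampleList w (S.sampleSize L (i + 1)))
            (grad (S.sampleList w (S.sampleSize L (i + 1)))).val).val / (1 + S.ε' + S.ε / 3)) ∨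
      (¬ S.Stops L grad obj w (i + 1) ∧
        (S.samplingLoop L grad obj w (fuel + 1) (i + 1) (S.sampleList w (S.sampleSize L i))).time =
          t + (S.samplingLoop L grad obj w fuel (i + 2) (S.sampleList w (S.sampleSize L (i + 1)))).time ∧
        (S.samplingLoop L grad obj w (fuel + 1) (i + 1) (S.sampleList w (S.sampleSize L i))).val =
          (S.samplingLoop L grad obj w fuel (i + 2) (S.sampleList w (S.sampleSize L (i + 1)))).val) := by
  have e := S.sampleList_append w (S.sampleSize L i) (S.theta L (i + 1))
  have e2 : max (S.sampleSize L i) (S.theta L (i + 1)) = S.sampleSize L (i + 1) := rfl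
  rw [e2] at e
  refine ⟨_, le_rfl, ?_⟩
  by_cases hs : S.Stops L grad obj w (i + 1)
  · refine Or.inl ⟨hs, ?_, ?_⟩
    all_goals unfold Stops at hs
    · unfold samplingLoop
      simp only [time_bind, length_sampleList, e, time_tick]
      rw [if_pos hs]
      simp only [time_pure]
      ring
    · unfold samplingLoop
      simp only [val_bind, length_sampleList, e]
      rw [if_pos hs]
      rfl
  · refine Or.inr ⟨hs, ?_, ?_⟩
    all_goals unfold Stops at hs
    · conv_lhs => unfold samplingLoop
      simp only [time_bind, length_sampleList, e, time_tick]
      rw [if_neg hs]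
      ring
    · conv_lhs => unfold samplingLoop
      simp only [val_bind, length_sampleList, e]
      rw [if_neg hs]

/-- The cost of a round with `M` RR sets. -/
def roundCost (S : Setting n d) (B : ℝ≥0∞) (U : ℕ) (M : ℕ) (w : ℕ → Sample n) : ℝ≥0∞ :=
  B * (U + S.totalWidth (S.sampleList w M) : ℕ)

variable {A : ℝ≥0∞} {U : ℕ}

/-- A ≥ 1 and U ≥ 1 let the factor a + 4 for generation and bookkeeping join the two summands A,
giving (a + 6)A. -/
theorem time_round_le (ha : ∀ v, S.sampleTime v ≤ a * (S.net.inDegree v + 1)) (hA : 1 ≤ A)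
    (hU : 1 ≤ U)
    (hgrad : ∀ R, S.IsRR R → ((grad R).time : ℝ≥0∞) ≤ A * (U + S.totalWidth R : ℕ))
    (hobj : ∀ R x, S.IsRR R → ((obj R x).time : ℝ≥0∞) ≤ A * (U + S.totalWidth R : ℕ))
    (w : ℕ → Sample n) (M m : ℕ) (x : Mix d) :
    ((1 + (mapList (fun j => rrGenerate S.net S.sampleTime (w j)) (List.range' M m)).time +
      (grad (S.sampleList w (M + m))).time + (obj (S.sampleList w (M + m)) x).time : ℕ) : ℝ≥0∞) ≤
        S.roundCost ((a + 6) * A) U (M + m) w := by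
  have h1 := S.time_generate_le ha w M m
  have h2 := hgrad _ (S.isRR_sampleList w (M + m))
  have h3 := hobj _ x (S.isRR_sampleList w (M + m))
  set W := S.totalWidth (S.sampleList w (M + m))
  have h4 : ((1 + (mapList (fun j => rrGenerate S.net S.sampleTime (w j))
      (List.range' M m)).time : ℕ) : ℝ≥0∞) ≤ (a + 4) * A * (U + W : ℕ) := by
    have h5 : 1 + (mapList (fun j => rrGenerate S.net S.sampleTime (w j))
      (List.range' M m)).time ≤ (a + 4) * (U + W) := by nlinarith
    calc _ ≤ (((a + 4) * (U + W) : ℕ) : ℝ≥0∞) := Nat.cast_le.mpr h5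
      _ = (a + 4) * 1 * (U + W : ℕ) := by push_cast; ring
      _ ≤ _ := by gcongr
  rw [Nat.cast_add, Nat.cast_add]
  calc _ ≤ (a + 4) * A * (U + W : ℕ) + A * (U + W : ℕ) + A * (U + W : ℕ) := by gcongr
    _ = _ := by rw [roundCost]; ring

theorem sampleSize_succ (L : ℝ) (i : ℕ) :
    S.sampleSize L i + (S.theta L (i + 1) - S.sampleSize L i) = S.sampleSize L (i + 1) := by
  change _ = max (S.sampleSize L i) (S.theta L (i + 1))
  omega

/-- The running time of the sampling procedure, for bounds `ρ i` of the indicators that round `i`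
does not stop. -/
theorem time_samplingLoop_le (ha : ∀ v, S.sampleTime v ≤ a * (S.net.inDegree v + 1)) (hA : 1 ≤ A)
    (hU : 1 ≤ U)
    (hgrad : ∀ R, S.IsRR R → ((grad R).time : ℝ≥0∞) ≤ A * (U + S.totalWidth R : ℕ))
    (hobj : ∀ R x, S.IsRR R → ((obj R x).time : ℝ≥0∞) ≤ A * (U + S.totalWidth R : ℕ))
    (w : ℕ → Sample n) (ρ : ℕ → ℝ≥0∞) (fuel i : ℕ)
    (hρ : ∀ j, i < j → j ≤ i + fuel → ¬ S.Stops L grad obj w j → 1 ≤ ρ j) (hi : 1 ≤ ρ i) :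
    ((S.samplingLoop L grad obj w fuel (i + 1) (S.sampleList w (S.sampleSize L i))).time : ℝ≥0∞) ≤
      ∑ t ∈ Finset.range fuel,
        ρ (i + t) * S.roundCost ((a + 6) * A) U (S.sampleSize L (i + t + 1)) w := by
  induction fuel generalizing i with
  | zero => simp [samplingLoop]
  | succ fuel ih =>
    obtain ⟨t, ht, hcase⟩ := samplingLoop_succ (S := S) (L := L) (grad := grad) (obj := obj) w fuel i
    have hround := time_round_le ha hA hU hgrad hobj w (S.sampleSize L i)
      (S.theta L (i + 1) - S.sampleSize L i) (grad (S.sampleList w (S.sampleSize L (i + 1)))).val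
    rw [sampleSize_succ] at hround
    -- Round i + 1 is paid for by ρ i, since it is reached only if round i did not stop; for i = 0
    -- this will be the constant 1.
    have ht' : (t : ℝ≥0∞) ≤ ρ i * S.roundCost ((a + 6) * A) U (S.sampleSize L (i + 1)) w :=
      ((Nat.cast_le.mpr ht).trans hround).trans (le_mul_of_one_le_left' hi)
    rw [Finset.sum_range_succ', add_comm (Finset.sum _ _)]
    rcases hcase with ⟨-, h1, -⟩ | ⟨hs, h1, -⟩
    · rw [h1]
      exact le_add_right ht'
    · rw [h1, Nat.cast_add]
      refine add_le_add ht' ?_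
      have := ih (i + 1) (fun j h1 h2 => hρ j (by omega) (by omega))
        (hρ (i + 1) (by omega) (by omega) hs)
      refine this.trans (le_of_eq (Finset.sum_congr rfl fun t _ => ?_))
      rw [add_right_comm i 1 t, add_assoc i t 1]

/-- The lower bound found by the sampling procedure. -/
theorem val_samplingLoop [NeZero n] (hA : S.Admissible a h) (w : ℕ → Sample n) (ρ : ℕ → ℝ≥0∞)
    (fuel i : ℕ) (hr : i + fuel ≤ S.rounds)
    (hρ : ∀ j, i < j → j ≤ i + fuel → ¬ S.Stops L grad obj w j → 1 ≤ ρ j) (hi : 1 ≤ ρ i) :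
    1 ≤ (S.samplingLoop L grad obj w fuel (i + 1) (S.sampleList w (S.sampleSize L i))).val ∧
    ENNReal.ofReal
      (1 / (S.samplingLoop L grad obj w fuel (i + 1) (S.sampleList w (S.sampleSize L i))).val) ≤
      ∑ t ∈ Finset.range fuel, ρ (i + t) * ENNReal.ofReal (1 / S.guess (i + t + 1)) +
        ρ (i + fuel) := by
  induction fuel generalizing i with
  -- No round stopped: LB = 1, and the last ρ pays for it.
  | zero => simpa [samplingLoop] using hi
  | succ fuel ih =>
    obtain ⟨t, -, hcase⟩ := samplingLoop_succ (S := S) (L := L) (grad := grad) (obj := obj) w fuel i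
    rcases hcase with ⟨hs, -, h1⟩ | ⟨hs, -, h1⟩
    · have h2 := two_le_guess hA (i := i + 1) (by omega) (by omega)
      obtain ⟨h3, -, -⟩ := ε'_bounds hA
      have h4 := hA.ε_pos
      rw [h1]
      unfold Stops at hs
      -- When round i + 1 stops, LB is at least its guess.
      rw [mul_comm, ← le_div_iff₀ (by positivity)] at hs
      refine ⟨by linarith, ?_⟩
      rw [Finset.sum_range_succ']
      refine le_add_right (le_add_left ?_)
      refine le_trans ?_ (le_mul_of_one_le_left' hi)
      exact ENNReal.ofReal_le_ofReal (one_div_le_one_div_of_le (by linarith) hs)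
    · rw [h1]
      have := ih (i + 1) (by omega) (fun j h1 h2 => hρ j (by omega) (by omega))
        (hρ (i + 1) (by omega) (by omega) hs)
      refine ⟨this.1, this.2.trans ?_⟩
      rw [Finset.sum_range_succ']
      refine add_le_add (le_add_right (le_of_eq ?_)) (le_of_eq ?_)
      · refine Finset.sum_congr rfl fun t _ => ?_
        rw [add_right_comm i 1 t, add_assoc i t 1]
      · rw [add_right_comm i 1 fuel, add_assoc i fuel 1]

end loop

end Setting

namespace Setting

variable {S : Setting n d} {a : ℕ} {h : Fin n → Mix d → ℝ}

/-! ## The expected running time -/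

theorem one_le_spread (S : Setting n d) (v : Fin n) : 1 ≤ S.net.spread {v} := by
  rw [S.spread_eq]
  refine S.net.sum_prob.ge.trans (Finset.sum_le_sum fun T _ => ?_)
  refine le_mul_of_one_le_right (S.net.prob_nonneg T) ?_
  have h1 : (1 : ℝ) = if ∃ u ∈ ({v} : Finset (Fin n)), u ∈ S.rr (v, T) then 1 else 0 := by
    rw [if_pos ⟨v, by simp, S.root_mem_rr (v, T)⟩]
  refine h1.le.trans ?_
  exact Finset.single_le_sum
    (f := fun v' => if ∃ u ∈ ({v} : Finset (Fin n)), u ∈ S.rr (v', T) then (1 : ℝ) else 0)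
    (fun v' _ => by split_ifs <;> norm_num) (Finset.mem_univ v)

theorem spread_le_natCast (S : Setting n d) (A : Finset (Fin n)) : S.net.spread A ≤ n := by
  rw [S.spread_eq, ← S.mean_one]
  exact S.mean_mono fun w => by split_ifs <;> norm_num

/-- The expected width of an RR set. -/
def meanWidth (S : Setting n d) : ℝ := S.mean (fun w => (S.net.width (S.rr w) : ℝ)) / n

theorem meanWidth_nonneg (S : Setting n d) : 0 ≤ S.meanWidth :=
  div_nonneg (Finset.sum_nonneg fun T _ => mul_nonneg (S.net.prob_nonneg T)
    (Finset.sum_nonneg fun _ _ => Nat.cast_nonneg _)) (Nat.cast_nonneg _)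

theorem lintegral_width [NeZero n] (S : Setting n d) :
    ∫⁻ s, (S.net.width (S.rr s) : ℝ≥0∞) ∂(sampleLaw S.net) = ENNReal.ofReal S.meanWidth := by
  rw [meanWidth, ← S.lintegral_sampleLaw _ fun _ => Nat.cast_nonneg _]
  simp only [ENNReal.ofReal_natCast]

/-- The in-degrees plus one add up to m + n, and each is weighted by a spread of at most σ. -/
theorem meanWidth_le (S : Setting n d) {σ : ℝ} (hσ : ∀ v, S.net.spread {v} ≤ σ) :
    S.meanWidth ≤ ((S.edges : ℝ) + n) * σ / n := by
  rw [meanWidth, mean_width]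
  refine div_le_div_of_nonneg_right ?_ (Nat.cast_nonneg _)
  have e : ((S.edges : ℝ) + n) = ∑ u, ((S.net.inDegree u : ℝ) + 1) := by
    have := S.net.sum_inDegree
    rw [edges]
    exact_mod_cast this.symm
  rw [e, Finset.sum_mul]
  exact Finset.sum_le_sum fun u _ => mul_le_mul_of_nonneg_left (hσ u) (by positivity)

/-- The width is a sum over samples, so the hypothesis on ρ applies to each of them separately. The
result looks as if ρ, with expectation c, were independent of the widths. -/
theorem lintegral_mul_roundCost_le [NeZero n] (S : Setting n d) {B c : ℝ≥0∞} {U M : ℕ}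
    {ρ : (ℕ → Sample n) → ℝ≥0∞} (hρm : Measurable ρ)
    (hρ : ∀ (f : Sample n → ℝ≥0∞) (j : ℕ), ∫⁻ w, ρ w * f (w j) ∂(seqLaw S.net) ≤
      c * ∫⁻ s, f s ∂(sampleLaw S.net)) :
    ∫⁻ w, ρ w * S.roundCost B U M w ∂(seqLaw S.net) ≤
      B * (c * U + M * (c * ENNReal.ofReal S.meanWidth)) := by
  have hwm : ∀ j, Measurable fun w : ℕ → Sample n => (S.net.width (S.rr (w j)) : ℝ≥0∞) := fun j =>
    (Measurable.of_discrete (f := fun s => (S.net.width (S.rr s) : ℝ≥0∞))).comp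
      (measurable_pi_apply j)
  have e : ∀ w, ρ w * S.roundCost B U M w =
      B * (ρ w * U + ∑ j ∈ Finset.range M, ρ w * (S.net.width (S.rr (w j)) : ℝ≥0∞)) := by
    intro w
    rw [roundCost, totalWidth_sampleList, ← Finset.mul_sum]
    push_cast
    ring
  have hm1 : Measurable fun w => ρ w * U := hρm.mul_const _
  have hm2 : ∀ j ∈ Finset.range M, Measurable fun w => ρ w * (S.net.width (S.rr (w j)) : ℝ≥0∞) :=
    fun j _ => hρm.mul (hwm j)
  have hm : Measurable fun w => ρ w * U +
      ∑ j ∈ Finset.range M, ρ w * (S.net.width (S.rr (w j)) : ℝ≥0∞) :=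
    hm1.add (Finset.measurable_sum _ hm2)
  simp only [e]
  rw [lintegral_const_mul _ hm, lintegral_add_left hm1, lintegral_finsetSum _ hm2]
  refine mul_le_mul_right (add_le_add ?_ ?_) _
  · have := hρ (fun _ => U) 0
    rwa [lintegral_const, measure_univ, mul_one] at this
  · refine (Finset.sum_le_sum fun j _ =>
      (hρ (fun s => (S.net.width (S.rr s) : ℝ≥0∞)) j)).trans (le_of_eq ?_)
    rw [lintegral_width, Finset.sum_const, Finset.card_range, nsmul_eq_mul]

theorem theta_le_sampleSize (S : Setting n d) (L : ℝ) {i : ℕ} (hi : 1 ≤ i) :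
    S.theta L i ≤ S.sampleSize L i := by
  obtain ⟨i, rfl⟩ := Nat.exists_eq_add_of_le' hi
  exact le_max_right _ _

/-- The guesses decrease, so the bound for the current round dominates those for all earlier ones,
and with them the maximum. -/
theorem sampleSize_le [NeZero n] (hA : S.Admissible a h) (hd : 1 ≤ d) {L Γ : ℝ} (hL : 0 ≤ L)
    (hΓ1 : 1 ≤ Γ) (hΓ : Real.log (2 + 6 * √(d : ℝ) * S.k * L / S.ε) ≤ Γ)
    (hΓn : Real.log (2 * n) ≤ Γ) {i : ℕ} (hi : i ≤ S.rounds) :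
    (S.sampleSize L i : ℝ) ≤ 42 * n * (Γ * (d + S.ℓ) / S.ε ^ 2) / S.guess i + 1 := by
  have hℓ := hA.ℓ_pos
  induction i with
  | zero =>
    have := guess_pos hA 0
    simp only [sampleSize, Nat.cast_zero]
    positivity
  | succ i ih =>
    have h1 := ih (by omega)
    have h2 := theta_le hA hd hL hΓ1 hΓ hΓn (by omega : 1 ≤ i + 1) hi
    have h3 := guess_anti hA (Nat.le_add_right i 1)
    have h4 := guess_pos hA (i + 1)
    rw [sampleSize, Nat.cast_max]
    refine max_le (h1.trans ?_) h2
    gcongr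

/-- Measurable bounds for the indicators that round `i` is reached and does not stop. -/
theorem exists_reach_bounds [NeZero n] (hA : S.Admissible a h)
    (hmem : ∀ v, ∀ x ∈ orthant d, h v x ∈ Set.Icc (0 : ℝ) 1) {L : ℝ}
    {grad : List (RRSet n) → Timed (Mix d)} {obj : List (RRSet n) → Mix d → Timed ℝ}
    (hspec : ∀ R, S.IsRR R → R ≠ [] → ∀ u ∈ S.P,
      1 / 2 * hatG (fun v => h v u) R - 1 / 3 ≤ (obj R (grad R).val).val)
    (v₀ : Fin n) :
    ∃ ρ : ℕ → (ℕ → Sample n) → ℝ≥0∞, (∀ i, Measurable (ρ i)) ∧ (∀ w, ρ 0 w = 1) ∧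
      (∀ i, 1 ≤ i → i ≤ S.rounds → ∀ w, ¬ S.Stops L grad obj w i → 1 ≤ ρ i w) ∧
      ∀ i ≤ S.rounds, ∀ (f : Sample n → ℝ≥0∞) (j : ℕ), ∫⁻ w, ρ i w * f (w j) ∂(seqLaw S.net) ≤
        ENNReal.ofReal (min 1 (16 * S.guess i / S.net.spread {v₀})) *
          ∫⁻ s, f s ∂(sampleLaw S.net) := by
  -- A single fixed u suffices as witness, so no union bound over the feasible set is needed.
  obtain ⟨u, hu, hσ⟩ := hA.spread_le v₀
  have hσ1 := S.one_le_spread v₀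
  have hσn := S.spread_le_natCast {v₀}
  rw [S.influence_eq] at hσ
  set σ := S.net.spread {v₀}
  have hn := hA.natCast_pos
  have hY : ∀ s, hit (fun v => h v u) (S.rr s) ∈ Set.Icc (0 : ℝ) 1 := fun s =>
    hit_mem _ _ fun v => hmem v u hu.1
  have key : ∀ i, ∃ ρ : (ℕ → Sample n) → ℝ≥0∞, Measurable ρ ∧ (i = 0 → ∀ w, ρ w = 1) ∧
      (1 ≤ i → i ≤ S.rounds → ∀ w, ¬ S.Stops L grad obj w i → 1 ≤ ρ w) ∧
      (i ≤ S.rounds → ∀ (f : Sample n → ℝ≥0∞) (j : ℕ), ∫⁻ w, ρ w * f (w j) ∂(seqLaw S.net) ≤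
        ENNReal.ofReal (min 1 (16 * S.guess i / σ)) * ∫⁻ s, f s ∂(sampleLaw S.net)) := by
    intro i
    rcases Nat.eq_zero_or_pos i with rfl | hi
    · refine ⟨fun _ => 1, measurable_const, fun _ _ => rfl, fun _ _ _ _ => le_rfl, fun _ f j => ?_⟩
      have h1 : 1 ≤ 16 * S.guess 0 / σ := by
        rw [le_div_iff₀ (by linarith)]
        linarith [natCast_le_guess_zero hA]
      simp only [one_mul]
      rw [min_eq_left h1, ENNReal.ofReal_one, one_mul, lintegral_eval]
    · by_cases hir : i ≤ S.rounds
      · have hx := two_le_guess hA hi hir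
        have hM : 12 * n / S.guess i ≤ (S.sampleSize L i : ℝ) :=
          (le_theta hA hi hir).trans (by exact_mod_cast S.theta_le_sampleSize L hi)
        obtain ⟨ρ, h1, h2, h3⟩ := S.exists_failure_bound hY (by linarith) hσn hσ
          (by linarith : 0 < S.guess i) _ hM
        refine ⟨ρ, h1, fun h0 => absurd h0 (by omega), fun _ _ w hs => h2 w ?_, fun _ => h3⟩
        have hMpos : (0 : ℝ) < S.sampleSize L i := lt_of_lt_of_le (by positivity) hM
        have hne : S.sampleList w (S.sampleSize L i) ≠ [] := by
          rw [← List.length_pos_iff, length_sampleList]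
          exact_mod_cast hMpos
        have h4 := hspec _ (S.isRR_sampleList w _) hne u hu
        rw [hatG_sampleList] at h4
        unfold Stops at hs
        push Not at hs
        -- Not stopping means ĝ_R(u)/2 − 1/3 < (11/6)x, as 1 + ε' + ε/3 ≤ 11/6. Hence ĝ_R(u) <
        -- (11/3)x + 2/3 ≤ 4x, because x ≥ 2.
        obtain ⟨-, h5, -⟩ := ε'_bounds hA
        have h6 := hA.ε_lt_one
        have h7 : (1 + S.ε' + S.ε / 3) * S.guess i ≤ 11 / 6 * S.guess i :=
          mul_le_mul_of_nonneg_right (by linarith) (by linarith)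
        linarith
      · exact ⟨fun _ => 1, measurable_const, fun h0 => absurd h0 (by omega),
          fun _ h0 => absurd h0 hir, fun h0 => absurd h0 hir⟩
  choose ρ h1 h2 h3 h4 using key
  exact ⟨ρ, h1, h2 0 rfl, h3, h4⟩

theorem time_gradRIS_le (ha : ∀ v, S.sampleTime v ≤ a * (S.net.inDegree v + 1))
    {L α : ℝ} {grad : List (RRSet n) → Timed (Mix d)} {obj : List (RRSet n) → Mix d → Timed ℝ}
    {A : ℝ≥0∞} {U : ℕ} (hA : 1 ≤ A) (hU : 1 ≤ U)
    (hgrad : ∀ R, S.IsRR R → ((grad R).time : ℝ≥0∞) ≤ A * (U + S.totalWidth R : ℕ))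
    (hobj : ∀ R x, S.IsRR R → ((obj R x).time : ℝ≥0∞) ≤ A * (U + S.totalWidth R : ℕ))
    (w : Tape n) :
    ((S.gradRIS α L grad obj w).time : ℝ≥0∞) ≤
      ((S.samplingLoop L grad obj w.1 S.rounds 1 []).time : ℝ≥0∞) +
        S.roundCost ((a + 6) * A) U
          (S.thetaFinal α L (S.samplingLoop L grad obj w.1 S.rounds 1 []).val) w.2 := by
  set M := S.thetaFinal α L (S.samplingLoop L grad obj w.1 S.rounds 1 []).val with hM
  have h1 := time_round_le ha hA hU hgrad hobj w.2 0 M S.start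
  rw [zero_add] at h1
  have e : (S.gradRIS α L grad obj w).time = (S.samplingLoop L grad obj w.1 S.rounds 1 []).time +
      (1 + ((mapList (fun j => rrGenerate S.net S.sampleTime (w.2 j)) (List.range M)).time +
        (grad (S.sampleList w.2 M)).time)) := rfl
  rw [e, Nat.cast_add]
  refine add_le_add_right (le_trans (Nat.cast_le.mpr ?_) h1) _
  rw [List.range_eq_range']
  omega

/-- The expected running time of `Grad-RIS`, for a gradient algorithm that takes at most `A` times
`U` plus the total width of the RR sets. -/
theorem lintegral_time_gradRIS_le [NeZero n] (hA : S.Admissible a h) (hd : 1 ≤ d)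
    (hmem : ∀ v, ∀ x ∈ orthant d, h v x ∈ Set.Icc (0 : ℝ) 1) {L Γ α : ℝ} (hL : 0 ≤ L)
    (hΓ1 : 1 ≤ Γ) (hΓ : Real.log (2 + 6 * √(d : ℝ) * S.k * L / S.ε) ≤ Γ)
    (hΓn : Real.log (2 * n) ≤ Γ) (hα1 : 1 / 2 ≤ α) (hα2 : α ≤ 2 / 3)
    {grad : List (RRSet n) → Timed (Mix d)} {obj : List (RRSet n) → Mix d → Timed ℝ}
    {A : ℝ≥0∞} {U : ℕ} (hA1 : 1 ≤ A) (hU : 1 ≤ U)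
    (hgrad : ∀ R, S.IsRR R → ((grad R).time : ℝ≥0∞) ≤ A * (U + S.totalWidth R : ℕ))
    (hobj : ∀ R x, S.IsRR R → ((obj R x).time : ℝ≥0∞) ≤ A * (U + S.totalWidth R : ℕ))
    (hspec : ∀ R, S.IsRR R → R ≠ [] → ∀ u ∈ S.P,
      1 / 2 * hatG (fun v => h v u) R - 1 / 3 ≤ (obj R (grad R).val).val) :
    ∫⁻ w, ((S.gradRIS α L grad obj w).time : ℝ≥0∞) ∂(tapeLaw S.net) ≤
      (a + 6) * A * ENNReal.ofReal ((S.rounds + 2) *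
        (U + 200000 * (Γ * (d + S.ℓ) / S.ε ^ 2 * (S.edges + n)))) := by
  have hn := hA.natCast_pos
  have hε := hA.ε_pos
  have hε1 := hA.ε_lt_one
  have hℓ := hA.ℓ_pos
  have hdR : (1 : ℝ) ≤ d := by exact_mod_cast hd
  -- The best single node plays two roles: its spread bounds the mean width from above and the
  -- optimum from below.
  obtain ⟨v₀, -, hv₀⟩ := Finset.exists_max_image Finset.univ (fun v => S.net.spread {v})
    ⟨⟨0, Nat.pos_of_ne_zero (NeZero.ne n)⟩, Finset.mem_univ _⟩
  obtain ⟨ρ, hρm, hρ0, hρs, hρi⟩ := exists_reach_bounds hA hmem (L := L) hspec v₀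
  have hσ1 := S.one_le_spread v₀
  have hσn := S.spread_le_natCast {v₀}
  have hω := S.meanWidth_le fun v => hv₀ v (Finset.mem_univ v)
  have hω0 := S.meanWidth_nonneg
  set σ := S.net.spread {v₀} with hσ
  set ω := S.meanWidth with hωdef
  set E : ℝ := (S.edges : ℝ) + n with hE
  set K := Γ * (d + S.ℓ) / S.ε ^ 2 with hK
  set B : ℝ≥0∞ := (a + 6) * A with hB
  set r := S.rounds with hr
  set c : ℕ → ℝ := fun t => min 1 (16 * S.guess t / σ) with hc
  have hσ0 : 0 < σ := by linarith
  have hE1 : 1 ≤ E := by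
    have : (0 : ℝ) ≤ S.edges := Nat.cast_nonneg _
    linarith
  have hK1 : 1 ≤ K := by
    rw [hK, le_div_iff₀ (by positivity)]
    have h1 : S.ε ^ 2 ≤ 1 := pow_le_one₀ hε.le hε1.le
    nlinarith
  have hgp := guess_pos hA
  have hc0 : ∀ t, 0 ≤ c t := fun t => le_min zero_le_one (by have := hgp t; positivity)
  -- The spread σ cancels between the probability of going on and the mean width.
  have hcω : ∀ t, c t * ω ≤ 16 * S.guess t * (E / n) := by
    intro t
    have := hgp t
    calc c t * ω ≤ (16 * S.guess t / σ) * (E * σ / n) :=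
          mul_le_mul (min_le_right _ _) hω hω0 (by positivity)
      _ = _ := by field_simp
  -- one round of the sampling procedure
  have hround : ∀ t < r, ∫⁻ w, ρ t w * S.roundCost B U (S.sampleSize L (t + 1)) w ∂(seqLaw S.net) ≤
      B * ENNReal.ofReal (U + 1408 * (K * E)) := by
    intro t ht
    refine (S.lintegral_mul_roundCost_le (hρm t) (hρi t ht.le)).trans (mul_le_mul_right ?_ _)
    rw [← ENNReal.ofReal_natCast, ← ENNReal.ofReal_natCast, ← ENNReal.ofReal_mul (hc0 t),
      ← ENNReal.ofReal_mul (hc0 t), ← ENNReal.ofReal_mul (Nat.cast_nonneg _),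
      ← ENNReal.ofReal_add (mul_nonneg (hc0 t) (Nat.cast_nonneg _))
        (mul_nonneg (Nat.cast_nonneg _) (mul_nonneg (hc0 t) hω0))]
    refine ENNReal.ofReal_le_ofReal (add_le_add
      (mul_le_of_le_one_left (Nat.cast_nonneg _) (min_le_left _ _)) ?_)
    have h1 := sampleSize_le hA hd hL hΓ1 hΓ hΓn (i := t + 1) (by omega)
    have h2 := hgp (t + 1)
    have h3 : S.guess t = 2 * S.guess (t + 1) := by rw [guess_succ]; ring
    have h4 : S.guess (t + 1) ≤ 2 * n :=
      (guess_anti hA (Nat.zero_le _)).trans (guess_zero_le hA)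
    -- With x_t = 2x_{t+1}, the main term has the constant 42·16·2 = 1344. The + 1 from rounding
    -- adds at most 64E, since x_{t+1} ≤ 2n.
    calc (S.sampleSize L (t + 1) : ℝ) * (c t * ω)
        ≤ (42 * n * K / S.guess (t + 1) + 1) * (16 * S.guess t * (E / n)) :=
          mul_le_mul h1 (hcω t) (mul_nonneg (hc0 t) hω0) (by positivity)
      _ = 1344 * (K * E) + 32 * (S.guess (t + 1) / n) * E := by rw [h3]; field_simp; ring
      _ ≤ 1344 * (K * E) + 64 * E := by
          have : S.guess (t + 1) / n ≤ 2 := by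
            rw [div_le_iff₀ (by linarith)]
            exact h4
          nlinarith
      _ ≤ 1408 * (K * E) := by nlinarith
  -- the pointwise bound for the sampling procedure
  have hloop : ∀ w : ℕ → Sample n, ((S.samplingLoop L grad obj w r 1 []).time : ℝ≥0∞) ≤
      ∑ t ∈ Finset.range r, ρ t w * S.roundCost B U (S.sampleSize L (t + 1)) w := by
    intro w
    have := time_samplingLoop_le hA.sampleTime_le hA1 hU hgrad hobj (L := L) w (fun i => ρ i w) r 0
      (fun j h1 h2 hs => hρs j h1 (by omega) w hs) (hρ0 w).ge
    simp only [zero_add] at this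
    exact this
  -- the final number of RR sets
  have hfinal : ∀ w : ℕ → Sample n,
      ((S.thetaFinal α L (S.samplingLoop L grad obj w r 1 []).val : ℕ) : ℝ≥0∞) ≤
        ENNReal.ofReal (5184 * n * K) *
          (∑ t ∈ Finset.range r, ρ t w * ENNReal.ofReal (1 / S.guess (t + 1)) + ρ r w) + 1 := by
    intro w
    obtain ⟨h1, h2⟩ := val_samplingLoop hA (L := L) (grad := grad) (obj := obj) w (fun i => ρ i w) r 0
      (by omega) (fun j h1 h2 hs => hρs j h1 (by omega) w hs) (hρ0 w).ge
    change 1 ≤ (S.samplingLoop L grad obj w r 1 []).val at h1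
    change ENNReal.ofReal (1 / (S.samplingLoop L grad obj w r 1 []).val) ≤ _ at h2
    have h3 := thetaFinal_le hA hd hL hΓ1 hΓ hΓn hα1 hα2 h1
    rw [← ENNReal.ofReal_natCast]
    refine (ENNReal.ofReal_le_ofReal h3).trans ?_
    rw [ENNReal.ofReal_add (by positivity) zero_le_one, ENNReal.ofReal_one,
      ENNReal.ofReal_mul (by positivity)]
    refine add_le_add_left (mul_le_mul_right ?_ _) _
    simpa using h2
  have hone : ∀ M, ∫⁻ w, S.roundCost B U M w ∂(seqLaw S.net) ≤
      B * (U + M * ENNReal.ofReal ω) := by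
    intro M
    have := S.lintegral_mul_roundCost_le (B := B) (c := 1) (U := U) (M := M)
      (measurable_const (a := (1 : ℝ≥0∞))) (fun f j => by simp [lintegral_eval])
    simpa using this
  have hρint : ∀ t ≤ r, ∫⁻ w, ρ t w ∂(seqLaw S.net) ≤ ENNReal.ofReal (c t) := by
    intro t ht
    have := hρi t ht (fun _ => 1) 0
    simp only [mul_one, lintegral_const, measure_univ] at this
    exact this
  set D : (ℕ → Sample n) → ℝ≥0∞ := fun w =>
    ∑ t ∈ Finset.range r, ρ t w * ENNReal.ofReal (1 / S.guess (t + 1)) + ρ r w with hD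
  have hDm : Measurable D :=
    (Finset.measurable_sum _ fun t _ => (hρm t).mul_const _).add (hρm r)
  -- D dominates 1/LB. Each round contributes (16x_t/σ)/x_{t+1} = 32/σ, and the default LB = 1
  -- contributes 16·4/σ because the last guess is at most 4.
  have hDint : ∫⁻ w, D w ∂(seqLaw S.net) ≤ ENNReal.ofReal ((32 * r + 64) / σ) := by
    rw [hD, lintegral_add_right _ (hρm r), lintegral_finsetSum _ fun t _ => (hρm t).mul_const _]
    have h1 : ∀ t ∈ Finset.range r, ∫⁻ w, ρ t w * ENNReal.ofReal (1 / S.guess (t + 1))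
        ∂(seqLaw S.net) ≤ ENNReal.ofReal (32 / σ) := by
      intro t ht
      rw [lintegral_mul_const _ (hρm t)]
      refine (mul_le_mul_left (hρint t (Finset.mem_range.mp ht).le) _).trans ?_
      rw [← ENNReal.ofReal_mul (hc0 t)]
      refine ENNReal.ofReal_le_ofReal ?_
      have h2 := hgp (t + 1)
      have h3 : S.guess t = 2 * S.guess (t + 1) := by rw [guess_succ]; ring
      calc c t * (1 / S.guess (t + 1)) ≤ 16 * S.guess t / σ * (1 / S.guess (t + 1)) :=
            mul_le_mul_of_nonneg_right (min_le_right _ _) (by positivity)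
        _ = 32 / σ := by rw [h3]; field_simp; ring
    have h2 : ∫⁻ w, ρ r w ∂(seqLaw S.net) ≤ ENNReal.ofReal (64 / σ) := by
      refine (hρint r le_rfl).trans (ENNReal.ofReal_le_ofReal ((min_le_right _ _).trans ?_))
      have := guess_rounds_le hA
      gcongr
      linarith
    refine (add_le_add (Finset.sum_le_sum h1) h2).trans (le_of_eq ?_)
    rw [Finset.sum_const, Finset.card_range, nsmul_eq_mul, ← ENNReal.ofReal_natCast,
      ← ENNReal.ofReal_mul (Nat.cast_nonneg _), ← ENNReal.ofReal_add (by positivity) (by positivity)]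
    congr 1
    ring
  have hrcm : ∀ M, Measurable (S.roundCost B U M) := by
    intro M
    unfold roundCost
    simp only [totalWidth_sampleList]
    push_cast
    refine Measurable.const_mul (Measurable.const_add (Finset.measurable_sum _ fun j _ => ?_) _) _
    exact (Measurable.of_discrete (f := fun s => (S.net.width (S.rr s) : ℝ≥0∞))).comp
      (measurable_pi_apply j)
  have htape : tapeLaw S.net = (seqLaw S.net).prod (seqLaw S.net) := rfl
  rw [htape]
  -- Only the inequality half of Tonelli's theorem is used, which needs no measurability of the
  -- running time; all the bounds that follow are measurable.
  calc ∫⁻ w, ((S.gradRIS α L grad obj w).time : ℝ≥0∞) ∂((seqLaw S.net).prod (seqLaw S.net))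
      ≤ ∫⁻ w₁, ∫⁻ w₂, ((S.gradRIS α L grad obj (w₁, w₂)).time : ℝ≥0∞) ∂(seqLaw S.net)
          ∂(seqLaw S.net) := lintegral_prod_le _
    _ ≤ ∫⁻ w₁, (∑ t ∈ Finset.range r, ρ t w₁ * S.roundCost B U (S.sampleSize L (t + 1)) w₁ +
          B * (U + (ENNReal.ofReal (5184 * n * K) * D w₁ + 1) * ENNReal.ofReal ω))
          ∂(seqLaw S.net) := by
        refine lintegral_mono fun w₁ => ?_
        calc ∫⁻ w₂, ((S.gradRIS α L grad obj (w₁, w₂)).time : ℝ≥0∞) ∂(seqLaw S.net)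
            ≤ ∫⁻ w₂, (∑ t ∈ Finset.range r, ρ t w₁ * S.roundCost B U (S.sampleSize L (t + 1)) w₁ +
                S.roundCost B U (S.thetaFinal α L (S.samplingLoop L grad obj w₁ r 1 []).val) w₂)
                ∂(seqLaw S.net) := by
              refine lintegral_mono fun w₂ => ?_
              exact (time_gradRIS_le hA.sampleTime_le hA1 hU hgrad hobj (w₁, w₂)).trans
                (add_le_add_left (hloop w₁) _)
          _ ≤ _ := by
              rw [lintegral_add_left measurable_const, lintegral_const, measure_univ, mul_one]
              refine add_le_add_right ((hone _).trans (mul_le_mul_right ?_ _)) _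
              exact add_le_add_right (mul_le_mul_left (hfinal w₁) _) _
    _ = ∑ t ∈ Finset.range r, ∫⁻ w, ρ t w * S.roundCost B U (S.sampleSize L (t + 1)) w
          ∂(seqLaw S.net) + B * (U + (ENNReal.ofReal (5184 * n * K) * ∫⁻ w, D w ∂(seqLaw S.net) + 1) *
            ENNReal.ofReal ω) := by
        have hm : ∀ t ∈ Finset.range r, Measurable fun w =>
            ρ t w * S.roundCost B U (S.sampleSize L (t + 1)) w := fun t _ => (hρm t).mul (hrcm _)
        have h1 : Measurable fun w => ENNReal.ofReal (5184 * n * K) * D w := hDm.const_mul _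
        have h2 : Measurable fun w => (ENNReal.ofReal (5184 * n * K) * D w + 1) * ENNReal.ofReal ω :=
          (h1.add_const _).mul_const _
        rw [lintegral_add_left (Finset.measurable_sum _ hm), lintegral_finsetSum _ hm,
          lintegral_const_mul _ (h2.const_add _), lintegral_add_left measurable_const,
          lintegral_mul_const _ (h1.add_const _), lintegral_add_left h1,
          lintegral_const_mul _ hDm]
        simp
    _ ≤ ∑ t ∈ Finset.range r, B * ENNReal.ofReal (U + 1408 * (K * E)) +
          B * ENNReal.ofReal (U + (5184 * n * K * ((32 * r + 64) / σ) + 1) * ω) := by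
        refine add_le_add (Finset.sum_le_sum fun t ht => hround t (Finset.mem_range.mp ht))
          (mul_le_mul_right ?_ _)
        have e : ENNReal.ofReal (U + (5184 * n * K * ((32 * r + 64) / σ) + 1) * ω) =
            U + (ENNReal.ofReal (5184 * n * K) * ENNReal.ofReal ((32 * r + 64) / σ) + 1) *
              ENNReal.ofReal ω := by
          rw [← ENNReal.ofReal_mul (by positivity), ← ENNReal.ofReal_one,
            ← ENNReal.ofReal_add (by positivity) zero_le_one, ← ENNReal.ofReal_mul (by positivity),
            ← ENNReal.ofReal_natCast U,
            ← ENNReal.ofReal_add (Nat.cast_nonneg _) (by positivity)]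
        rw [e]
        gcongr
    _ = B * ENNReal.ofReal (r * (U + 1408 * (K * E)) +
          (U + (5184 * n * K * ((32 * r + 64) / σ) + 1) * ω)) := by
        have e : ∀ x y : ℝ, 0 ≤ x → 0 ≤ y → ENNReal.ofReal (r * x + y) =
            r * ENNReal.ofReal x + ENNReal.ofReal y := fun x y hx hy => by
          rw [ENNReal.ofReal_add (by positivity) hy, ENNReal.ofReal_mul (Nat.cast_nonneg _),
            ENNReal.ofReal_natCast]
        rw [Finset.sum_const, Finset.card_range, nsmul_eq_mul, e _ _ (by positivity)
          (by positivity)]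
        ring
    _ ≤ B * ENNReal.ofReal ((r + 2) * (U + 200000 * (K * E))) := by
        refine mul_le_mul_right (ENNReal.ofReal_le_ofReal ?_) _
        have hr0 : (0 : ℝ) ≤ r := Nat.cast_nonneg _
        have hU0 : (0 : ℝ) ≤ U := Nat.cast_nonneg _
        have h1 : (5184 * n * K * ((32 * r + 64) / σ) + 1) * ω ≤
            (5184 * n * K * ((32 * r + 64) / σ) + 1) * (E * σ / n) :=
          mul_le_mul_of_nonneg_left hω (by positivity)
        -- Again σ cancels, now between 1/LB and the mean width; 165888 = 5184·32.
        have h2 : (5184 * n * K * ((32 * r + 64) / σ) + 1) * (E * σ / n) =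
            165888 * (K * E) * (r + 2) + E * (σ / n) := by field_simp; ring
        have h3 : E * (σ / n) ≤ K * E := by
          have : σ / n ≤ 1 := (div_le_one (by linarith)).mpr hσn
          nlinarith
        have h4 : 0 ≤ K * E := by positivity
        nlinarith [mul_nonneg hr0 h4]

end Setting

namespace Setting

variable {S : Setting n d} {a : ℕ} {h : Fin n → Mix d → ℝ}

/-! ## The polylogarithmic factors -/

theorem costLip_le_sqrt (c : CostNorm) (hd : 1 ≤ d) : costLip c d ≤ √(d : ℝ) := by
  cases c
  · exact le_rfl
  · exact Real.one_le_sqrt.mpr (by exact_mod_cast hd)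

theorem one_le_costLip (c : CostNorm) (hd : 1 ≤ d) : 1 ≤ costLip c d := by
  cases c
  · exact Real.one_le_sqrt.mpr (by exact_mod_cast hd)
  · exact le_rfl

theorem clog_two_add_one_le (hd : 1 ≤ d) : (Nat.clog 2 d : ℝ) + 1 ≤ 2 * Real.log d + 2 := by
  have hlog : 0 ≤ Real.log d := Real.log_nonneg (by exact_mod_cast hd)
  have h1 : (Nat.clog 2 d : ℝ) ≤ Real.logb 2 d + 1 := by
    have h := Real.ceil_logb_natCast (b := 2) (r := (d : ℝ)) (Nat.cast_nonneg d)
    rw [Int.clog_natCast] at h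
    have h2 := Int.ceil_lt_add_one (Real.logb (2 : ℕ) (d : ℝ))
    rw [h] at h2
    exact_mod_cast h2.le
  have h2 : Real.logb 2 d ≤ 2 * Real.log d := by
    rw [Real.logb, div_le_iff₀ (Real.log_pos one_lt_two)]
    nlinarith [Real.log_two_gt_d9]
  linarith

/-- The expected running time of `Grad-RIS`, when the gradient algorithm makes at most `I`
iterations. -/
theorem lintegral_time_gradRIS_le_log [NeZero n] (hA : S.Admissible a h) (hd : 1 ≤ d)
    (hmem : ∀ v, ∀ x ∈ orthant d, h v x ∈ Set.Icc (0 : ℝ) 1) {L Δ α Z I : ℝ} {T : ℕ} (hL : 0 ≤ L)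
    (hΔ : 0 ≤ Δ) (hZ : 2 + n + d + 1 / S.ε ≤ Z)
    (hZL : 2 + 6 * √(d : ℝ) * S.k * L / S.ε ≤ (8 + 6 * Δ) * Z ^ 6)
    (hα1 : 1 / 2 ≤ α) (hα2 : α ≤ 2 / 3) (hT : 1 ≤ T)
    {grad : List (RRSet n) → Timed (Mix d)} {obj : List (RRSet n) → Mix d → Timed ℝ}
    {N : List (RRSet n) → ℕ} (hN : ∀ R, S.IsRR R → (N R : ℝ) + 1 ≤ I)
    (hgrad : ∀ R, S.IsRR R →
      (grad R).time ≤ (N R + 1) * (40 * (unitCost n d T + S.totalWidth R)))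
    (hobj : ∀ R x, S.IsRR R → (obj R x).time ≤ 9 * (unitCost n d T + S.totalWidth R))
    (hspec : ∀ R, S.IsRR R → R ≠ [] → ∀ u ∈ S.P,
      1 / 2 * hatG (fun v => h v u) R - 1 / 3 ≤ (obj R (grad R).val).val) :
    ∫⁻ w, ((S.gradRIS α L grad obj w).time : ℝ≥0∞) ∂(tapeLaw S.net) ≤
      ENNReal.ofReal ((a + 6) * 40 * 800016 * (14 + 6 * Δ) ^ 2 *
        (I * (T * ((S.edges : ℝ) + n) * (d + S.ℓ) / S.ε ^ 2)) * Real.log Z ^ 2) := by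
  have hn := hA.natCast_pos
  have hε := hA.ε_pos
  have hε1 := hA.ε_lt_one
  have hℓ := hA.ℓ_pos
  have hdR : (1 : ℝ) ≤ d := by exact_mod_cast hd
  have hTR : (1 : ℝ) ≤ T := by exact_mod_cast hT
  have hk := hA.k_nonneg
  have hεinv : 1 ≤ 1 / S.ε := (one_le_div hε).mpr hε1.le
  have hI : 1 ≤ I := by
    have := hN [] (fun r hr => by simp at hr)
    linarith [(Nat.cast_nonneg (N []) : (0 : ℝ) ≤ N [])]
  set Λ := Real.log Z with hΛ
  have hΛ1 : 1 ≤ Λ := by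
    rw [hΛ, Real.le_log_iff_exp_le (by linarith)]
    linarith [Real.exp_one_lt_d9]
  -- Since ln y ≤ y − 1 and Λ ≥ 1, the logarithm of (8 + 6Δ)Z⁶ is at most (7 + 6Δ) + 6Λ ≤ Γ.
  set Γ := (14 + 6 * Δ) * Λ with hΓdef
  have hΓΛ : Λ ≤ Γ := by rw [hΓdef]; nlinarith
  have hΓ2Λ : 2 * Λ ≤ Γ := by rw [hΓdef]; nlinarith
  have hΓ1 : 1 ≤ Γ := hΛ1.trans hΓΛ
  have hΓ : Real.log (2 + 6 * √(d : ℝ) * S.k * L / S.ε) ≤ Γ := by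
    refine (Real.log_le_log (by positivity) hZL).trans ?_
    rw [Real.log_mul (by positivity) (by have : 0 < Z := by linarith
                                         positivity), Real.log_pow]
    have := Real.log_le_sub_one_of_pos (by positivity : 0 < 8 + 6 * Δ)
    push_cast
    rw [hΓdef, ← hΛ]
    nlinarith
  have hΓn : Real.log (2 * n) ≤ Γ := by
    refine le_trans ?_ hΓ2Λ
    rw [Real.log_mul two_ne_zero (by linarith), hΛ]
    have h1 := Real.log_le_log two_pos (by linarith : (2 : ℝ) ≤ Z)
    have h2 := Real.log_le_log (by linarith : (0 : ℝ) < n) (by linarith : (n : ℝ) ≤ Z)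
    linarith
  have key := lintegral_time_gradRIS_le hA hd hmem (A := ENNReal.ofReal (40 * I))
    (U := unitCost n d T) hL hΓ1 hΓ hΓn hα1 hα2
    (by rw [ENNReal.one_le_ofReal]; linarith) (le_unitCost hd hT).1
    (grad := grad) (obj := obj)
    (fun R hR => by
      rw [← ENNReal.ofReal_natCast, ← ENNReal.ofReal_natCast, ← ENNReal.ofReal_mul (by positivity)]
      refine ENNReal.ofReal_le_ofReal ?_
      have h1 : ((grad R).time : ℝ) ≤
          ((N R : ℝ) + 1) * (40 * ((unitCost n d T + S.totalWidth R : ℕ) : ℝ)) := by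
        exact_mod_cast hgrad R hR
      refine h1.trans ?_
      have h2 := mul_le_mul_of_nonneg_right (hN R hR)
        (by positivity : (0 : ℝ) ≤ 40 * ((unitCost n d T + S.totalWidth R : ℕ) : ℝ))
      linarith)
    (fun R x hR => by
      rw [← ENNReal.ofReal_natCast, ← ENNReal.ofReal_natCast, ← ENNReal.ofReal_mul (by positivity)]
      refine ENNReal.ofReal_le_ofReal ?_
      have h1 : ((obj R x).time : ℝ) ≤ 9 * ((unitCost n d T + S.totalWidth R : ℕ) : ℝ) := by
        exact_mod_cast hobj R x hR
      refine h1.trans (mul_le_mul_of_nonneg_right ?_ (Nat.cast_nonneg _))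
      linarith) hspec
  refine key.trans ?_
  have e : ((a : ℝ≥0∞) + 6) = ENNReal.ofReal (a + 6) := by
    rw [ENNReal.ofReal_add (by positivity) (by positivity), ENNReal.ofReal_natCast,
      ENNReal.ofReal_ofNat]
  rw [e, ← ENNReal.ofReal_mul (by positivity), ← ENNReal.ofReal_mul (by positivity)]
  refine ENNReal.ofReal_le_ofReal ?_
  have hE : (n : ℝ) ≤ (S.edges : ℝ) + n := le_add_of_nonneg_left (Nat.cast_nonneg _)
  set E : ℝ := (S.edges : ℝ) + n
  set W : ℝ := T * E * (d + S.ℓ) / S.ε ^ 2 with hW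
  have hW0 : 0 ≤ W := by positivity
  have hε2 : S.ε ^ 2 ≤ 1 := pow_le_one₀ hε.le hε1.le
  have hU : (unitCost n d T : ℝ) ≤ 4 * Γ * W := by
    have h1 : (n * d * T : ℝ) ≤ W := by
      rw [hW, le_div_iff₀ (by positivity)]
      calc (n * d * T : ℝ) * S.ε ^ 2 ≤ n * d * T * 1 := by gcongr
        _ = T * n * d := by ring
        _ ≤ T * E * (d + S.ℓ) := by
          gcongr
          linarith
    have h2 := clog_two_add_one_le hd
    have h3 : Real.log d ≤ Λ := Real.log_le_log (by linarith) (by linarith)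
    rw [unitCost]
    push_cast
    rw [mul_comm]
    exact mul_le_mul (by linarith) h1 (by positivity) (by positivity)
  have hV : Γ * (d + S.ℓ) / S.ε ^ 2 * E ≤ Γ * W := by
    rw [hW, mul_div_assoc, mul_assoc]
    refine mul_le_mul_of_nonneg_left ?_ (by linarith)
    rw [div_mul_eq_mul_div]
    refine div_le_div_of_nonneg_right ?_ (by positivity)
    have : 0 ≤ (d + S.ℓ) * E := by positivity
    nlinarith
  have hr := rounds_le hA hΓn
  -- The number of rounds plus 2 is at most 4Γ, and `unitCost` adds 4ΓW to 200000ΓW. So two factors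
  -- Γ, and with them ln² Z, appear.
  calc ((a : ℝ) + 6) * (40 * I) * ((S.rounds + 2) *
        (unitCost n d T + 200000 * (Γ * (d + S.ℓ) / S.ε ^ 2 * E)))
      ≤ ((a : ℝ) + 6) * (40 * I) * ((4 * Γ) * (200004 * (Γ * W))) := by
        have : 0 ≤ Γ * (d + S.ℓ) / S.ε ^ 2 * E := by positivity
        refine mul_le_mul_of_nonneg_left (mul_le_mul ?_ ?_ ?_ ?_) ?_
        · linarith
        · linarith
        all_goals positivity
    _ = _ := by rw [hΓdef]; ring

end Setting

/-! ## Positivity of the constants -/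

theorem exists_mem_orthant_norm_sub (hd : 1 ≤ d) :
    ∃ x ∈ orthant d, ∃ y ∈ orthant d, ‖x - y‖ = 1 := by
  refine ⟨EuclideanSpace.single ⟨0, hd⟩ 1, fun i => ?_, 0, fun i => by simp, by simp⟩
  rw [PiLp.single_apply]
  split_ifs <;> norm_num

theorem IsLipschitz.nonneg {L : ℝ} {f : Mix d → ℝ} (hf : IsLipschitz L f) (hd : 1 ≤ d) : 0 ≤ L := by
  obtain ⟨x, hx, y, hy, hxy⟩ := exists_mem_orthant_norm_sub hd
  have := hf x hx y hy
  rw [hxy, mul_one] at this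
  exact (abs_nonneg _).trans this

theorem IsSmooth.nonneg {β : ℝ} {f : Mix d → ℝ} {f' : Mix d → Mix d} (hf : IsSmooth β f f')
    (hd : 1 ≤ d) : 0 ≤ β := by
  obtain ⟨x, hx, y, hy, hxy⟩ := exists_mem_orthant_norm_sub hd
  have := hf.2 x hx y hy
  rw [hxy, mul_one] at this
  exact (norm_nonneg _).trans this

/-! ### The two running time bounds -/

namespace Setting

variable {S : Setting n d} {a : ℕ}

/-- The argument of the logarithm must be polynomial in Z. The budget is at most the diameter, and λ
enters only through λk ≤ n, so no bound on λ itself is needed here. -/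
theorem cost_scale_le [NeZero n] {h : Fin n → Mix d → ℝ} (hA : S.Admissible a h) (hd : 1 ≤ d)
    {M Δ Z : ℝ} (hM : 0 ≤ M) (hΔ : S.diam ≤ Δ) (hZ : 2 + n + d + 1 / S.ε ≤ Z) (hMZ : M ≤ Z ^ 4) :
    2 + 6 * √(d : ℝ) * S.k * (M + S.lam * costLip S.costNorm d) / S.ε ≤ (8 + 6 * Δ) * Z ^ 6 := by
  have hn := hA.natCast_pos
  have hε := hA.ε_pos
  have hdR : (1 : ℝ) ≤ d := by exact_mod_cast hd
  have hεinv : 0 < 1 / S.ε := by positivity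
  have hk := hA.k_nonneg
  have hkΔ := (hA.k_le_diam hd).trans hΔ
  have hZ1 : 1 ≤ Z := by linarith
  have hsq : √(d : ℝ) ≤ Z := (Real.sqrt_le_iff.mpr ⟨by linarith, by nlinarith⟩ : √(d : ℝ) ≤ d).trans (by linarith)
  have hc := (costLip_le_sqrt S.costNorm hd).trans hsq
  have hc0 := zero_le_one.trans (one_le_costLip S.costNorm hd)
  have hlk : S.lam * S.k ≤ Z := hA.lam_mul_k_le.trans (by linarith)
  have hlk0 := mul_nonneg hA.lam_nonneg hk
  have hΔ0 : 0 ≤ Δ := hk.trans hkΔ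
  have h1 : S.k * (M + S.lam * costLip S.costNorm d) ≤ Δ * Z ^ 4 + Z ^ 4 := by
    calc S.k * (M + S.lam * costLip S.costNorm d)
        = S.k * M + S.lam * S.k * costLip S.costNorm d := by ring
      _ ≤ Δ * Z ^ 4 + Z * Z := by gcongr
      _ ≤ Δ * Z ^ 4 + Z ^ 4 := by
        have : Z ^ 2 ≤ Z ^ 4 := pow_le_pow_right₀ hZ1 (by norm_num)
        nlinarith
  have h2 : 1 ≤ Z ^ 6 := one_le_pow₀ hZ1
  calc 2 + 6 * √(d : ℝ) * S.k * (M + S.lam * costLip S.costNorm d) / S.ε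
      = 2 + 6 * √(d : ℝ) * (S.k * (M + S.lam * costLip S.costNorm d)) * (1 / S.ε) := by ring
    _ ≤ 2 + 6 * Z * (Δ * Z ^ 4 + Z ^ 4) * Z := by
      have h0 : 0 ≤ S.k * (M + S.lam * costLip S.costNorm d) :=
        mul_nonneg hk (add_nonneg hM (mul_nonneg hA.lam_nonneg hc0))
      gcongr
      linarith
    _ = 2 + (6 + 6 * Δ) * Z ^ 6 := by ring
    _ ≤ (8 + 6 * Δ) * Z ^ 6 := by linarith

/-- The expected running time of `ProxGrad-RIS`. -/
theorem lintegral_time_proxGradRIS_le [NeZero n] (hd : 1 ≤ d) {h : Fin n → Mix d → ℝ}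
    {h' : Fin n → Mix d → Mix d} {Lh βh Δ : ℝ} {Th : ℕ} (hA : S.Admissible a h) (hΔ : S.diam ≤ Δ)
    (hT : 1 ≤ Th) (hmem : ∀ v, ∀ x ∈ orthant d, h v x ∈ Set.Icc (0 : ℝ) 1)
    (hmono : ∀ v, IsMonotone (h v)) (hdr : ∀ v, IsDRSubmodular (h v))
    (hlip : ∀ v, IsLipschitz Lh (h v)) (hsm : ∀ v, IsSmooth βh (h v) (h' v))
    (hε : S.ε ≤ βh * (n : ℝ) ^ 2 + Lh ^ 2 * (n : ℝ) ^ 3) :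
    ∫⁻ w, ((S.proxGradRIS h h' Lh βh Th w).time : ℝ≥0∞) ∂(tapeLaw S.net) ≤
      ENNReal.ofReal ((a + 6) * 40 * 800016 * (14 + 6 * Δ) ^ 2 * (Δ ^ 2 + 2) *
        ((βh * (n : ℝ) ^ 2 + Lh ^ 2 * (n : ℝ) ^ 3) / S.ε *
          (Th * ((S.edges : ℝ) + n) * (d + S.ℓ) / S.ε ^ 2)) *
        Real.log (2 + n + d + 1 / S.ε + Lh) ^ 2) := by
  have hn := hA.natCast_pos
  have hε0 := hA.ε_pos
  have v₀ : Fin n := ⟨0, Nat.pos_of_ne_zero (NeZero.ne n)⟩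
  have hL := (hlip v₀).nonneg hd
  have hβ := (hsm v₀).nonneg hd
  have hΔ1 := hA.diam_nonneg
  -- Ensures β > 0, so that the step size 1/β is genuine.
  have hpos : 0 < βh ∨ 0 < Lh := by
    by_contra! hc
    have h1 : βh = 0 := le_antisymm hc.1 hβ
    have h2 : Lh = 0 := le_antisymm hc.2 hL
    rw [h1, h2] at hε
    norm_num at hε
    linarith
  have hh : ActivationSmooth h h' Lh βh := ⟨hmem, hmono, hdr, hlip, hsm, hL⟩
  have hεinv : 0 < 1 / S.ε := by positivity
  have hdR : (0 : ℝ) ≤ d := Nat.cast_nonneg _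
  set Z := 2 + n + d + 1 / S.ε + Lh with hZ
  set B := βh * (n : ℝ) ^ 2 + Lh ^ 2 * (n : ℝ) ^ 3 with hB
  have hB1 : 1 ≤ B / S.ε := (one_le_div hε0).mpr hε
  have hM : (n : ℝ) ^ 2 * Lh ≤ Z ^ 4 := by
    calc (n : ℝ) ^ 2 * Lh ≤ Z ^ 2 * Z := by gcongr <;> linarith
      _ = Z ^ 3 := by ring
      _ ≤ Z ^ 4 := pow_le_pow_right₀ (by linarith) (by norm_num)
  -- The iteration count obeys ⌈·⌉ + 1 ≤ Δ²B/ε + 2, and the 2 is absorbed because B/ε ≥ 1.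
  have key := lintegral_time_gradRIS_le_log hA hd hmem (Δ := Δ) (Z := Z)
    (I := (Δ ^ 2 + 2) * (B / S.ε)) (L := (n : ℝ) ^ 2 * Lh + S.lam * costLip S.costNorm d) (α := 1 / 2)
    (add_nonneg (by positivity) (mul_nonneg hA.lam_nonneg
      (zero_le_one.trans (one_le_costLip S.costNorm hd))))
    (hΔ1.trans hΔ) (by linarith) (cost_scale_le hA hd (by positivity) hΔ (by linarith) hM)
    le_rfl (by norm_num) hT
    (grad := S.proxGrad h h' Lh βh Th) (obj := S.objProx h Th)
    (N := fun R => ⌈3 * ((moment 1 R).val * n * βh +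
      (moment 2 R).val * n * Lh ^ 2) * S.diam ^ 2 / (4 * S.ε)⌉₊)
    (fun R hR => by
      have m1 := moment_le 1 hR
      have m2 := moment_le 2 hR
      have m10 := moment_nonneg 1 R
      have m20 := moment_nonneg 2 R
      have hb : (moment 1 R).val * n * βh + (moment 2 R).val * n * Lh ^ 2 ≤ B := by
        calc _ ≤ (n : ℝ) ^ 1 * n * βh + (n : ℝ) ^ 2 * n * Lh ^ 2 := by gcongr
          _ = B := by rw [hB]; ring
      have hx : 3 * ((moment 1 R).val * n * βh + (moment 2 R).val * n * Lh ^ 2) * S.diam ^ 2 /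
          (4 * S.ε) ≤ Δ ^ 2 * (B / S.ε) := by
        calc _ ≤ 3 * B * Δ ^ 2 / (4 * S.ε) := by gcongr
          _ = 3 / 4 * (Δ ^ 2 * (B / S.ε)) := by field_simp
          _ ≤ Δ ^ 2 * (B / S.ε) := by
            have : 0 ≤ Δ ^ 2 * (B / S.ε) := by positivity
            linarith
      have := Nat.ceil_lt_add_one (by positivity : 0 ≤ 3 * ((moment 1 R).val * n * βh +
        (moment 2 R).val * n * Lh ^ 2) * S.diam ^ 2 / (4 * S.ε))
      nlinarith)
    (fun R hR => S.time_proxGrad_le hd hT hR)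
    (fun R x hR => (S.time_objProx_le hd hT hR x).trans
      (Nat.mul_le_mul_right _ (by norm_num)))
    (fun R hR h0 u hu => proxGrad_spec hA hh hβ hpos Th hR h0 hu)
  refine key.trans (le_of_eq ?_)
  congr 1
  ring

/-- The expected running time of `UpperGrad-RIS`. -/
theorem lintegral_time_upperGradRIS_le [NeZero n] (hd : 1 ≤ d) {q q' : Fin n → Fin d → ℝ → ℝ}
    {Lq Δ Λ : ℝ} {Tq : ℕ} (hA : S.Admissible a (independentActivation q)) (hΔ : S.diam ≤ Δ)
    (hΛ : S.lam ≤ Λ) (hT : 1 ≤ Tq) (hq : ActivationConcave q q' Lq)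
    (hL : costLip S.costNorm d ≤ (n : ℝ) ^ 2 * √(d : ℝ) * Lq) :
    ∫⁻ w, ((S.upperGradRIS q q' Lq Tq w).time : ℝ≥0∞) ∂(tapeLaw S.net) ≤
      ENNReal.ofReal ((a + 6) * 40 * 800016 * (14 + 6 * Δ) ^ 2 * (9 * Δ ^ 2 * (1 + Λ) ^ 2 + 2) *
        ((n : ℝ) ^ 4 * d * Lq ^ 2 / S.ε ^ 2 *
          (Tq * ((S.edges : ℝ) + n) * (d + S.ℓ) / S.ε ^ 2)) *
        Real.log (2 + n + d + 1 / S.ε + Lq) ^ 2) := by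
  have hn := hA.natCast_pos
  have hε0 := hA.ε_pos
  have hΔ1 := hA.diam_nonneg
  have hlam := hA.lam_nonneg
  have hΔ0 := hΔ1.trans hΔ
  have hΛ0 := hlam.trans hΛ
  have hdR : (1 : ℝ) ≤ d := by exact_mod_cast hd
  have hc1 := one_le_costLip S.costNorm hd
  have hM1 := hc1.trans hL
  have hLq : 0 < Lq := by
    by_contra! hc
    have : (n : ℝ) ^ 2 * √(d : ℝ) * Lq ≤ 0 := mul_nonpos_of_nonneg_of_nonpos (by positivity) hc
    linarith
  have hεinv : 0 < 1 / S.ε := by positivity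
  set Z := 2 + n + d + 1 / S.ε + Lq with hZ
  set B := (n : ℝ) ^ 2 * √(d : ℝ) * Lq with hB
  have hB2 : (n : ℝ) ^ 4 * d * Lq ^ 2 = B ^ 2 := by
    rw [hB, mul_pow, mul_pow, Real.sq_sqrt (by linarith)]
    ring
  have hBε : 1 ≤ B ^ 2 / S.ε ^ 2 := by
    rw [one_le_div (by positivity)]
    exact pow_le_pow_left₀ hε0.le (hA.ε_lt_one.le.trans hM1) 2
  have hM : B ≤ Z ^ 4 := by
    have hsq : √(d : ℝ) ≤ Z := (Real.sqrt_le_iff.mpr ⟨by linarith, by nlinarith⟩ : √(d : ℝ) ≤ d).trans (by linarith)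
    calc B ≤ Z ^ 2 * Z * Z := by rw [hB]; gcongr <;> linarith
      _ = Z ^ 4 := by ring
  -- Places α = 1 − 1/e between 1/2 and 2/3.
  have hexp : 1 / 3 ≤ 1 / Real.exp 1 ∧ 1 / Real.exp 1 ≤ 1 / 2 := by
    have h1 := Real.exp_one_gt_d9
    have h2 := Real.exp_one_lt_d9
    constructor <;> exact one_div_le_one_div_of_le (by linarith) (by linarith)
  have key := lintegral_time_gradRIS_le_log hA hd (fun v x hx => hq.independentActivation_mem v hx)
    (Δ := Δ) (Z := Z)
    (I := (9 * Δ ^ 2 * (1 + Λ) ^ 2 + 2) * (B ^ 2 / S.ε ^ 2))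
    (L := B + S.lam * costLip S.costNorm d) (α := 1 - 1 / Real.exp 1)
    (add_nonneg (by positivity) (mul_nonneg hlam (zero_le_one.trans hc1)))
    (hΔ1.trans hΔ) (by linarith) (cost_scale_le hA hd (by positivity) hΔ (by linarith) hM)
    (by linarith) (by linarith) hT
    (grad := S.upperGrad q q' Lq Tq) (obj := S.objUpper q Tq)
    (N := fun R => ⌈9 * (S.diam * ((moment 1 R).val * n * √(d : ℝ) * Lq +
      S.lam * costLip S.costNorm d)) ^ 2 / S.ε ^ 2⌉₊)
    (fun R hR => by
      have m1 := moment_le 1 hR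
      have m10 := moment_nonneg 1 R
      have hb : (moment 1 R).val * n * √(d : ℝ) * Lq + S.lam * costLip S.costNorm d ≤
          (1 + Λ) * B := by
        -- The cost term is absorbed using L_c ≤ B; this is where the bound Λ on λ enters.
        calc _ ≤ (n : ℝ) ^ 1 * n * √(d : ℝ) * Lq + Λ * B := by gcongr
          _ = (1 + Λ) * B := by rw [hB]; ring
      have hx : 9 * (S.diam * ((moment 1 R).val * n * √(d : ℝ) * Lq +
          S.lam * costLip S.costNorm d)) ^ 2 / S.ε ^ 2 ≤
          9 * Δ ^ 2 * (1 + Λ) ^ 2 * (B ^ 2 / S.ε ^ 2) := by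
        calc _ ≤ 9 * (Δ * ((1 + Λ) * B)) ^ 2 / S.ε ^ 2 := by gcongr
          _ = _ := by ring
      have := Nat.ceil_lt_add_one (by positivity : 0 ≤ 9 * (S.diam * ((moment 1 R).val * n *
        √(d : ℝ) * Lq + S.lam * costLip S.costNorm d)) ^ 2 / S.ε ^ 2)
      nlinarith)
    (fun R hR => S.time_upperGrad_le hd hT hR)
    (fun R x hR => S.time_objUpper_le hd hT hR x)
    (fun R hR h0 u hu => upperGrad_spec hA hq hLq hd Tq hR h0 hu)
  refine key.trans (le_of_eq ?_)
  rw [hB2]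
  congr 1
  ring

end Setting

end CIM

end

theorem theorem5 :
    -- ProxGrad-RIS
    (∀ (a : ℕ) (Δ : ℝ), ∃ (C : ℝ) (p : ℕ), ∀ (n d : ℕ) [NeZero n], 1 ≤ d →
      ∀ (S : CIM.Setting n d) (h : Fin n → CIM.Mix d → ℝ) (h' : Fin n → CIM.Mix d → CIM.Mix d)
        (Lh βh : ℝ) (Th : ℕ),
      S.Admissible a h → S.diam ≤ Δ → 1 ≤ Th →
      (∀ v, ∀ x ∈ CIM.orthant d, h v x ∈ Set.Icc (0 : ℝ) 1) →
      (∀ v, CIM.IsMonotone (h v)) → (∀ v, CIM.IsDRSubmodular (h v)) →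
      (∀ v, CIM.IsLipschitz Lh (h v)) → (∀ v, CIM.IsSmooth βh (h v) (h' v)) →
      S.ε ≤ βh * (n : ℝ) ^ 2 + Lh ^ 2 * (n : ℝ) ^ 3 →
      ∫⁻ w, ((S.proxGradRIS h h' Lh βh Th w).time : ℝ≥0∞) ∂(CIM.tapeLaw S.net) ≤
        ENNReal.ofReal (C *
          ((βh * (n : ℝ) ^ 2 + Lh ^ 2 * (n : ℝ) ^ 3) / S.ε *
            (Th * ((S.edges : ℝ) + n) * (d + S.ℓ) / S.ε ^ 2)) *
          Real.log (2 + n + d + 1 / S.ε + Lh) ^ p)) ∧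
    -- UpperGrad-RIS under independent strategy activation
    (∀ (a : ℕ) (Δ Λ : ℝ), ∃ (C : ℝ) (p : ℕ), ∀ (n d : ℕ) [NeZero n], 1 ≤ d →
      ∀ (S : CIM.Setting n d) (q q' : Fin n → Fin d → ℝ → ℝ) (Lq : ℝ) (Tq : ℕ),
      S.Admissible a (CIM.independentActivation q) → S.diam ≤ Δ → S.lam ≤ Λ → 1 ≤ Tq →
      (∀ v j, ∀ t ∈ Set.Ici (0 : ℝ), q v j t ∈ Set.Icc (0 : ℝ) 1) →
      (∀ v j, MonotoneOn (q v j) (Set.Ici 0)) → (∀ v j, ConcaveOn ℝ (Set.Ici 0) (q v j)) →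
      (∀ v j, ∀ t ∈ Set.Ici (0 : ℝ), ∀ u ∈ Set.Ici (0 : ℝ),
        |q v j t - q v j u| ≤ Lq * |t - u|) →
      (∀ v j, ∀ t ∈ Set.Ici (0 : ℝ), HasDerivWithinAt (q v j) (q' v j t) (Set.Ici 0) t) →
      CIM.costLip S.costNorm d ≤ (n : ℝ) ^ 2 * √(d : ℝ) * Lq →
      ∫⁻ w, ((S.upperGradRIS q q' Lq Tq w).time : ℝ≥0∞) ∂(CIM.tapeLaw S.net) ≤
        ENNReal.ofReal (C *
          ((n : ℝ) ^ 4 * d * Lq ^ 2 / S.ε ^ 2 *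
            (Tq * ((S.edges : ℝ) + n) * (d + S.ℓ) / S.ε ^ 2)) *
          Real.log (2 + n + d + 1 / S.ε + Lq) ^ p)) := by
  -- The exponent 2 counts one logarithm for the rounds and one for the numbers of RR sets or the
  -- sorting in a proximal step.
  refine ⟨fun a Δ => ⟨(a + 6) * 40 * 800016 * (14 + 6 * Δ) ^ 2 * (Δ ^ 2 + 2), 2, ?_⟩,
    fun a Δ Λ => ⟨(a + 6) * 40 * 800016 * (14 + 6 * Δ) ^ 2 * (9 * Δ ^ 2 * (1 + Λ) ^ 2 + 2), 2, ?_⟩⟩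
  · intro n d _ hd S h h' Lh βh Th hA hΔ hT hmem hmono hdr hlip hsm hε
    exact CIM.Setting.lintegral_time_proxGradRIS_le hd hA hΔ hT hmem hmono hdr hlip hsm hε
  · intro n d _ hd S q q' Lq Tq hA hΔ hΛ hT hmem hmono hconc hlip hder hL
    exact CIM.Setting.lintegral_time_upperGradRIS_le hd hA hΔ hΛ hT
      ⟨hmem, hmono, hconc, hlip, hder⟩ hL
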